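/- **Setting.** Let $d\in\{2,3\}$ and let $\Omega\subset\mathbb R^d$ be a bounded open set (for instance a bounded Lipschitz domain) whose closure is decomposed by a mesh $\mathcal T_h$ into the closures of finitely many pairwise disjoint open quadrilaterals or hexahedra $K=T_K((0,1)^d)\subset\Omega$. Each component of $T_K$ is a polynomial of degree at most one in every variable, $T_K$ is injective on $[0,1]^d$ and $\det DT_K\neq0$ there, and each face of an element either lies on $\partial\Omega$ or is a face of exactly one other element. The mesh is quasi-uniform with constant $\kappa$ and mesh size $h>0$: $\|DT_K\|\le\kappa h$ and $\|(DT_K)^{-1}\|\le\kappa/h$ on $[0,1]^d$ for all $K$. Let $\partial\Omega=\Gamma^D_u\cup\Gamma^N_u=\Gamma^D_p\cup\Gamma^N_p$ with $\Gamma^D_u,\Gamma^D_p$ closed, let $\rho,\alpha,c_0>0$, let $\mathbf C=(C_{ijkl})$ with $C_{ijkl}=C_{klij}$ be a constant tensor that is positive definite on symmetric matrices, and let $\mathbf K\in\mathbb R^{d\times d}$ be symmetric and positive definite. For $r\ge2$ let $V_h$ be the space of vector fields in $C(\overline\Omega)^d$ whose pull-back by $T_K$ is in $\mathbb Q_r^d$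 for every $K$. Let $Q_h$ be either $Q_h^{\rm cont}$, the functions in $C(\overline\Omega)$ with pull-backs in $\mathbb Q_{r-1}$, or $Q_h^{\rm disc}$, the piecewise functions (no continuity) with pull-backs in $\mathbb P_{r-1}$, the polynomials of total degree at most $r-1$. Write $\varepsilon(w)=\frac12(\nabla w+\nabla w^\top)$, $\langle\cdot,\cdot\rangle_S$ for the $L^2(S)$ inner product, $\langle\cdot,\cdot\rangle=\langle\cdot,\cdot\rangle_\Omega$, and $n$ for the outer unit normal. Put $h_F=|K|$ on a boundary face $F$ of $K$ and $h_F=\frac12(|K^+|+|K^-|)$ on an interior face $F=\partial K^+\cap\partial K^-$, with $|\cdot|$ the $d$-dimensional volume. On an interior face $\{\!\{w\}\!\}=\frac12(w^++w^-)$, $[\![w]\!]=w^+-w^-$ and $n$ points from $K^+$ to $K^-$; on a boundary face both are the trace of $w$. Let $\mathcal F_h$ be the set of all faces. Define $$a_\gamma(w,\chi)=-\langle w,\mathbf C\varepsilon(\chi)n\rangle_{\Gamma^D_u}+\tfrac{\gamma_a}{h_F}\langle w,\chi\rangle_{\Gamma^D_u},\qquad b_\gamma(q,\psi)=-\langle q,\mathbf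 K\nabla\psi\cdot n\rangle_{\Gamma^D_p}+\tfrac{\gamma_b}{h_F}\langle q,\psi\rangle_{\Gamma^D_p},$$ $$A_\gamma(w,\chi)=\langle\mathbf C\varepsilon(w),\varepsilon(\chi)\rangle-\langle\mathbf C\varepsilon(w)n,\chi\rangle_{\Gamma^D_u}+a_\gamma(w,\chi),\qquad C(\chi,q)=-\alpha\langle\nabla\cdot\chi,q\rangle+\alpha\langle\chi\cdot n,q\rangle_{\Gamma^D_u},$$ where $h_F$ is taken face by face. For $Q_h=Q_h^{\rm cont}$ let $B_\gamma(q,\psi)=\langle\mathbf K\nabla q,\nabla\psi\rangle-\langle\mathbf K\nabla q\cdot n,\psi\rangle_{\Gamma^D_p}+b_\gamma(q,\psi)$, and for $Q_h=Q_h^{\rm disc}$ $$B_\gamma(q,\psi)=\sum_K\langle\mathbf K\nabla q,\nabla\psi\rangle_K-\sum_{F\in\mathcal F_h}\big(\langle\{\!\{\mathbf K\nabla q\}\!\}\cdot n,[\![\psi]\!]\rangle_F+\langle[\![q]\!],\{\!\{\mathbf K\nabla\psi\}\!\}\cdot n\rangle_F\big)+\sum_{F\in\mathcal F_h}\tfrac{\gamma}{h_F}\langle[\![q]\!],[\![\psi]\!]\rangle_F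 .$$ *Data* (at each time in $(0,T]$): arbitrary linear functionals $f$ on $V_h$, $g$ on $Q_h$ and $t_N$ on the traces on $\Gamma^N_u$; functions $u_D,v_D\in L^2(\Gamma^D_u)^d$ (in the applications $v_D=\partial_tu_D$) and $p_D\in L^2(\Gamma^D_p)$; for $Q_h^{\rm cont}$ a linear functional $p_N$ on the traces on $\Gamma^N_p$, and for $Q_h^{\rm disc}$ a function $p_N\in L^2(\Gamma^N_p)$. Put $F_\gamma(\chi)=\langle f,\chi\rangle-\langle t_N,\chi\rangle_{\Gamma^N_u}+a_\gamma(u_D,\chi)$. For $Q_h^{\rm cont}$ put $G_\gamma(\psi)=\langle g,\psi\rangle-\alpha\langle v_D\cdot n,\psi\rangle_{\Gamma^D_u}-\langle p_N,\psi\rangle_{\Gamma^N_p}+b_\gamma(p_D,\psi)$, and for $Q_h^{\rm disc}$ $$G_\gamma(\psi)=\langle g,\psi\rangle-\sum_{F\subset\Gamma^D_u}\alpha\langle v_D\cdot n,\psi\rangle_F-\sum_{F\subset\Gamma^D_p}\langle p_D,\mathbf K\nabla\psi\cdot n\rangle_F+\sum_{F\subset\Gamma^D_p}\tfrac{\gamma}{h_F}\langle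 p_D,\psi\rangle_F-\sum_{F\subset\Gamma^N_p}\langle p_N,\psi\rangle_F ,$$ the sums being over boundary faces. *Local problem.* Let $0=t_0<\dots<t_N=T$, $I_n=(t_{n-1},t_n]$, $k\in\mathbb N_0$, let $\mathbb P_k(I_n;B)$ be the polynomials in time of degree at most $k$ with coefficients in $B$, and let $Q_n$ be the right-sided $(k+1)$-point Gauss–Radau quadrature formula on $I_n$. Given $u^{n-1},v^{n-1}\in V_h$ and $p^{n-1}\in Q_h$, find $(u,v,p)\in\mathbb P_k(I_n;V_h)\times\mathbb P_k(I_n;V_h)\times\mathbb P_k(I_n;Q_h)$ such that $$Q_n\big(\langle\partial_tu,\phi\rangle-\langle v,\phi\rangle\big)+\langle u^+(t_{n-1}),\phi^+(t_{n-1})\rangle=\langle u^{n-1},\phi^+(t_{n-1})\rangle,$$ $$Q_n\big(\langle\rho\partial_tv,\chi\rangle+A_\gamma(u,\chi)+C(\chi,p)\big)+\langle\rho v^+(t_{n-1}),\chi^+(t_{n-1})\rangle=Q_n(F_\gamma(\chi))+\langle\rho v^{n-1},\chi^+(t_{n-1})\rangle,$$ $$Q_n\big(\langle c_0\partial_tp,\psi\rangle-C(v,\psi)+B_\gamma(p,\psi)\big)+\langle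 c_0p^+(t_{n-1}),\psi^+(t_{n-1})\rangle=Q_n(G_\gamma(\psi))+\langle c_0p^{n-1},\psi^+(t_{n-1})\rangle$$ for all $(\phi,\chi,\psi)\in\mathbb P_k(I_n;V_h)\times\mathbb P_k(I_n;V_h)\times\mathbb P_k(I_n;Q_h)$, where $w^+(t_{n-1})$ denotes the right-sided limit. **Lemma (existence and uniqueness).** There is $\gamma_0>0$, depending only on $d,\Omega,\mathbf C,\mathbf K,r$ and $\kappa$ (in particular not on the mesh or its size $h$, the boundary parts, $\rho,\alpha,c_0$, $k$, the time mesh or the data), such that for all $\gamma_a,\gamma_b,\gamma\ge\gamma_0$ and every $n=1,\dots,N$ the local problem on $I_n$ has exactly one solution, both for $Q_h=Q_h^{\rm cont}$ and for $Q_h=Q_h^{\rm disc}$. -/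

import Mathlib

open scoped MeasureTheory

noncomputable section

namespace Biot

/-- `ℝ^d` with the Euclidean norm. -/
abbrev E (d : ℕ) := EuclideanSpace ℝ (Fin d)

/-- The closed reference cell `[0,1]^d`. -/
def refCube (d : ℕ) : Set (E d) := {x | ∀ i, x i ∈ Set.Icc (0 : ℝ) 1}

/-- The open reference cell `(0,1)^d`. -/
def openRefCube (d : ℕ) : Set (E d) := {x | ∀ i, x i ∈ Set.Ioo (0 : ℝ) 1}

/-- The face of the reference cell on which the coordinate `f.1` is `1` (if `f.2 = true`)
or `0` (if `f.2 = false`). -/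
def refFace {d : ℕ} (f : Fin d × Bool) : Set (E d) :=
  {x | x ∈ refCube d ∧ x f.1 = if f.2 then 1 else 0}

/-- The outer unit normal vector of the reference cell on the face `refFace f`. -/
def refNormal {d : ℕ} (f : Fin d × Bool) : E d :=
  EuclideanSpace.single f.1 (if f.2 then (1 : ℝ) else -1)

/-- A decomposition of `Ω` into (mapped) quadrilaterals or hexahedra `K_0, …, K_{n-1}`. The closed
element `K` is the image of the reference cell under `map K`, each component of which is a
polynomial of degree at most one in every variable. -/
structure Mesh (d : ℕ) (Ω : Set (E d)) where
  /-- The number of elements. -/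
  n : ℕ
  /-- The reference maps. -/
  map : Fin n → E d → E d
  multilinear : ∀ K i, ∃ P ∈ MvPolynomial.restrictDegree (Fin d) ℝ 1,
    ∀ x : E d, map K x i = MvPolynomial.eval (fun j => x j) P
  injOn : ∀ K, Set.InjOn (map K) (refCube d)
  det_ne_zero : ∀ K, ∀ x ∈ refCube d, (fderiv ℝ (map K) x).det ≠ 0
  subset : ∀ K, map K '' openRefCube d ⊆ Ω
  disjoint : Pairwise fun K K' => Disjoint (map K '' openRefCube d) (map K' '' openRefCube d)
  cover : ⋃ K, map K '' refCube d = closure Ω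
  /-- Conformity: a face of an element is contained in the boundary of `Ω`, or it is at the same
  time a face of exactly one other element. -/
  conform : ∀ F : Fin n × (Fin d × Bool),
    map F.1 '' refFace F.2 ⊆ frontier Ω ∨
      ∃! F' : Fin n × (Fin d × Bool), F' ≠ F ∧ map F'.1 '' refFace F'.2 = map F.1 '' refFace F.2

namespace Mesh

variable {d : ℕ} {Ω : Set (E d)} (M : Mesh d Ω)

/-- The open element `K`. -/
def elem (K : Fin M.n) : Set (E d) := M.map K '' openRefCube d

/-- The closed element `K`. -/
def closedElem (K : Fin M.n) : Set (E d) := M.map K '' refCube d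

/-- A local face: an element together with a face of the reference cell. -/
abbrev LocalFace := Fin M.n × (Fin d × Bool)

/-- The point set of a local face. -/
def face (F : M.LocalFace) : Set (E d) := M.map F.1 '' refFace F.2

/-- The unit normal on the face `F` of the element `F.1`, pointing out of this element. With
`x = M.map F.1 x̂`, it is the normalization of `(DM(x̂))^{-T} n̂`, where `n̂` is the outer normal of
the reference cell. -/
def normal (F : M.LocalFace) (x : E d) : E d :=
  let xhat := Function.invFunOn (M.map F.1) (refCube d) x
  let m := ContinuousLinearMap.adjoint (fderiv ℝ (M.map F.1) xhat).inverse (refNormal F.2)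
  ‖m‖⁻¹ • m

open Classical in
/-- The boundary faces. -/
def bdFaces : Finset M.LocalFace := {F | M.face F ⊆ frontier Ω}

open Classical in
/-- The boundary faces that lie on the part `Γ` of the boundary. -/
def bdFacesOn (Γ : Set (E d)) : Finset M.LocalFace := {F ∈ M.bdFaces | M.face F ⊆ Γ}

open Classical in
/-- The interior faces `F = ∂K⁺ ∩ ∂K⁻`, given as a face of `K⁺` and the coinciding face of `K⁻`.
Each interior face occurs once: `K⁺` is the element with the smaller index. -/
def intFaces : Finset (M.LocalFace × M.LocalFace) :=
  {F | F.1.1 < F.2.1 ∧ M.face F.1 = M.face F.2 ∧ ¬ M.face F.1 ⊆ frontier Ω}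

/-- `h_F = |K|` on a boundary face. -/
def hBd (F : M.LocalFace) : ℝ := (MeasureTheory.volume (M.elem F.1)).toReal

/-- `h_F = (|K⁺| + |K⁻|) / 2` on an interior face. -/
def hInt (F : M.LocalFace × M.LocalFace) : ℝ := (M.hBd F.1 + M.hBd F.2) / 2

/-- Quasi-uniformity (with shape regularity) of constant `κ` for the mesh size `h`: the reference
maps satisfy `‖DM‖ ≤ κ h` and `‖(DM)⁻¹‖ ≤ κ / h`. -/
def QuasiUniform (κ h : ℝ) : Prop :=
  0 < h ∧ ∀ K, ∀ x ∈ refCube d,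
    ‖fderiv ℝ (M.map K) x‖ ≤ κ * h ∧ ‖(fderiv ℝ (M.map K) x).inverse‖ ≤ κ / h

/-- The `(d-1)`-dimensional surface integral over a set `S`. -/
def surfInt (S : Set (E d)) (w : E d → ℝ) : ℝ :=
  ∫ x in S, w x ∂(MeasureTheory.Measure.euclideanHausdorffMeasure (d - 1))

/-! ### Derivatives of functions on a closed element -/

/-- `∂_j w_i` on the closed element `K`, up to the boundary of `K` (one-sided derivative of the
restriction of `w` to `K`). -/
def partialVec (K : Fin M.n) (w : E d → E d) (i j : Fin d) (x : E d) : ℝ :=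
  (fderivWithin ℝ w (M.closedElem K) x (EuclideanSpace.single j 1)) i

/-- The gradient of the restriction of `q` to the closed element `K`. -/
def gradScal (K : Fin M.n) (q : E d → ℝ) (j : Fin d) (x : E d) : ℝ :=
  fderivWithin ℝ q (M.closedElem K) x (EuclideanSpace.single j 1)

/-- The strain tensor `ε(w) = (∇w + ∇wᵀ)/2` on `K`. -/
def strain (K : Fin M.n) (w : E d → E d) (x : E d) (i j : Fin d) : ℝ :=
  (M.partialVec K w i j x + M.partialVec K w j i x) / 2

/-- The divergence on `K`. -/
def divg (K : Fin M.n) (w : E d → E d) (x : E d) : ℝ := ∑ i, M.partialVec K w i i x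

/-- The stress `C ε(w)` on `K`. -/
def stress (Ct : Fin d → Fin d → Fin d → Fin d → ℝ) (K : Fin M.n) (w : E d → E d) (x : E d)
    (i j : Fin d) : ℝ :=
  ∑ k, ∑ l, Ct i j k l * M.strain K w x k l

/-- `(C ε(w) n) · z` on the face `F`, with the trace of `ε(w)` from the element of `F`. -/
def tractionDot (Ct : Fin d → Fin d → Fin d → Fin d → ℝ) (F : M.LocalFace) (w z : E d → E d)
    (x : E d) : ℝ :=
  ∑ i, (∑ j, M.stress Ct F.1 w x i j * M.normal F x j) * z x i

/-- `K ∇q` on the element `K`. -/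
def flux (Kp : Matrix (Fin d) (Fin d) ℝ) (K : Fin M.n) (q : E d → ℝ) (x : E d) (i : Fin d) : ℝ :=
  ∑ j, Kp i j * M.gradScal K q j x

/-- `K ∇q · n` on the local face `F`, where the trace is taken from the element `K'` and the
normal `n` is the outer one of the element of `F`. -/
def fluxNormal (Kp : Matrix (Fin d) (Fin d) ℝ) (K' : Fin M.n) (F : M.LocalFace) (q : E d → ℝ)
    (x : E d) : ℝ :=
  ∑ i, M.flux Kp K' q x i * M.normal F x i

/-! ### Finite element spaces -/

/-- The space `V_h` of continuous functions on the closure of `Ω` (extended by zero) with mapped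
`ℚ_r^d` restrictions. -/
def Vh (r : ℕ) : Submodule ℝ (E d → E d) where
  carrier := {v | ContinuousOn v (closure Ω) ∧ (∀ x ∉ closure Ω, v x = 0) ∧
    ∀ K i, ∃ P ∈ MvPolynomial.restrictDegree (Fin d) ℝ r,
      ∀ x ∈ refCube d, v (M.map K x) i = MvPolynomial.eval (fun j => x j) P}
  zero_mem' := ⟨continuousOn_const, fun _ _ => rfl, fun _ _ => ⟨0, Submodule.zero_mem _, by simp⟩⟩
  add_mem' := by
    rintro v w ⟨hv, hv0, hvP⟩ ⟨hw, hw0, hwP⟩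
    refine ⟨hv.add hw, fun x hx => by simp [hv0 x hx, hw0 x hx], fun K i => ?_⟩
    obtain ⟨P, hP, h⟩ := hvP K i
    obtain ⟨R, hR, h'⟩ := hwP K i
    exact ⟨P + R, Submodule.add_mem _ hP hR, fun x hx => by simp [h x hx, h' x hx]⟩
  smul_mem' := by
    rintro c v ⟨hv, hv0, hvP⟩
    refine ⟨hv.const_smul c, fun x hx => by simp [hv0 x hx], fun K i => ?_⟩
    obtain ⟨P, hP, h⟩ := hvP K i
    exact ⟨c • P, Submodule.smul_mem _ c hP, fun x hx => by simp [h x hx, MvPolynomial.smul_eval]⟩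

/-- The space of continuous functions on the closure of `Ω` (extended by zero) with mapped `ℚ_s`
restrictions. -/
def QhCont (s : ℕ) : Submodule ℝ (E d → ℝ) where
  carrier := {q | ContinuousOn q (closure Ω) ∧ (∀ x ∉ closure Ω, q x = 0) ∧
    ∀ K, ∃ P ∈ MvPolynomial.restrictDegree (Fin d) ℝ s,
      ∀ x ∈ refCube d, q (M.map K x) = MvPolynomial.eval (fun j => x j) P}
  zero_mem' := ⟨continuousOn_const, fun _ _ => rfl, fun _ => ⟨0, Submodule.zero_mem _, by simp⟩⟩
  add_mem' := by
    rintro v w ⟨hv, hv0, hvP⟩ ⟨hw, hw0, hwP⟩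
    refine ⟨hv.add hw, fun x hx => by simp [hv0 x hx, hw0 x hx], fun K => ?_⟩
    obtain ⟨P, hP, h⟩ := hvP K
    obtain ⟨R, hR, h'⟩ := hwP K
    exact ⟨P + R, Submodule.add_mem _ hP hR, fun x hx => by simp [h x hx, h' x hx]⟩
  smul_mem' := by
    rintro c v ⟨hv, hv0, hvP⟩
    refine ⟨hv.const_smul c, fun x hx => by simp [hv0 x hx], fun K => ?_⟩
    obtain ⟨P, hP, h⟩ := hvP K
    exact ⟨c • P, Submodule.smul_mem _ c hP, fun x hx => by simp [h x hx, MvPolynomial.smul_eval]⟩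

/-- Broken functions: one function on each closed element. They are two-valued on interior faces. -/
abbrev Broken := Fin M.n → E d → ℝ

/-- The broken space with mapped `ℙ_s` restrictions. The restriction of `q` to the closed
element `K` is `q K`, extended by zero. -/
def QhDisc (s : ℕ) : Submodule ℝ M.Broken where
  carrier := {q | ∀ K, (∀ x ∉ M.closedElem K, q K x = 0) ∧
    ∃ P ∈ MvPolynomial.restrictTotalDegree (Fin d) ℝ s,
      ∀ x ∈ refCube d, q K (M.map K x) = MvPolynomial.eval (fun j => x j) P}
  zero_mem' := fun _ => ⟨fun _ _ => rfl, ⟨0, Submodule.zero_mem _, by simp⟩⟩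
  add_mem' := by
    intro v w hv hw K
    obtain ⟨hv0, P, hP, h⟩ := hv K
    obtain ⟨hw0, R, hR, h'⟩ := hw K
    exact ⟨fun x hx => by simp [hv0 x hx, hw0 x hx],
      P + R, Submodule.add_mem _ hP hR, fun x hx => by simp [h x hx, h' x hx]⟩
  smul_mem' := by
    intro c v hv K
    obtain ⟨hv0, P, hP, h⟩ := hv K
    exact ⟨fun x hx => by simp [hv0 x hx],
      c • P, Submodule.smul_mem _ c hP, fun x hx => by simp [h x hx, MvPolynomial.smul_eval]⟩

/-- A function on the closure of `Ω`, considered on each element. -/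
def toBroken (q : E d → ℝ) : M.Broken := fun _ => q

/-! ### Bilinear forms -/

/-- The `L²(Ω)` inner product of scalar (broken) functions. -/
def l2Broken (q ψ : M.Broken) : ℝ := ∑ K, ∫ x in M.elem K, q K x * ψ K x

/-- `a_γ(w, χ) = -⟨w, C ε(χ) n⟩_Γ + (γ_a / h_F) ⟨w, χ⟩_Γ`, for `Γ` the Dirichlet boundary part. -/
def aNitsche (Ct : Fin d → Fin d → Fin d → Fin d → ℝ) (Γ : Set (E d)) (γa : ℝ) (w χ : E d → E d) :
    ℝ :=
  ∑ F ∈ M.bdFaces,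
    (-(surfInt (M.face F ∩ Γ) fun x => M.tractionDot Ct F χ w x)
      + γa / M.hBd F * surfInt (M.face F ∩ Γ) fun x => ∑ i, w x i * χ x i)

/-- `A_γ(w, χ) = ⟨C ε(w), ε(χ)⟩ - ⟨C ε(w) n, χ⟩_Γ + a_γ(w, χ)`. -/
def formA (Ct : Fin d → Fin d → Fin d → Fin d → ℝ) (Γ : Set (E d)) (γa : ℝ) (w χ : E d → E d) : ℝ :=
  (∑ K, ∫ x in M.elem K, ∑ i, ∑ j, M.stress Ct K w x i j * M.strain K χ x i j)
    - (∑ F ∈ M.bdFaces, surfInt (M.face F ∩ Γ) fun x => M.tractionDot Ct F w χ x)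
    + M.aNitsche Ct Γ γa w χ

/-- `C(χ, q) = -α ⟨∇·χ, q⟩ + α ⟨χ·n, q⟩_Γ`. -/
def formC (α : ℝ) (Γ : Set (E d)) (χ : E d → E d) (q : M.Broken) : ℝ :=
  -α * (∑ K, ∫ x in M.elem K, M.divg K χ x * q K x)
    + α * ∑ F ∈ M.bdFaces,
        surfInt (M.face F ∩ Γ) fun x => (∑ i, χ x i * M.normal F x i) * q F.1 x

/-- `b_γ(q, ψ) = -⟨q, K∇ψ·n⟩_Γ + (γ_b / h_F) ⟨q, ψ⟩_Γ`. -/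
def bNitsche (Kp : Matrix (Fin d) (Fin d) ℝ) (Γ : Set (E d)) (γb : ℝ) (q ψ : E d → ℝ) : ℝ :=
  ∑ F ∈ M.bdFaces,
    (-(surfInt (M.face F ∩ Γ) fun x => q x * M.fluxNormal Kp F.1 F ψ x)
      + γb / M.hBd F * surfInt (M.face F ∩ Γ) fun x => q x * ψ x)

/-- `B_γ` for continuous pressures:
`B_γ(q, ψ) = ⟨K∇q, ∇ψ⟩ - ⟨K∇q·n, ψ⟩_Γ + b_γ(q, ψ)`. -/
def formBCont (Kp : Matrix (Fin d) (Fin d) ℝ) (Γ : Set (E d)) (γb : ℝ) (q ψ : E d → ℝ) : ℝ :=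
  (∑ K, ∫ x in M.elem K, ∑ i, M.flux Kp K q x i * M.gradScal K ψ i x)
    - (∑ F ∈ M.bdFaces, surfInt (M.face F ∩ Γ) fun x => M.fluxNormal Kp F.1 F q x * ψ x)
    + M.bNitsche Kp Γ γb q ψ

/-- The jump `q⁺ - q⁻` on an interior face. -/
def jump (F : M.LocalFace × M.LocalFace) (q : M.Broken) (x : E d) : ℝ := q F.1.1 x - q F.2.1 x

/-- The normal component `{{K∇q}}·n` of the average flux on an interior face; `n` points from
`K⁺` to `K⁻`. -/
def avgFluxNormal (Kp : Matrix (Fin d) (Fin d) ℝ) (F : M.LocalFace × M.LocalFace) (q : M.Broken)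
    (x : E d) : ℝ :=
  (M.fluxNormal Kp F.1.1 F.1 (q F.1.1) x + M.fluxNormal Kp F.2.1 F.1 (q F.2.1) x) / 2

/-- `B_γ` for discontinuous pressures, the symmetric interior penalty form. The sum over all faces
is split into the interior ones and the boundary ones, on which the average and the jump are the
one-sided trace. -/
def formBDisc (Kp : Matrix (Fin d) (Fin d) ℝ) (γ : ℝ) (q ψ : M.Broken) : ℝ :=
  (∑ K, ∫ x in M.elem K, ∑ i, M.flux Kp K (q K) x i * M.gradScal K (ψ K) i x)
    + (∑ F ∈ M.intFaces,
        (-((surfInt (M.face F.1) fun x => M.avgFluxNormal Kp F q x * M.jump F ψ x)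
            + surfInt (M.face F.1) fun x => M.jump F q x * M.avgFluxNormal Kp F ψ x)
          + γ / M.hInt F * surfInt (M.face F.1) fun x => M.jump F q x * M.jump F ψ x))
    + ∑ F ∈ M.bdFaces,
        (-((surfInt (M.face F) fun x => M.fluxNormal Kp F.1 F (q F.1) x * ψ F.1 x)
            + surfInt (M.face F) fun x => q F.1 x * M.fluxNormal Kp F.1 F (ψ F.1) x)
          + γ / M.hBd F * surfInt (M.face F) fun x => q F.1 x * ψ F.1 x)

/-! ### Right-hand sides -/

/-- `F_γ(χ) = ⟨f, χ⟩ - ⟨t_N, χ⟩_{Γ_N} + a_γ(u_D, χ)`, where `f` is a linear functional of `χ` and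
`t_N` is a linear functional of the trace of `χ` on `ΓN`. -/
def rhsF (Ct : Fin d → Fin d → Fin d → Fin d → ℝ) (ΓD ΓN : Set (E d)) (γa : ℝ)
    (f : (E d → E d) →ₗ[ℝ] ℝ) (tN : (ΓN → E d) →ₗ[ℝ] ℝ) (uD χ : E d → E d) : ℝ :=
  f χ - tN (fun x => χ x) + M.aNitsche Ct ΓD γa uD χ

/-- `G_γ` for continuous pressures:
`⟨g, ψ⟩ - α ⟨v_D·n, ψ⟩_{Γ_u^D} - ⟨p_N, ψ⟩_{Γ_p^N} + b_γ(p_D, ψ)`. -/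
def rhsGCont (α : ℝ) (Kp : Matrix (Fin d) (Fin d) ℝ) (ΓuD ΓpD ΓpN : Set (E d)) (γb : ℝ)
    (g : (E d → ℝ) →ₗ[ℝ] ℝ) (pN : (ΓpN → ℝ) →ₗ[ℝ] ℝ) (vD : E d → E d) (pD ψ : E d → ℝ) : ℝ :=
  g ψ
    - α * (∑ F ∈ M.bdFaces,
        surfInt (M.face F ∩ ΓuD) fun x => (∑ i, vD x i * M.normal F x i) * ψ x)
    - pN (fun x => ψ x)
    + M.bNitsche Kp ΓpD γb pD ψ

/-- `G_γ` for discontinuous pressures. -/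
def rhsGDisc (α : ℝ) (Kp : Matrix (Fin d) (Fin d) ℝ) (ΓuD ΓpD ΓpN : Set (E d)) (γ : ℝ)
    (g : M.Broken →ₗ[ℝ] ℝ) (pN : E d → ℝ) (vD : E d → E d) (pD : E d → ℝ) (ψ : M.Broken) : ℝ :=
  g ψ
    - (∑ F ∈ M.bdFacesOn ΓuD,
        α * surfInt (M.face F) fun x => (∑ i, vD x i * M.normal F x i) * ψ F.1 x)
    - (∑ F ∈ M.bdFacesOn ΓpD,
        surfInt (M.face F) fun x => pD x * M.fluxNormal Kp F.1 F (ψ F.1) x)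
    + (∑ F ∈ M.bdFacesOn ΓpD, γ / M.hBd F * surfInt (M.face F) fun x => pD x * ψ F.1 x)
    - ∑ F ∈ M.bdFacesOn ΓpN, surfInt (M.face F) fun x => pN x * ψ F.1 x

end Mesh

/-! ### Discretization in time -/

/-- `ℙ_k(I; B)`: polynomials in time of degree at most `k` with coefficients in `B`. A polynomial
on an interval of positive length is identified with its unique polynomial extension to `ℝ`; in
particular `w a` is the right-sided limit at the left end point `a` of the interval. -/
def polyTime {X : Type*} [AddCommGroup X] [Module ℝ X] (k : ℕ) (B : Submodule ℝ X) :
    Submodule ℝ (ℝ → X) where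
  carrier := {w | ∃ W : Fin (k + 1) → X, (∀ j, W j ∈ B) ∧ ∀ t, w t = ∑ j : Fin (k + 1), t ^ (j : ℕ) • W j}
  zero_mem' := ⟨0, fun _ => B.zero_mem, fun t => by simp⟩
  add_mem' := by
    rintro v w ⟨V, hV, hv⟩ ⟨W, hW, hw⟩
    exact ⟨V + W, fun j => B.add_mem (hV j) (hW j),
      fun t => by simp [hv t, hw t, Finset.sum_add_distrib]⟩
  smul_mem' := by
    rintro c v ⟨V, hV, hv⟩
    exact ⟨c • V, fun j => B.smul_mem c (hV j),
      fun t => by simp [hv t, Finset.smul_sum, smul_comm c]⟩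

open Polynomial in
/-- The right Radau polynomial of degree `k + 1` on `[-1,1]` (up to a factor), by Rodrigues'
formula `dᵏ/dxᵏ ((x-1)^{k+1} (x+1)^k)`. -/
def radauPoly (k : ℕ) : ℝ[X] := derivative^[k] ((X - 1) ^ (k + 1) * (X + 1) ^ k)

/-- The nodes of the right-sided `(k+1)`-point Gauss-Radau quadrature formula on `[-1,1]`. -/
def radauNodes (k : ℕ) : Finset ℝ := (radauPoly k).roots.toFinset

/-- The weights of the formula: the integrals of the Lagrange basis polynomials. -/
def radauWeight (k : ℕ) (t : ℝ) : ℝ :=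
  ∫ x in (-1 : ℝ)..1, (Lagrange.basis (radauNodes k) id t).eval x

/-- The Gauss-Radau formula `Q_n` on the interval `(a, b]`. -/
def radauQuad (k : ℕ) (a b : ℝ) (w : ℝ → ℝ) : ℝ :=
  (b - a) / 2 * ∑ t ∈ radauNodes k, radauWeight k t * w ((a + b) / 2 + (b - a) / 2 * t)

/-- The (componentwise) time derivative of a function of time and space. -/
def dtVec {d : ℕ} (u : ℝ → E d → E d) (t : ℝ) (x : E d) : E d := deriv (fun s => u s x) t

/-- The `L²(Ω)` inner product of vector fields. -/
def l2Vec {d : ℕ} (Ω : Set (E d)) (w χ : E d → E d) : ℝ := ∫ x in Ω, ∑ i, w x i * χ x i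

namespace Mesh

variable {d : ℕ} {Ω : Set (E d)} (M : Mesh d Ω)

/-- The time derivative of a broken function of time and space. -/
def dtBroken (p : ℝ → M.Broken) (t : ℝ) : M.Broken := fun K x => deriv (fun s => p s K x) t

/-- The numerically integrated local problem on `(a, b]`: `U = (u, v, p)` is a solution in
`ℙ_k(V) × ℙ_k(V) × ℙ_k(Q)` for the given values `(u₀, v₀, p₀)` at the time `a`.

The pressures are elements of a vector space `X`, with `br` giving their restrictions to the
elements; `A`, `C`, `B` are the bilinear forms and `Fr t`, `G t` the right-hand sides at the
time `t`. -/
def IsSolution {X : Type*} [AddCommGroup X] [Module ℝ X] (br : X → M.Broken)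
    (ρ c₀ : ℝ) (k : ℕ) (a b : ℝ)
    (V : Submodule ℝ (E d → E d)) (Q : Submodule ℝ X)
    (A : (E d → E d) → (E d → E d) → ℝ) (C : (E d → E d) → M.Broken → ℝ) (B : X → X → ℝ)
    (Fr : ℝ → (E d → E d) → ℝ) (G : ℝ → X → ℝ)
    (u₀ v₀ : E d → E d) (p₀ : X)
    (U : (ℝ → E d → E d) × (ℝ → E d → E d) × (ℝ → X)) : Prop :=
  let u := U.1
  let v := U.2.1
  let p := U.2.2
  u ∈ polyTime k V ∧ v ∈ polyTime k V ∧ p ∈ polyTime k Q ∧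
  (∀ φ ∈ polyTime k V,
    radauQuad k a b (fun t => l2Vec Ω (dtVec u t) (φ t) - l2Vec Ω (v t) (φ t))
      + l2Vec Ω (u a) (φ a) = l2Vec Ω u₀ (φ a)) ∧
  (∀ χ ∈ polyTime k V,
    radauQuad k a b (fun t => ρ * l2Vec Ω (dtVec v t) (χ t) + A (u t) (χ t) + C (χ t) (br (p t)))
      + ρ * l2Vec Ω (v a) (χ a)
      = radauQuad k a b (fun t => Fr t (χ t)) + ρ * l2Vec Ω v₀ (χ a)) ∧
  (∀ ψ ∈ polyTime k Q,
    radauQuad k a b (fun t => c₀ * M.l2Broken (M.dtBroken (fun s => br (p s)) t) (br (ψ t))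
        - C (v t) (br (ψ t)) + B (p t) (ψ t))
      + c₀ * M.l2Broken (br (p a)) (br (ψ a))
      = radauQuad k a b (fun t => G t (ψ t)) + c₀ * M.l2Broken (br p₀) (br (ψ a)))

end Mesh

end Biot

end

/-! On each time interval the problem is a square linear system for the coefficients in time, which
lie in finite-dimensional spaces. Existence therefore follows from uniqueness
(`existsUnique_localForm`, `localForm_eq_zero`).

Uniqueness is an energy argument. Let `R` represent `A_γ` in the L² product, and test the
homogeneous problem with `(R u, v, p)`. The operator `R` turns the first equation into one in `A_γ`,
so its elastic term cancels against that of the second equation, and the coupling form cancels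
between the second and the third. The Radau formula is exact up to degree `2k`, so the terms with
time derivatives become differences of end values. Together with the jump terms, what is left is
half the energy at both ends plus `Q_n(B_γ(p,p))`, a sum of nonnegative numbers equal to zero. Hence
`v` and `p` vanish at the left end and `u` lies there in the radical of `A_γ`. The jump terms drop
out, and a residual of degree at most `k` that is Radau-orthogonal to all polynomials of degree at
most `k` vanishes at `k+1` nodes, hence identically. The equations thus hold at all times, the first
one tested through `A_γ`. The energy does not increase and starts from zero, so `v = p = 0`; the
first equation tested with the mass form then gives `u = 0`. Only the mass forms have to be
definite. For `A_γ` and `B_γ` semidefiniteness is enough, so no Korn or Poincaré inequality and no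
condition on the size of the Dirichlet parts is involved.

Semidefiniteness is where `γ₀` enters (`QuasiUniform.formA_nonneg`, `QuasiUniform.formBCont_nonneg`,
`QuasiUniform.formBDisc_nonneg`). Young's inequality splits the consistency terms into the penalty
and `h_F` times the squared flux on the faces, and the trace inequality `exists_trace_le` bounds the
latter by the energy in the elements. Its constant does not depend on the mesh because derivatives
of mapped polynomials are polynomials of bounded degree divided by the Jacobian determinant
(`IsMapped.gradScal`), so one equivalence of norms on the reference cell serves all elements. Since
`h_F` is a volume, of order `h^d` and not `h`, a factor `h^(d-1)` is left over. It is bounded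
because an element has to fit into the bounded set `Ω`, which is how `γ₀` comes to depend on `Ω`. -/

noncomputable section

namespace Biot

/-! ### The right-sided Gauss-Radau formula -/

section Radau

open Polynomial

/-- The polynomial whose `k`-th derivative is the Radau polynomial. -/
def radauGen (k : ℕ) : ℝ[X] := (X - 1) ^ (k + 1) * (X + 1) ^ k

lemma radauPoly_eq (k : ℕ) : radauPoly k = derivative^[k] (radauGen k) := rfl

lemma radauGen_monic (k : ℕ) : (radauGen k).Monic :=
  ((monic_X_sub_C (1 : ℝ)).pow _).mul ((monic_X_add_C (1 : ℝ)).pow _)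

lemma natDegree_radauGen (k : ℕ) : (radauGen k).natDegree = 2 * k + 1 := by
  have h1 : (X - 1 : ℝ[X]) = X - C 1 := by simp
  have h2 : (X + 1 : ℝ[X]) = X + C 1 := by simp
  rw [radauGen, h1, h2, Monic.natDegree_mul ((monic_X_sub_C _).pow _) ((monic_X_add_C _).pow _)]
  simp only [natDegree_pow, natDegree_X_sub_C, natDegree_X_add_C]
  ring

lemma iterate_derivative_radauGen_ne_zero {k j : ℕ} (hj : j ≤ 2 * k + 1) :
    derivative^[j] (radauGen k) ≠ 0 := by
  intro h
  have := congrArg (fun p => coeff p (2 * k + 1 - j)) h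
  simp only [coeff_iterate_derivative, coeff_zero, Nat.sub_add_cancel hj] at this
  have hc : (radauGen k).coeff (2 * k + 1) = 1 := by
    rw [← natDegree_radauGen]; exact radauGen_monic k
  rw [hc, nsmul_eq_mul, mul_one, Nat.cast_eq_zero, Nat.descFactorial_eq_zero_iff_lt] at this
  omega

/-- Each derivative costs one order of the zero of order `k+1` at `1`, so a zero survives up to `j =
k`. At `-1` the order is only `k`, and the last derivative may lose the zero; this asymmetry makes
the formula right-sided. -/
lemma eval_one_iterate_derivative_radauGen {k j : ℕ} (hj : j ≤ k) :
    (derivative^[j] (radauGen k)).eval 1 = 0 := by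
  have h : (X - 1 : ℝ[X]) ^ (k + 1 - j) ∣ derivative^[j] (radauGen k) :=
    pow_sub_dvd_iterate_derivative_of_pow_dvd j (dvd_mul_right _ _)
  refine eval_eq_zero_of_dvd_of_eval_eq_zero h ?_
  simp [show k + 1 - j ≠ 0 by omega]

lemma eval_neg_one_iterate_derivative_radauGen {k j : ℕ} (hj : j < k) :
    (derivative^[j] (radauGen k)).eval (-1) = 0 := by
  have h : (X + 1 : ℝ[X]) ^ (k - j) ∣ derivative^[j] (radauGen k) :=
    pow_sub_dvd_iterate_derivative_of_pow_dvd j (dvd_mul_left _ _)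
  refine eval_eq_zero_of_dvd_of_eval_eq_zero h ?_
  simp [show k - j ≠ 0 by omega]

lemma mem_roots_iterate_derivative_radauGen {k j : ℕ} (hj : j ≤ 2 * k + 1) {x : ℝ} :
    x ∈ (derivative^[j] (radauGen k)).roots.toFinset ↔
      (derivative^[j] (radauGen k)).eval x = 0 := by
  simp [iterate_derivative_radauGen_ne_zero hj]

/-- Induction by Rolle: `j+2` distinct roots force at least `j+1` roots of the derivative that were
not roots before. The points `1` and `-1` remain roots as long as the order of the derivative is
below `k`, and they are not among the new ones. -/
lemma card_roots_iterate_derivative_radauGen {k : ℕ} : ∀ j, j + 1 ≤ k →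
    j + 2 ≤ (derivative^[j] (radauGen k)).roots.toFinset.card
  | 0, hk => by
    have : ({1, -1} : Finset ℝ) ⊆ (derivative^[0] (radauGen k)).roots.toFinset := by
      intro x hx
      rw [mem_roots_iterate_derivative_radauGen (by omega)]
      rcases Finset.mem_insert.1 hx with rfl | hx
      · exact eval_one_iterate_derivative_radauGen (by omega)
      · rw [Finset.mem_singleton.1 hx]
        exact eval_neg_one_iterate_derivative_radauGen (by omega)
    have h := Finset.card_le_card this
    rwa [Finset.card_pair (by norm_num)] at h
  | j + 1, hk => by
    have ih := card_roots_iterate_derivative_radauGen (k := k) j (by omega)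
    have hR := card_roots_toFinset_le_card_roots_derivative_sdiff_roots_succ
      (derivative^[j] (radauGen k))
    rw [← Function.iterate_succ_apply' derivative] at hR
    set S := (derivative^[j + 1] (radauGen k)).roots.toFinset \
      (derivative^[j] (radauGen k)).roots.toFinset with hS
    have hm : ∀ x ∈ ({1, -1} : Finset ℝ), ∀ i ≤ j + 1,
        x ∈ (derivative^[i] (radauGen k)).roots.toFinset := by
      intro x hx i hi
      rw [mem_roots_iterate_derivative_radauGen (by omega)]
      rcases Finset.mem_insert.1 hx with rfl | hx
      · exact eval_one_iterate_derivative_radauGen (by omega)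
      · rw [Finset.mem_singleton.1 hx]
        exact eval_neg_one_iterate_derivative_radauGen (by omega)
    have hd : Disjoint ({1, -1} : Finset ℝ) S :=
      Finset.disjoint_left.2 fun x hx hxS => (Finset.mem_sdiff.1 hxS).2 (hm x hx j (by omega))
    have hsub : ({1, -1} : Finset ℝ) ∪ S ⊆ (derivative^[j + 1] (radauGen k)).roots.toFinset :=
      Finset.union_subset (fun x hx => hm x hx _ le_rfl) Finset.sdiff_subset
    have h := Finset.card_le_card hsub
    rw [Finset.card_union_of_disjoint hd, Finset.card_pair (by norm_num)] at h
    omega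

lemma radauPoly_ne_zero (k : ℕ) : radauPoly k ≠ 0 :=
  iterate_derivative_radauGen_ne_zero (by omega)

lemma natDegree_radauPoly_le (k : ℕ) : (radauPoly k).natDegree ≤ k + 1 := by
  have := natDegree_iterate_derivative (radauGen k) k
  rw [natDegree_radauGen] at this
  rw [radauPoly_eq]
  omega

lemma one_mem_radauNodes (k : ℕ) : (1 : ℝ) ∈ radauNodes k :=
  (mem_roots_iterate_derivative_radauGen (by omega)).2
    (eval_one_iterate_derivative_radauGen le_rfl)

/-- The degree gives the upper bound. For the lower bound Rolle is applied once more, to the last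
derivative before the Radau polynomial: now only the endpoint `1` persists as a root, and it adds
one to the roots gained in between. -/
lemma card_radauNodes (k : ℕ) : (radauNodes k).card = k + 1 := by
  refine le_antisymm ?_ ?_
  · exact (Multiset.toFinset_card_le _).trans ((card_roots' _).trans (natDegree_radauPoly_le k))
  · rcases k with _ | k
    · exact Finset.card_pos.2 ⟨1, one_mem_radauNodes 0⟩
    · have hc := card_roots_iterate_derivative_radauGen (k := k + 1) k le_rfl
      have hR := card_roots_toFinset_le_card_roots_derivative_sdiff_roots_succ
        (derivative^[k] (radauGen (k + 1)))
      rw [← Function.iterate_succ_apply' derivative] at hR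
      have h1 : (1 : ℝ) ∈ (derivative^[k] (radauGen (k + 1))).roots.toFinset :=
        (mem_roots_iterate_derivative_radauGen (by omega)).2
          (eval_one_iterate_derivative_radauGen (by omega))
      set S := (derivative^[k + 1] (radauGen (k + 1))).roots.toFinset \
        (derivative^[k] (radauGen (k + 1))).roots.toFinset with hS
      have h1S : (1 : ℝ) ∉ S := fun h => (Finset.mem_sdiff.1 h).2 h1
      have h := Finset.card_le_card (Finset.insert_subset (one_mem_radauNodes (k + 1))
        (Finset.sdiff_subset : S ⊆ _))
      rw [Finset.card_insert_of_notMem h1S] at h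
      omega

lemma intervalIntegrable_eval (p : ℝ[X]) (a b : ℝ) :
    IntervalIntegrable (fun x => p.eval x) MeasureTheory.volume a b :=
  p.continuous.intervalIntegrable a b

lemma integral_eval_derivative (p : ℝ[X]) (a b : ℝ) :
    ∫ x in a..b, (derivative p).eval x = p.eval b - p.eval a :=
  intervalIntegral.integral_eq_sub_of_hasDerivAt (fun x _ => p.hasDerivAt x)
    (intervalIntegrable_eval _ _ _)

lemma integral_eval_derivative_mul (p q : ℝ[X]) (h1 : p.eval 1 = 0) (h2 : p.eval (-1) = 0) :
    ∫ x in (-1 : ℝ)..1, (derivative p * q).eval x =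
      - ∫ x in (-1 : ℝ)..1, (p * derivative q).eval x := by
  have h := integral_eval_derivative (p * q) (-1) 1
  rw [derivative_mul] at h
  simp only [eval_add] at h
  rw [intervalIntegral.integral_add (intervalIntegrable_eval _ _ _)
    (intervalIntegrable_eval _ _ _)] at h
  simp only [eval_mul, h1, h2, zero_mul, sub_zero] at h ⊢
  linarith

/-- Integration by parts `j` times: the boundary terms contain derivatives of order below `k`, which
vanish at both ends, while the degree of `q` falls with each step. For `j = k` this is the
orthogonality of the Radau polynomial to degrees below `k`. -/
lemma integral_iterate_derivative_radauGen_mul {k : ℕ} : ∀ j ≤ k, ∀ q : ℝ[X], q.degree < j →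
    ∫ x in (-1 : ℝ)..1, (derivative^[j] (radauGen k) * q).eval x = 0
  | 0, _, q, hq => by
    have : q = 0 := by simpa using hq
    simp [this]
  | j + 1, hj, q, hq => by
    rw [Function.iterate_succ_apply', integral_eval_derivative_mul _ _
      (eval_one_iterate_derivative_radauGen (by omega))
      (eval_neg_one_iterate_derivative_radauGen (by omega)),
      integral_iterate_derivative_radauGen_mul j (by omega), neg_zero]
    by_cases h0 : q = 0
    · simp [h0]
    by_cases hd : derivative q = 0
    · simp [hd]
    · have h3 := degree_derivative_lt h0
      rw [degree_eq_natDegree h0] at h3 hq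
      rw [degree_eq_natDegree hd] at h3 ⊢
      norm_cast at h3 hq ⊢
      omega

/-- The Gauss-Radau formula on `[-1,1]` is exact for polynomials of degree at most `2k`. -/
lemma sum_radauWeight_mul_eval {k : ℕ} (p : ℝ[X]) (hp : p.natDegree ≤ 2 * k) :
    ∑ t ∈ radauNodes k, radauWeight k t * p.eval t = ∫ x in (-1 : ℝ)..1, p.eval x := by
  set N := Lagrange.nodal (radauNodes k) (id : ℝ → ℝ) with hN
  have hNm : N.Monic := Lagrange.nodal_monic
  have hNd : N.natDegree = k + 1 := by rw [hN, Lagrange.natDegree_nodal, card_radauNodes]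
  -- All `k+1` nodes are roots of `radauPoly k`, whose degree is at most `k+1`. The cofactor is
  -- therefore constant, and `N` inherits the orthogonality to degrees below `k`.
  have hdvd : N ∣ radauPoly k := by
    have : (Multiset.map (fun a => X - C a) (radauNodes k).val).prod = N := by
      rw [hN, Lagrange.nodal_eq]; rfl
    rw [← this]
    refine (Multiset.prod_X_sub_C_dvd_iff_le_roots (radauPoly_ne_zero k) _).2 ?_
    exact Multiset.dedup_le _
  obtain ⟨c, hc⟩ := hdvd
  have hc0 : c ≠ 0 := fun h => radauPoly_ne_zero k (by rw [hc, h, mul_zero])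
  have hcd : c.natDegree = 0 := by
    have h1 := natDegree_radauPoly_le k
    rw [hc, hNm.natDegree_mul' hc0, hNd] at h1
    omega
  obtain ⟨c', rfl⟩ : ∃ c', c = C c' := ⟨_, eq_C_of_natDegree_eq_zero hcd⟩
  have hc0' : c' ≠ 0 := by simpa using hc0
  have hNR : N = C c'⁻¹ * radauPoly k := by
    rw [hc, mul_comm N, ← mul_assoc, ← C_mul, inv_mul_cancel₀ hc0', C_1, one_mul]
  -- Division with remainder. The quotient has degree below `k` (it is zero for `k = 0`), so `N * q`
  -- has integral zero and vanishes at the nodes. The remainder has degree at most `k`, hence equals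
  -- its interpolant, for which the weights are exact by definition.
  set q := p /ₘ N
  set r := p %ₘ N
  have hpqr : r + N * q = p := modByMonic_add_div p N
  have hr : r.degree < (radauNodes k).card := by
    have := degree_modByMonic_lt p hNm
    rwa [hN, Lagrange.degree_nodal] at this
  have hq : ∫ x in (-1 : ℝ)..1, (N * q).eval x = 0 := by
    have : N * q = radauPoly k * (C c'⁻¹ * q) := by rw [hNR]; ring
    rw [this, radauPoly_eq]
    refine integral_iterate_derivative_radauGen_mul k le_rfl _ ?_
    by_cases hq0 : q = 0
    · simp [hq0]
    · have h1 : q.natDegree = p.natDegree - N.natDegree := natDegree_divByMonic p hNm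
      have h2 : N.degree ≤ p.degree := by
        by_contra h
        exact hq0 ((divByMonic_eq_zero_iff hNm).2 (not_le.1 h))
      have h3 : N.natDegree ≤ p.natDegree := natDegree_le_natDegree h2
      refine (degree_C_mul (by positivity)).trans_lt ?_
      rw [degree_eq_natDegree hq0]
      norm_cast
      omega
  have hint : r = ∑ t ∈ radauNodes k, C (r.eval t) * Lagrange.basis (radauNodes k) id t := by
    have := Lagrange.eq_interpolate (s := radauNodes k) (v := id) Function.injective_id.injOn hr
    rw [Lagrange.interpolate_apply] at this
    exact this
  have h1 : ∫ x in (-1 : ℝ)..1, p.eval x = ∫ x in (-1 : ℝ)..1, r.eval x := by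
    rw [← hpqr]
    simp only [eval_add]
    rw [intervalIntegral.integral_add (intervalIntegrable_eval _ _ _)
      (intervalIntegrable_eval _ _ _), hq, add_zero]
  rw [h1]
  have h2 : ∫ x in (-1 : ℝ)..1, r.eval x
      = ∑ t ∈ radauNodes k, radauWeight k t * r.eval t := by
    conv_lhs => rw [hint]
    simp only [eval_finsetSum, eval_mul, eval_C]
    rw [intervalIntegral.integral_finsetSum]
    · refine Finset.sum_congr rfl fun t _ => ?_
      rw [intervalIntegral.integral_const_mul, radauWeight, mul_comm]
    · exact fun t _ => (intervalIntegrable_eval _ _ _).const_mul _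
  rw [h2]
  refine Finset.sum_congr rfl fun t ht => ?_
  have hN0 : N.eval t = 0 := Lagrange.eval_nodal_at_node (v := id) ht
  rw [← hpqr, eval_add, eval_mul, hN0, zero_mul, add_zero]

lemma integral_eval_pos {p : ℝ[X]} (hp : p ≠ 0)
    (hpos : ∀ x ∈ Set.Ioc (-1 : ℝ) 1, 0 ≤ p.eval x) : 0 < ∫ x in (-1 : ℝ)..1, p.eval x := by
  obtain ⟨c, hc, hc0⟩ : ∃ c ∈ Set.Ioo (-1 : ℝ) 1, p.eval c ≠ 0 := by
    by_contra! h
    exact hp (Polynomial.eq_zero_of_infinite_isRoot p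
      ((Set.Ioo_infinite (by norm_num : (-1 : ℝ) < 1)).mono fun x hx => h x hx))
  exact intervalIntegral.integral_pos (by norm_num) p.continuous.continuousOn hpos
    ⟨c, ⟨hc.1.le, hc.2.le⟩, (hpos c ⟨hc.1, hc.2.le⟩).lt_of_ne' hc0⟩

/-- Exactness for the square of a Lagrange basis polynomial, of degree `2k`, identifies the weight
with the integral of that square. -/
lemma radauWeight_pos {k : ℕ} {t : ℝ} (ht : t ∈ radauNodes k) : 0 < radauWeight k t := by
  set l := Lagrange.basis (radauNodes k) (id : ℝ → ℝ) t with hl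
  have hinj : Set.InjOn (id : ℝ → ℝ) (radauNodes k) := Function.injective_id.injOn
  have hd : l.natDegree = k := by
    rw [hl, Lagrange.natDegree_basis hinj ht, card_radauNodes]; rfl
  have hl0 : l ≠ 0 := Lagrange.basis_ne_zero hinj ht
  have h := sum_radauWeight_mul_eval (k := k) (l * l) (natDegree_mul_le.trans (by omega))
  rw [Finset.sum_eq_single t] at h
  · have h1 : l.eval t = 1 := Lagrange.eval_basis_self (v := id) hinj ht
    rw [eval_mul, h1, mul_one, mul_one] at h
    rw [h]
    exact integral_eval_pos (mul_ne_zero hl0 hl0) fun x _ => by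
      rw [eval_mul]; exact mul_self_nonneg _
  · intro s hs hst
    have h0 : l.eval s = 0 := Lagrange.eval_basis_of_ne (v := id) hst.symm hs
    simp [h0]
  · exact fun h => absurd ht h

/-- The Gauss-Radau nodes lie in `(-1,1]`. -/
lemma radauNodes_subset {k : ℕ} {t : ℝ} (ht : t ∈ radauNodes k) : t ∈ Set.Ioc (-1 : ℝ) 1 := by
  by_contra hmem
  have ht1 : t ≠ 1 := by rintro rfl; exact hmem ⟨by norm_num, le_rfl⟩
  set S := ((radauNodes k).erase t).erase 1
  have hS : S.card + 1 = k := by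
    rw [Finset.card_erase_of_mem (Finset.mem_erase.2 ⟨ht1.symm, one_mem_radauNodes k⟩),
      Finset.card_erase_of_mem ht, card_radauNodes]
    have h2 : ({1, t} : Finset ℝ) ⊆ radauNodes k :=
      Finset.insert_subset (one_mem_radauNodes k) (Finset.singleton_subset_iff.2 ht)
    have h3 := Finset.card_le_card h2
    rw [Finset.card_pair ht1.symm, card_radauNodes] at h3
    omega
  set w := Lagrange.nodal S (id : ℝ → ℝ) with hw
  have hw0 : w ≠ 0 := Lagrange.nodal_ne_zero
  have hwd : w.natDegree = S.card := Lagrange.natDegree_nodal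
  -- The test polynomial vanishes at every node and has degree at most `2 + 2(k-1) = 2k`, so its
  -- integral is zero. If `t` were outside `(-1,1]`, it would have constant sign on `(-1,1]` without
  -- being zero.
  set p := (C 1 - X : ℝ[X]) * (X - C t) * (w * w) with hp
  have hx1 : (C 1 - X : ℝ[X]) ≠ 0 := by
    rw [← neg_ne_zero, neg_sub]; exact X_sub_C_ne_zero 1
  have hp0 : p ≠ 0 := mul_ne_zero (mul_ne_zero hx1 (X_sub_C_ne_zero t)) (mul_ne_zero hw0 hw0)
  have hpd : p.natDegree ≤ 2 * k := by
    have h1 : (C 1 - X : ℝ[X]).natDegree ≤ 1 := by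
      rw [← natDegree_neg, neg_sub, natDegree_X_sub_C]
    have h2 := natDegree_mul_le (p := (C 1 - X : ℝ[X]) * (X - C t)) (q := w * w)
    have h3 := natDegree_mul_le (p := (C 1 - X : ℝ[X])) (q := X - C t)
    have h4 := natDegree_mul_le (p := w) (q := w)
    rw [natDegree_X_sub_C] at h3
    rw [← hp] at h2
    omega
  have hev : ∀ x, p.eval x = (1 - x) * (x - t) * (w.eval x * w.eval x) := fun x => by simp [hp]
  have h := sum_radauWeight_mul_eval p hpd
  rw [Finset.sum_eq_zero] at h
  · rw [Set.mem_Ioc, not_and_or, not_lt, not_le] at hmem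
    rcases hmem with hm | hm
    · have := integral_eval_pos hp0 fun x hx => by
        rw [hev]
        exact mul_nonneg (mul_nonneg (by linarith [hx.2]) (by linarith [hx.1]))
          (mul_self_nonneg _)
      linarith
    · have := integral_eval_pos (neg_ne_zero.2 hp0) fun x hx => by
        rw [eval_neg, hev, ← neg_mul, ← mul_neg]
        exact mul_nonneg (mul_nonneg (by linarith [hx.2]) (by linarith [hx.2]))
          (mul_self_nonneg _)
      simp only [eval_neg] at this
      rw [intervalIntegral.integral_neg] at this
      linarith
  · intro s hs
    rw [hev]
    by_cases h1 : s = 1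
    · simp [h1]
    by_cases h2 : s = t
    · simp [h2]
    · have : w.eval s = 0 := Lagrange.eval_nodal_at_node (v := id)
        (Finset.mem_erase.2 ⟨h1, Finset.mem_erase.2 ⟨h2, hs⟩⟩)
      simp [this]

/-- The nodes of the Gauss-Radau formula on `(a,b]`. -/
def quadNode (a b t : ℝ) : ℝ := (a + b) / 2 + (b - a) / 2 * t

/-- The weights of the Gauss-Radau formula on `(a,b]`. -/
def quadWeight (k : ℕ) (a b t : ℝ) : ℝ := (b - a) / 2 * radauWeight k t

lemma radauQuad_eq (k : ℕ) (a b : ℝ) (w : ℝ → ℝ) :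
    radauQuad k a b w = ∑ t ∈ radauNodes k, quadWeight k a b t * w (quadNode a b t) := by
  simp only [radauQuad, quadWeight, quadNode, Finset.mul_sum, mul_assoc]

lemma quadWeight_pos {k : ℕ} {a b t : ℝ} (hab : a < b) (ht : t ∈ radauNodes k) :
    0 < quadWeight k a b t :=
  mul_pos (by linarith) (radauWeight_pos ht)

lemma quadNode_injective {a b : ℝ} (hab : a < b) : Function.Injective (quadNode a b) := by
  intro s t h
  have h2 : (b - a) / 2 ≠ 0 := by linarith
  exact mul_left_cancel₀ h2 (add_left_cancel h)

/-- The data are constrained only at times in `(0,T]`; it matters that the left end point is never a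
node. -/
lemma quadNode_mem {k : ℕ} {a b t : ℝ} (hab : a < b) (ht : t ∈ radauNodes k) :
    quadNode a b t ∈ Set.Ioc a b := by
  obtain ⟨h1, h2⟩ := radauNodes_subset ht
  constructor <;> unfold quadNode <;> nlinarith

/-- The Gauss-Radau formula integrates the derivative of a polynomial of degree at most `2k + 1`
exactly. -/
lemma radauQuad_derivative {k : ℕ} {a b : ℝ} (hab : a < b) (p : ℝ[X])
    (hp : p.natDegree ≤ 2 * k + 1) :
    radauQuad k a b (fun t => (derivative p).eval t) = p.eval b - p.eval a := by
  set m : ℝ[X] := C ((a + b) / 2) + C ((b - a) / 2) * X with hm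
  have h2 : (b - a) / 2 ≠ 0 := by linarith
  have hmd : m.natDegree ≤ 1 := by
    rw [hm, add_comm]; exact natDegree_linear_le
  have hd : derivative (p.comp m) = C ((b - a) / 2) * (derivative p).comp m := by
    rw [derivative_comp]; simp [hm]
  have hdd : (derivative (p.comp m)).natDegree ≤ 2 * k := by
    refine (natDegree_derivative_le _).trans ?_
    rw [natDegree_comp]
    have : p.natDegree * m.natDegree ≤ p.natDegree * 1 := Nat.mul_le_mul_left _ hmd
    omega
  have h := sum_radauWeight_mul_eval _ hdd
  rw [integral_eval_derivative] at h
  have e1 : (p.comp m).eval 1 = p.eval b := by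
    rw [eval_comp]; congr 1; simp [hm]; ring
  have e2 : (p.comp m).eval (-1) = p.eval a := by
    rw [eval_comp]; congr 1; simp [hm]; ring
  rw [e1, e2] at h
  rw [← h, radauQuad, Finset.mul_sum]
  refine Finset.sum_congr rfl fun t _ => ?_
  rw [hd]
  simp [hm]
  ring

end Radau

end Biot

end

noncomputable section

namespace Biot

/-! ### Polynomials in time -/

section TimePolynomials

open Polynomial

variable {S S' : Type*} [AddCommGroup S] [Module ℝ S] [AddCommGroup S'] [Module ℝ S']

/-- The value at `t` of the polynomial with the coefficients `W`. -/
def timeEval (S : Type*) [AddCommGroup S] [Module ℝ S] (k : ℕ) (t : ℝ) :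
    (Fin (k + 1) → S) →ₗ[ℝ] S :=
  ∑ j : Fin (k + 1), t ^ (j : ℕ) • LinearMap.proj j

/-- The derivative at `t` of the polynomial with the coefficients `W`. -/
def timeDeriv (S : Type*) [AddCommGroup S] [Module ℝ S] (k : ℕ) (t : ℝ) :
    (Fin (k + 1) → S) →ₗ[ℝ] S :=
  ∑ j : Fin (k + 1), ((j : ℕ) * t ^ ((j : ℕ) - 1)) • LinearMap.proj j

lemma timeEval_apply {k : ℕ} (t : ℝ) (W : Fin (k + 1) → S) :
    timeEval S k t W = ∑ j : Fin (k + 1), t ^ (j : ℕ) • W j := by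
  simp [timeEval]

lemma timeDeriv_apply {k : ℕ} (t : ℝ) (W : Fin (k + 1) → S) :
    timeDeriv S k t W = ∑ j : Fin (k + 1), ((j : ℕ) * t ^ ((j : ℕ) - 1)) • W j := by
  simp [timeDeriv]

lemma map_timeEval {k : ℕ} (f : S →ₗ[ℝ] S') (t : ℝ) (W : Fin (k + 1) → S) :
    f (timeEval S k t W) = timeEval S' k t fun j => f (W j) := by
  simp [timeEval_apply]

lemma map_timeDeriv {k : ℕ} (f : S →ₗ[ℝ] S') (t : ℝ) (W : Fin (k + 1) → S) :
    f (timeDeriv S k t W) = timeDeriv S' k t fun j => f (W j) := by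
  simp [timeDeriv_apply]

/-- The real polynomial with the coefficients `c`. -/
def coeffPoly {k : ℕ} (c : Fin (k + 1) → ℝ) : ℝ[X] := ∑ j : Fin (k + 1), C (c j) * X ^ (j : ℕ)

lemma eval_coeffPoly {k : ℕ} (c : Fin (k + 1) → ℝ) (t : ℝ) :
    (coeffPoly c).eval t = timeEval ℝ k t c := by
  simp only [coeffPoly, timeEval_apply, eval_finsetSum, eval_C_mul, eval_pow, eval_X, smul_eq_mul]
  exact Finset.sum_congr rfl fun _ _ => mul_comm _ _

lemma eval_derivative_coeffPoly {k : ℕ} (c : Fin (k + 1) → ℝ) (t : ℝ) :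
    (derivative (coeffPoly c)).eval t = timeDeriv ℝ k t c := by
  simp only [coeffPoly, timeDeriv_apply, derivative_sum, eval_finsetSum]
  refine Finset.sum_congr rfl fun j _ => ?_
  simp [derivative_X_pow]
  ring

lemma natDegree_coeffPoly_le {k : ℕ} (c : Fin (k + 1) → ℝ) : (coeffPoly c).natDegree ≤ k := by
  refine natDegree_sum_le_of_forall_le _ _ fun j _ => ?_
  exact (natDegree_C_mul_X_pow_le _ _).trans (by omega)

lemma coeff_coeffPoly {k : ℕ} (c : Fin (k + 1) → ℝ) (j : Fin (k + 1)) :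
    (coeffPoly c).coeff j = c j := by
  simp only [coeffPoly, finsetSum_coeff, coeff_C_mul, coeff_X_pow]
  rw [Finset.sum_eq_single j]
  · simp
  · intro i _ hij
    have : (j : ℕ) ≠ i := fun h => hij (Fin.ext h.symm)
    simp [this]
  · simp

lemma timeEval_coeff {k : ℕ} {e : ℝ[X]} (he : e.natDegree ≤ k) (t : ℝ) :
    timeEval ℝ k t (fun j => e.coeff j) = e.eval t := by
  rw [timeEval_apply, eval_eq_sum_range' (show e.natDegree < k + 1 by omega),
    Fin.sum_univ_eq_sum_range (fun j => t ^ j • e.coeff j)]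
  exact Finset.sum_congr rfl fun j _ => by rw [smul_eq_mul, mul_comm]

/-- Linear functionals reduce this to a real polynomial with infinitely many zeros. A half-line is
enough, and it is all that the decay of the energy provides. -/
lemma eq_zero_of_timeEval_eq_zero [FiniteDimensional ℝ S] {k : ℕ} {W : Fin (k + 1) → S} {a : ℝ}
    (h : ∀ t ≥ a, timeEval S k t W = 0) : W = 0 := by
  funext j
  refine (Module.forall_dual_apply_eq_zero_iff ℝ (W j)).1 fun l => ?_
  have hp : coeffPoly (fun j => l (W j)) = 0 := by
    refine eq_zero_of_infinite_isRoot _ ((Set.Ici_infinite a).mono fun t ht => ?_)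
    change eval t _ = 0
    rw [eval_coeffPoly, ← map_timeEval, h t ht, map_zero]
  have := coeff_coeffPoly (fun j => l (W j)) j
  rw [hp] at this
  simpa using this.symm

/-- The polynomial `t ↦ A(w(t), z(t))` for a bilinear form `A` and polynomials `w`, `z`. -/
def bilinPoly {k : ℕ} (A : S →ₗ[ℝ] S' →ₗ[ℝ] ℝ) (W : Fin (k + 1) → S) (Z : Fin (k + 1) → S') : ℝ[X] :=
  ∑ i : Fin (k + 1), ∑ j : Fin (k + 1), C (A (W i) (Z j)) * (X ^ (i : ℕ) * X ^ (j : ℕ))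

lemma eval_bilinPoly {k : ℕ} (A : S →ₗ[ℝ] S' →ₗ[ℝ] ℝ) (W : Fin (k + 1) → S)
    (Z : Fin (k + 1) → S') (t : ℝ) :
    (bilinPoly A W Z).eval t = A (timeEval S k t W) (timeEval S' k t Z) := by
  simp only [bilinPoly, timeEval_apply, eval_finsetSum, map_sum, LinearMap.sum_apply, map_smul,
    LinearMap.smul_apply, smul_eq_mul, Finset.mul_sum]
  rw [Finset.sum_comm]
  refine Finset.sum_congr rfl fun i _ => Finset.sum_congr rfl fun j _ => ?_
  simp
  ring

lemma eval_derivative_bilinPoly {k : ℕ} (A : S →ₗ[ℝ] S' →ₗ[ℝ] ℝ) (W : Fin (k + 1) → S)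
    (Z : Fin (k + 1) → S') (t : ℝ) :
    (derivative (bilinPoly A W Z)).eval t =
      A (timeDeriv S k t W) (timeEval S' k t Z) + A (timeEval S k t W) (timeDeriv S' k t Z) := by
  simp only [bilinPoly, timeEval_apply, timeDeriv_apply, eval_finsetSum, map_sum,
    LinearMap.sum_apply, map_smul, LinearMap.smul_apply, smul_eq_mul, Finset.mul_sum]
  rw [Finset.sum_comm, ← Finset.sum_add_distrib]
  refine Finset.sum_congr rfl fun i _ => ?_
  rw [← Finset.sum_add_distrib]
  refine Finset.sum_congr rfl fun j _ => ?_
  simp [derivative_mul, derivative_X_pow]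
  ring

lemma natDegree_bilinPoly_le {k : ℕ} (A : S →ₗ[ℝ] S' →ₗ[ℝ] ℝ) (W : Fin (k + 1) → S)
    (Z : Fin (k + 1) → S') : (bilinPoly A W Z).natDegree ≤ 2 * k := by
  refine natDegree_sum_le_of_forall_le _ _ fun i _ => natDegree_sum_le_of_forall_le _ _
    fun j _ => ?_
  rw [← pow_add]
  exact (natDegree_C_mul_X_pow_le _ ((i : ℕ) + j)).trans (by omega)

/-- The integrand is half the derivative of `t ↦ A(w(t), w(t))`, a polynomial of degree at most
`2k`, so the quadrature of this derivative is exact. -/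
lemma radauQuad_timeDeriv {k : ℕ} {a b : ℝ} (hab : a < b) (A : S →ₗ[ℝ] S →ₗ[ℝ] ℝ)
    (hA : ∀ x y, A x y = A y x) (W : Fin (k + 1) → S) :
    radauQuad k a b (fun t => A (timeDeriv S k t W) (timeEval S k t W)) =
      (A (timeEval S k b W) (timeEval S k b W) - A (timeEval S k a W) (timeEval S k a W)) / 2 := by
  have hdeg := natDegree_bilinPoly_le A W W
  have h := radauQuad_derivative hab (bilinPoly A W W) (hdeg.trans (Nat.le_succ _))
  rw [eval_bilinPoly, eval_bilinPoly] at h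
  rw [← h, radauQuad_eq, radauQuad_eq, Finset.sum_div]
  refine Finset.sum_congr rfl fun t _ => ?_
  rw [eval_derivative_bilinPoly, hA (timeEval S k _ W)]
  ring

/-- A polynomial of degree at most `k` that is orthogonal to all such polynomials with respect to
the Gauss-Radau formula vanishes. -/
lemma eq_zero_of_radauQuad_eq_zero {k : ℕ} {a b : ℝ} (hab : a < b) {e : ℝ[X]}
    (he : e.natDegree ≤ k)
    (h : ∀ g : Fin (k + 1) → ℝ, radauQuad k a b (fun t => e.eval t * timeEval ℝ k t g) = 0) :
    e = 0 := by
  -- With `e` itself as test function the formula is a sum of squares with positive weights. So `e`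
  -- vanishes at `k+1` distinct nodes, one more than its degree allows.
  have h0 := h fun j => e.coeff j
  simp only [timeEval_coeff he, radauQuad_eq] at h0
  have h1 := (Finset.sum_eq_zero_iff_of_nonneg fun t ht =>
    mul_nonneg (quadWeight_pos hab ht).le (mul_self_nonneg _)).1 h0
  refine eq_zero_of_degree_lt_of_eval_index_eq_zero (s := radauNodes k)
    (v := quadNode a b) (quadNode_injective hab).injOn ?_ fun t ht => ?_
  · rw [card_radauNodes]
    exact degree_le_natDegree.trans_lt (by exact_mod_cast (by omega))
  · have := h1 t ht
    rcases mul_eq_zero.1 this with h2 | h2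
    · exact absurd h2 (quadWeight_pos hab ht).ne'
    · exact mul_self_eq_zero.1 h2

lemma radauQuad_add (k : ℕ) (a b : ℝ) (f g : ℝ → ℝ) :
    radauQuad k a b (fun t => f t + g t) = radauQuad k a b f + radauQuad k a b g := by
  simp only [radauQuad_eq, mul_add, Finset.sum_add_distrib]

lemma radauQuad_sub (k : ℕ) (a b : ℝ) (f g : ℝ → ℝ) :
    radauQuad k a b (fun t => f t - g t) = radauQuad k a b f - radauQuad k a b g := by
  simp only [radauQuad_eq, mul_sub, Finset.sum_sub_distrib]

lemma radauQuad_const_mul (k : ℕ) (a b c : ℝ) (f : ℝ → ℝ) :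
    radauQuad k a b (fun t => c * f t) = c * radauQuad k a b f := by
  simp only [radauQuad_eq, Finset.mul_sum]
  exact Finset.sum_congr rfl fun _ _ => by ring

lemma radauQuad_nonneg {k : ℕ} {a b : ℝ} (hab : a < b) {f : ℝ → ℝ} (hf : ∀ t, 0 ≤ f t) :
    0 ≤ radauQuad k a b f := by
  rw [radauQuad_eq]
  exact Finset.sum_nonneg fun t ht => mul_nonneg (quadWeight_pos hab ht).le (hf _)

end TimePolynomials

/-! ### The abstract local problem -/

section AbstractProblem

open Polynomial

variable {V Q : Type*} [AddCommGroup V] [Module ℝ V] [AddCommGroup Q] [Module ℝ Q]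

/-- A null vector of a semidefinite form lies in its radical: along `s • x + y` the quadratic form
is affine in `s` and bounded below, so its slope `2 A(x,y)` is zero. -/
lemma eq_zero_of_apply_self_eq_zero {A : V →ₗ[ℝ] V →ₗ[ℝ] ℝ} (hA : ∀ x y, A x y = A y x)
    (hA0 : ∀ x, 0 ≤ A x x) {x : V} (hx : A x x = 0) (y : V) : A x y = 0 := by
  have h : ∀ s : ℝ, 0 ≤ 2 * s * A x y + A y y := fun s => by
    have := hA0 (s • x + y)
    simp only [map_add, map_smul, LinearMap.add_apply, LinearMap.smul_apply, smul_eq_mul, hx,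
      hA y x] at this
    linarith
  by_contra hne
  -- This value of `s` would make the affine function equal to `-1`.
  have h1 := h (-(A y y + 1) / (2 * A x y))
  rw [show 2 * (-(A y y + 1) / (2 * A x y)) * A x y = -(A y y + 1) by field_simp] at h1
  linarith

/-- The bilinear form of the local problem on `(a,b]`, on the coefficients with respect to time. -/
def localForm (k : ℕ) (a b ρ c₀ : ℝ) (m A : V →ₗ[ℝ] V →ₗ[ℝ] ℝ) (mQ B : Q →ₗ[ℝ] Q →ₗ[ℝ] ℝ)
    (C : V →ₗ[ℝ] Q →ₗ[ℝ] ℝ) :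
    ((Fin (k + 1) → V) × (Fin (k + 1) → V) × (Fin (k + 1) → Q)) →ₗ[ℝ]
      ((Fin (k + 1) → V) × (Fin (k + 1) → V) × (Fin (k + 1) → Q)) →ₗ[ℝ] ℝ :=
  let π₁ := LinearMap.fst ℝ (Fin (k + 1) → V) ((Fin (k + 1) → V) × (Fin (k + 1) → Q))
  let π₂ := LinearMap.fst ℝ (Fin (k + 1) → V) (Fin (k + 1) → Q) ∘ₗ
    LinearMap.snd ℝ (Fin (k + 1) → V) ((Fin (k + 1) → V) × (Fin (k + 1) → Q))
  let π₃ := LinearMap.snd ℝ (Fin (k + 1) → V) (Fin (k + 1) → Q) ∘ₗ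
    LinearMap.snd ℝ (Fin (k + 1) → V) ((Fin (k + 1) → V) × (Fin (k + 1) → Q))
  let ev := timeEval V k
  let dv := timeDeriv V k
  let ew := timeEval Q k
  let dw := timeDeriv Q k
  (∑ t ∈ radauNodes k, quadWeight k a b t •
    (m.compl₁₂ (dv (quadNode a b t) ∘ₗ π₁) (ev (quadNode a b t) ∘ₗ π₁)
      - m.compl₁₂ (ev (quadNode a b t) ∘ₗ π₂) (ev (quadNode a b t) ∘ₗ π₁)
      + (ρ • m.compl₁₂ (dv (quadNode a b t) ∘ₗ π₂) (ev (quadNode a b t) ∘ₗ π₂)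
        + A.compl₁₂ (ev (quadNode a b t) ∘ₗ π₁) (ev (quadNode a b t) ∘ₗ π₂)
        + (C.flip).compl₁₂ (ew (quadNode a b t) ∘ₗ π₃) (ev (quadNode a b t) ∘ₗ π₂))
      + (c₀ • mQ.compl₁₂ (dw (quadNode a b t) ∘ₗ π₃) (ew (quadNode a b t) ∘ₗ π₃)
        - C.compl₁₂ (ev (quadNode a b t) ∘ₗ π₂) (ew (quadNode a b t) ∘ₗ π₃)
        + B.compl₁₂ (ew (quadNode a b t) ∘ₗ π₃) (ew (quadNode a b t) ∘ₗ π₃))))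
    + (m.compl₁₂ (ev a ∘ₗ π₁) (ev a ∘ₗ π₁) + ρ • m.compl₁₂ (ev a ∘ₗ π₂) (ev a ∘ₗ π₂)
      + c₀ • mQ.compl₁₂ (ew a ∘ₗ π₃) (ew a ∘ₗ π₃))

variable {k : ℕ} {a b ρ c₀ : ℝ} {m A : V →ₗ[ℝ] V →ₗ[ℝ] ℝ} {mQ B : Q →ₗ[ℝ] Q →ₗ[ℝ] ℝ}
  {C : V →ₗ[ℝ] Q →ₗ[ℝ] ℝ}

lemma localForm_apply (u v φ χ : Fin (k + 1) → V) (p ψ : Fin (k + 1) → Q) :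
    localForm k a b ρ c₀ m A mQ B C (u, v, p) (φ, χ, ψ) =
      (radauQuad k a b (fun t => m (timeDeriv V k t u) (timeEval V k t φ)
          - m (timeEval V k t v) (timeEval V k t φ))
        + m (timeEval V k a u) (timeEval V k a φ))
      + (radauQuad k a b (fun t => ρ * m (timeDeriv V k t v) (timeEval V k t χ)
          + A (timeEval V k t u) (timeEval V k t χ) + C (timeEval V k t χ) (timeEval Q k t p))
        + ρ * m (timeEval V k a v) (timeEval V k a χ))
      + (radauQuad k a b (fun t => c₀ * mQ (timeDeriv Q k t p) (timeEval Q k t ψ)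
          - C (timeEval V k t v) (timeEval Q k t ψ) + B (timeEval Q k t p) (timeEval Q k t ψ))
        + c₀ * mQ (timeEval Q k a p) (timeEval Q k a ψ)) := by
  simp only [localForm, LinearMap.add_apply, LinearMap.sum_apply, LinearMap.smul_apply,
    LinearMap.sub_apply, LinearMap.compl₁₂_apply, LinearMap.comp_apply, LinearMap.fst_apply,
    LinearMap.snd_apply, LinearMap.flip_apply, smul_eq_mul, radauQuad_eq, mul_add,
    Finset.sum_add_distrib]
  ring

/-- The data of a local problem with a unique solution. -/
structure Admissible (ρ c₀ : ℝ) (m A : V →ₗ[ℝ] V →ₗ[ℝ] ℝ) (mQ B : Q →ₗ[ℝ] Q →ₗ[ℝ] ℝ) : Prop where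
  rho_pos : 0 < ρ
  c_pos : 0 < c₀
  m_symm : ∀ x y, m x y = m y x
  m_pos : ∀ x, x ≠ 0 → 0 < m x x
  A_symm : ∀ x y, A x y = A y x
  A_nonneg : ∀ x, 0 ≤ A x x
  mQ_symm : ∀ x y, mQ x y = mQ y x
  mQ_pos : ∀ x, x ≠ 0 → 0 < mQ x x
  B_nonneg : ∀ x, 0 ≤ B x x

lemma nonneg_of_pos {m : V →ₗ[ℝ] V →ₗ[ℝ] ℝ} (h : ∀ x, x ≠ 0 → 0 < m x x) (x : V) : 0 ≤ m x x := by
  by_cases hx : x = 0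
  · simp [hx]
  · exact (h x hx).le

lemma eq_zero_of_nonpos {m : V →ₗ[ℝ] V →ₗ[ℝ] ℝ} (h : ∀ x, x ≠ 0 → 0 < m x x) {x : V}
    (hx : m x x ≤ 0) : x = 0 := by
  by_contra h0
  linarith [h x h0]

/-- With respect to a positive definite form, every symmetric bilinear form is represented by an
operator. -/
lemma exists_repr [FiniteDimensional ℝ V] (hm : ∀ x y, m x y = m y x)
    (hm0 : ∀ x, x ≠ 0 → 0 < m x x) (A : Q →ₗ[ℝ] V →ₗ[ℝ] ℝ) :
    ∃ R : Q →ₗ[ℝ] V, ∀ x y, A y x = m x (R y) := by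
  have hinj : Function.Injective m := by
    refine (injective_iff_map_eq_zero m).2 fun x hx => eq_zero_of_nonpos hm0 ?_
    simp [hx]
  have hsurj : Function.Surjective m :=
    (LinearMap.injective_iff_surjective_of_finrank_eq_finrank
      (Subspace.dual_finrank_eq (K := ℝ) (V := V)).symm).1 hinj
  let e : V ≃ₗ[ℝ] (V →ₗ[ℝ] ℝ) := LinearEquiv.ofBijective m ⟨hinj, hsurj⟩
  refine ⟨e.symm.toLinearMap ∘ₗ A, fun x y => ?_⟩
  have h : m (e.symm (A y)) = A y := e.apply_symm_apply (A y)
  rw [LinearMap.comp_apply, LinearEquiv.coe_coe, hm, h]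

/-- The form `A` may be degenerate, and this dictates the order: first the values at `a`, with
`u(a)` known only modulo the radical of `A`; then the equations at all times; then `v` and `p`; and
`u` last, from the first equation tested with the definite form `m`. -/
lemma localForm_eq_zero [FiniteDimensional ℝ V] [FiniteDimensional ℝ Q] (hab : a < b)
    (H : Admissible ρ c₀ m A mQ B) {u v : Fin (k + 1) → V} {p : Fin (k + 1) → Q}
    (h : ∀ Φ, localForm k a b ρ c₀ m A mQ B C (u, v, p) Φ = 0) : u = 0 ∧ v = 0 ∧ p = 0 := by
  have h1 : ∀ φ : Fin (k + 1) → V, radauQuad k a b (fun t =>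
      m (timeDeriv V k t u) (timeEval V k t φ) - m (timeEval V k t v) (timeEval V k t φ))
        + m (timeEval V k a u) (timeEval V k a φ) = 0 := fun φ => by
    have := h (φ, 0, 0)
    rw [localForm_apply] at this
    simpa [radauQuad] using this
  have h2 : ∀ χ : Fin (k + 1) → V, radauQuad k a b (fun t =>
      ρ * m (timeDeriv V k t v) (timeEval V k t χ)
        + A (timeEval V k t u) (timeEval V k t χ) + C (timeEval V k t χ) (timeEval Q k t p))
        + ρ * m (timeEval V k a v) (timeEval V k a χ) = 0 := fun χ => by
    have := h (0, χ, 0)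
    rw [localForm_apply] at this
    simpa [radauQuad] using this
  have h3 : ∀ ψ : Fin (k + 1) → Q, radauQuad k a b (fun t =>
      c₀ * mQ (timeDeriv Q k t p) (timeEval Q k t ψ)
        - C (timeEval V k t v) (timeEval Q k t ψ) + B (timeEval Q k t p) (timeEval Q k t ψ))
        + c₀ * mQ (timeEval Q k a p) (timeEval Q k a ψ) = 0 := fun ψ => by
    have := h (0, 0, ψ)
    rw [localForm_apply] at this
    simpa [radauQuad] using this
  -- Testing the first equation with `R u` turns `m` into `A`, so that the term `A(u,v)` cancels
  -- against the one from the second equation tested with `v`.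
  obtain ⟨R, hR⟩ := exists_repr H.m_symm H.m_pos A
  have hRe : ∀ (t : ℝ) (W : Fin (k + 1) → V), timeEval V k t (fun j => R (W j))
      = R (timeEval V k t W) := fun t W => (map_timeEval R t W).symm
  -- the energy identity
  have e1 := h1 fun j => R (u j)
  simp only [hRe, ← hR] at e1
  have e2 := h2 v
  have e3 := h3 p
  rw [radauQuad_sub] at e1
  rw [radauQuad_add, radauQuad_add, radauQuad_const_mul, radauQuad_timeDeriv hab m H.m_symm] at e2
  rw [radauQuad_add, radauQuad_sub, radauQuad_const_mul,
    radauQuad_timeDeriv hab mQ H.mQ_symm] at e3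
  have e1' : radauQuad k a b (fun t => A (timeEval V k t u) (timeDeriv V k t u)) =
      (A (timeEval V k b u) (timeEval V k b u) - A (timeEval V k a u) (timeEval V k a u)) / 2 := by
    rw [← radauQuad_timeDeriv hab A H.A_symm]
    simp only [H.A_symm (timeEval V k _ u)]
  rw [e1'] at e1
  have hB := radauQuad_nonneg (k := k) hab fun t => H.B_nonneg (timeEval Q k t p)
  -- A jump term contributes a full square at `a`, of which the exact quadrature takes away one
  -- half. The sum of `e1`, `e2`, `e3` is therefore half of all squares at `a` and `b` plus the
  -- quadrature of `B(p,p)`, with no negative summand.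
  have nva := mul_nonneg H.rho_pos.le (nonneg_of_pos H.m_pos (timeEval V k a v))
  have nvb := mul_nonneg H.rho_pos.le (nonneg_of_pos H.m_pos (timeEval V k b v))
  have npa := mul_nonneg H.c_pos.le (nonneg_of_pos H.mQ_pos (timeEval Q k a p))
  have npb := mul_nonneg H.c_pos.le (nonneg_of_pos H.mQ_pos (timeEval Q k b p))
  have nua := H.A_nonneg (timeEval V k a u)
  have nub := H.A_nonneg (timeEval V k b u)
  have hva : timeEval V k a v = 0 := by
    refine eq_zero_of_nonpos H.m_pos ?_
    by_contra hc
    have := mul_pos H.rho_pos (not_le.1 hc)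
    linarith
  have hpa : timeEval Q k a p = 0 := by
    refine eq_zero_of_nonpos H.mQ_pos ?_
    by_contra hc
    have := mul_pos H.c_pos (not_le.1 hc)
    linarith
  have hAua : A (timeEval V k a u) (timeEval V k a u) = 0 := by linarith
  have hAua' := eq_zero_of_apply_self_eq_zero H.A_symm H.A_nonneg hAua
  -- the equations hold at all times
  have sm : ∀ (t : ℝ) (g : Fin (k + 1) → ℝ) (z : V),
      timeEval V k t (fun j => g j • z) = timeEval ℝ k t g • z := fun t g z =>
    (map_timeEval (LinearMap.toSpanSingleton ℝ V z) t g).symm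
  have smQ : ∀ (t : ℝ) (g : Fin (k + 1) → ℝ) (z : Q),
      timeEval Q k t (fun j => g j • z) = timeEval ℝ k t g • z := fun t g z =>
    (map_timeEval (LinearMap.toSpanSingleton ℝ Q z) t g).symm
  have deg : ∀ c : Fin (k + 1) → ℝ, (derivative (coeffPoly c)).natDegree ≤ k := fun c =>
    (natDegree_derivative_le _).trans ((Nat.sub_le _ _).trans (natDegree_coeffPoly_le c))
  -- The test vectors are `R z`, since so far only `A(u(a), ·) = 0` is known and not `u(a) = 0`. The
  -- relation between `∂ₜu` and `v` is thus obtained modulo the radical of `A`, which is enough for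
  -- the energy.
  have o1 : ∀ t z, A z (timeDeriv V k t u) = A z (timeEval V k t v) := by
    intro t z
    have he : derivative (coeffPoly fun j => A z (u j)) - coeffPoly (fun j => A z (v j)) = 0 := by
      refine eq_zero_of_radauQuad_eq_zero hab ((natDegree_sub_le_of_le (deg _)
        (natDegree_coeffPoly_le _)).trans (max_self k).le) fun g => ?_
      have := h1 fun j => g j • R z
      simp only [sm, map_smul, smul_eq_mul, ← hR, H.A_symm z (timeEval V k a u), hAua', mul_zero,
        add_zero] at this
      rw [← this]
      congr 1
      funext t
      rw [eval_sub, eval_derivative_coeffPoly, eval_coeffPoly, ← map_timeDeriv, ← map_timeEval]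
      ring
    have := congrArg (eval t) he
    rw [eval_sub, eval_derivative_coeffPoly, eval_coeffPoly, ← map_timeDeriv, ← map_timeEval,
      eval_zero] at this
    linarith
  have o2 : ∀ t z, ρ * m (timeDeriv V k t v) z + A (timeEval V k t u) z
      + C z (timeEval Q k t p) = 0 := by
    intro t z
    set e : ℝ[X] := Polynomial.C ρ * derivative (coeffPoly fun j => m.flip z (v j))
      + coeffPoly (fun j => A.flip z (u j)) + coeffPoly (fun j => C z (p j)) with hedef
    have hev : ∀ s, e.eval s = ρ * m (timeDeriv V k s v) z + A (timeEval V k s u) z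
      + C z (timeEval Q k s p) := fun s => by
      rw [hedef, eval_add, eval_add, eval_C_mul, eval_derivative_coeffPoly, eval_coeffPoly,
        eval_coeffPoly, ← map_timeDeriv, ← map_timeEval, ← map_timeEval]
      rfl
    have he : e = 0 := by
      refine eq_zero_of_radauQuad_eq_zero hab (natDegree_add_le_of_degree_le
        (natDegree_add_le_of_degree_le ((natDegree_C_mul_le _ _).trans (deg _))
        (natDegree_coeffPoly_le _)) (natDegree_coeffPoly_le _)) fun g => ?_
      have := h2 fun j => g j • z
      simp only [sm, map_smul, smul_eq_mul, hva, LinearMap.zero_apply, map_zero, mul_zero,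
        add_zero, LinearMap.smul_apply] at this
      rw [← this]
      congr 1
      funext t
      rw [hev]
      ring
    rw [← hev, he, eval_zero]
  have o3 : ∀ t z, c₀ * mQ (timeDeriv Q k t p) z - C (timeEval V k t v) z
      + B (timeEval Q k t p) z = 0 := by
    intro t z
    set e : ℝ[X] := Polynomial.C c₀ * derivative (coeffPoly fun j => mQ.flip z (p j))
      - coeffPoly (fun j => C.flip z (v j)) + coeffPoly (fun j => B.flip z (p j)) with hedef
    have hev : ∀ s, e.eval s = c₀ * mQ (timeDeriv Q k s p) z - C (timeEval V k s v) z
      + B (timeEval Q k s p) z := fun s => by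
      rw [hedef, eval_add, eval_sub, eval_C_mul, eval_derivative_coeffPoly, eval_coeffPoly,
        eval_coeffPoly, ← map_timeDeriv, ← map_timeEval, ← map_timeEval]
      rfl
    have he : e = 0 := by
      refine eq_zero_of_radauQuad_eq_zero hab (natDegree_add_le_of_degree_le
        ((natDegree_sub_le_of_le ((natDegree_C_mul_le _ _).trans (deg _))
        (natDegree_coeffPoly_le _)).trans (max_self k).le) (natDegree_coeffPoly_le _)) fun g => ?_
      have := h3 fun j => g j • z
      simp only [smQ, map_smul, smul_eq_mul, hpa, LinearMap.zero_apply, map_zero, mul_zero,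
        add_zero] at this
      rw [← this]
      congr 1
      funext t
      rw [hev]
      ring
    rw [← hev, he, eval_zero]
  -- the energy decreases
  set E : ℝ[X] := Polynomial.C ρ * bilinPoly m v v + bilinPoly A u u
    + Polynomial.C c₀ * bilinPoly mQ p p with hE
  have hEev : ∀ t, E.eval t = ρ * m (timeEval V k t v) (timeEval V k t v)
      + A (timeEval V k t u) (timeEval V k t u)
      + c₀ * mQ (timeEval Q k t p) (timeEval Q k t p) := fun t => by
    simp only [hE, eval_add, eval_C_mul, eval_bilinPoly]
  -- Inserting `z = v(t)`, `z = p(t)`, `z = u(t)` into the three pointwise equations cancels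
  -- `A(u,v)` and `C(v,p)`, so the derivative of `E` is `-2 B(p,p)`.
  have hEd : ∀ t, (derivative E).eval t ≤ 0 := fun t => by
    simp only [hE, derivative_add, derivative_C_mul, eval_add, eval_C_mul,
      eval_derivative_bilinPoly]
    have i2 := o2 t (timeEval V k t v)
    have i3 := o3 t (timeEval Q k t p)
    have i1 := o1 t (timeEval V k t u)
    have iB := H.B_nonneg (timeEval Q k t p)
    rw [H.m_symm (timeEval V k t v) (timeDeriv V k t v),
      H.mQ_symm (timeEval Q k t p) (timeDeriv Q k t p),
      H.A_symm (timeDeriv V k t u) (timeEval V k t u)]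
    linarith
  have hanti : Antitone fun t => E.eval t := by
    refine antitone_of_deriv_nonpos E.differentiable fun t => ?_
    rw [E.deriv]
    exact hEd t
  have hE0 : ∀ t ≥ a, timeEval V k t v = 0 ∧ timeEval Q k t p = 0 := by
    intro t ht
    have := hanti ht
    simp only [hEev, hva, hpa, hAua, map_zero, mul_zero, add_zero] at this
    have n1 := mul_nonneg H.rho_pos.le (nonneg_of_pos H.m_pos (timeEval V k t v))
    have n2 := H.A_nonneg (timeEval V k t u)
    have n3 := mul_nonneg H.c_pos.le (nonneg_of_pos H.mQ_pos (timeEval Q k t p))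
    constructor
    · refine eq_zero_of_nonpos H.m_pos ?_
      by_contra hc
      have := mul_pos H.rho_pos (not_le.1 hc)
      linarith
    · refine eq_zero_of_nonpos H.mQ_pos ?_
      by_contra hc
      have := mul_pos H.c_pos (not_le.1 hc)
      linarith
  have hv : v = 0 := eq_zero_of_timeEval_eq_zero fun t ht => (hE0 t ht).1
  have hp : p = 0 := eq_zero_of_timeEval_eq_zero fun t ht => (hE0 t ht).2
  refine ⟨?_, hv, hp⟩
  -- With `v = 0` the first equation is a discretization of `∂ₜu = 0` with zero initial value.
  -- Tested with `u` it gives `u(a) = 0`; without the jump term it then forces `∂ₜu = 0`.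
  simp only [hv, map_zero, LinearMap.zero_apply, sub_zero] at h1
  have hua : timeEval V k a u = 0 := by
    have := h1 u
    rw [radauQuad_timeDeriv hab m H.m_symm] at this
    have n1 := nonneg_of_pos H.m_pos (timeEval V k b u)
    exact eq_zero_of_nonpos H.m_pos (by linarith)
  refine eq_zero_of_timeEval_eq_zero (a := a) fun t _ =>
    eq_zero_of_nonpos H.m_pos (le_of_eq ?_)
  -- Pairing with the fixed vector `z = u(t)` gives a scalar polynomial in time with zero
  -- derivative. Its values at `t` and `a` agree, that is `m(z,z) = 0`.
  set z := timeEval V k t u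
  have he : derivative (coeffPoly fun j => m.flip z (u j)) = 0 := by
    refine eq_zero_of_radauQuad_eq_zero hab (deg _) fun g => ?_
    have := h1 fun j => g j • z
    simp only [sm, map_smul, smul_eq_mul, hua] at this
    rw [map_zero, LinearMap.zero_apply, mul_zero, add_zero] at this
    rw [← this]
    congr 1
    funext s
    rw [eval_derivative_coeffPoly, ← map_timeDeriv, LinearMap.flip_apply]
    ring
  have hc := derivative_eq_zero.1 he
  have ht : (coeffPoly fun j => m.flip z (u j)).eval t
      = (coeffPoly fun j => m.flip z (u j)).eval a := by
    rw [eq_C_of_natDegree_eq_zero hc, eval_C, eval_C]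
  rw [eval_coeffPoly, eval_coeffPoly, ← map_timeEval, ← map_timeEval, hua, map_zero] at ht
  exact ht

/-- The abstract local problem has a unique solution. -/
theorem existsUnique_localForm [FiniteDimensional ℝ V] [FiniteDimensional ℝ Q] (hab : a < b)
    (H : Admissible ρ c₀ m A mQ B)
    (F : ((Fin (k + 1) → V) × (Fin (k + 1) → V) × (Fin (k + 1) → Q)) →ₗ[ℝ] ℝ) :
    ∃! U, ∀ Φ, localForm k a b ρ c₀ m A mQ B C U Φ = F Φ := by
  have hinj : Function.Injective (localForm k a b ρ c₀ m A mQ B C) := by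
    refine (injective_iff_map_eq_zero _).2 ?_
    rintro ⟨u, v, p⟩ h
    obtain ⟨rfl, rfl, rfl⟩ := localForm_eq_zero (C := C) hab H (u := u) (v := v) (p := p)
      fun Φ => by rw [h, LinearMap.zero_apply]
    rfl
  have hsurj : Function.Surjective (localForm k a b ρ c₀ m A mQ B C) :=
    (LinearMap.injective_iff_surjective_of_finrank_eq_finrank
      (Subspace.dual_finrank_eq (K := ℝ)).symm).1 hinj
  obtain ⟨U, hU⟩ := hsurj F
  refine ⟨U, fun Φ => by rw [hU], fun U' hU' => hinj ?_⟩
  rw [hU]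
  exact LinearMap.ext hU'

end AbstractProblem

end Biot

end

noncomputable section

namespace Biot

/-! ### Polynomial functions and the reference cell -/

section Reference

variable {d : ℕ}

/-- The polynomial function on `ℝ^d` given by `P`. -/
def polyFun (P : MvPolynomial (Fin d) ℝ) (x : E d) : ℝ := MvPolynomial.eval (fun j => x j) P

lemma polyFun_add (P R : MvPolynomial (Fin d) ℝ) (x : E d) :
    polyFun (P + R) x = polyFun P x + polyFun R x := map_add _ _ _

lemma polyFun_smul (c : ℝ) (P : MvPolynomial (Fin d) ℝ) (x : E d) :
    polyFun (c • P) x = c * polyFun P x := MvPolynomial.smul_eval _ _ _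

lemma polyFun_sum {ι : Type*} (s : Finset ι) (P : ι → MvPolynomial (Fin d) ℝ) (x : E d) :
    polyFun (∑ i ∈ s, P i) x = ∑ i ∈ s, polyFun (P i) x := map_sum _ _ _

lemma hasFDerivAt_polyFun (P : MvPolynomial (Fin d) ℝ) (x : E d) :
    HasFDerivAt (polyFun P)
      (∑ j, polyFun (MvPolynomial.pderiv j P) x • (EuclideanSpace.proj j : E d →L[ℝ] ℝ)) x := by
  classical
  induction P using MvPolynomial.induction_on with
  | C a =>
    have : polyFun (MvPolynomial.C a : MvPolynomial (Fin d) ℝ) = fun _ => a := by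
      funext y; simp [polyFun]
    rw [this]
    simpa [polyFun] using hasFDerivAt_const a x
  | add P R hP hR =>
    have : polyFun (P + R) = polyFun P + polyFun R := by
      funext y; exact polyFun_add P R y
    rw [this]
    refine (hP.add hR).congr_fderiv ?_
    simp only [map_add, polyFun_add, add_smul, Finset.sum_add_distrib]
  | mul_X P i hP =>
    have : polyFun (P * MvPolynomial.X i) = fun y => polyFun P y * y i := by
      funext y; simp [polyFun]
    rw [this]
    have hX : HasFDerivAt (fun y : E d => y i) (EuclideanSpace.proj i : E d →L[ℝ] ℝ) x :=
      (EuclideanSpace.proj i : E d →L[ℝ] ℝ).hasFDerivAt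
    refine (hP.mul hX).congr_fderiv ?_
    ext y
    simp only [MvPolynomial.pderiv_mul, MvPolynomial.pderiv_X, polyFun, Pi.single_apply,
      add_apply, smul_apply, sum_apply,
      map_add, map_mul, MvPolynomial.eval_X, add_smul, Finset.sum_add_distrib, mul_smul, smul_eq_mul,
      Finset.smul_sum]
    simp [mul_comm, add_comm]
    exact Finset.sum_congr rfl fun _ _ => by ring

lemma fderiv_polyFun_single (P : MvPolynomial (Fin d) ℝ) (x : E d) (j : Fin d) :
    fderiv ℝ (polyFun P) x (EuclideanSpace.single j 1) = polyFun (MvPolynomial.pderiv j P) x := by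
  rw [(hasFDerivAt_polyFun P x).fderiv]
  simp [sum_apply]

lemma continuous_polyFun (P : MvPolynomial (Fin d) ℝ) : Continuous (polyFun P) :=
  continuous_iff_continuousAt.2 fun x => (hasFDerivAt_polyFun P x).continuousAt

lemma isCompact_refCube : IsCompact (refCube d) := by
  have h : IsCompact (Set.univ.pi fun _ : Fin d => Set.Icc (0 : ℝ) 1) :=
    isCompact_univ_pi fun _ => isCompact_Icc
  have := (EuclideanSpace.equiv (Fin d) ℝ).toHomeomorph.isCompact_preimage.2 h
  convert this using 1
  ext x
  simp only [refCube, Set.mem_ofPred_eq, Set.mem_preimage, Set.mem_univ_pi]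
  rfl

lemma isOpen_openRefCube : IsOpen (openRefCube d) := by
  have h : IsOpen (Set.univ.pi fun _ : Fin d => Set.Ioo (0 : ℝ) 1) :=
    isOpen_set_pi Set.finite_univ fun _ _ => isOpen_Ioo
  have := (EuclideanSpace.equiv (Fin d) ℝ).toHomeomorph.isOpen_preimage.2 h
  convert this using 1
  ext x
  simp [openRefCube]

lemma openRefCube_subset : openRefCube d ⊆ refCube d := fun _ hx i => Set.Ioo_subset_Icc_self (hx i)

lemma convex_refCube : Convex ℝ (refCube d) := by
  intro x hx y hy a b ha hb hab i
  exact convex_Icc (0 : ℝ) 1 (hx i) (hy i) ha hb hab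

lemma half_mem_openRefCube : (WithLp.toLp 2 fun _ => 1 / 2 : E d) ∈ openRefCube d := by
  intro i
  constructor <;> norm_num

lemma uniqueDiffOn_refCube : UniqueDiffOn ℝ (refCube d) :=
  uniqueDiffOn_convex convex_refCube
    ⟨_, interior_maximal openRefCube_subset isOpen_openRefCube half_mem_openRefCube⟩

lemma eq_zero_of_polyFun_eq_zero {P : MvPolynomial (Fin d) ℝ}
    (h : ∀ x ∈ openRefCube d, polyFun P x = 0) : P = 0 := by
  refine MvPolynomial.funext_set (fun _ => Set.Ioo (0 : ℝ) 1)
    (fun _ => Set.Ioo_infinite (by norm_num)) fun x hx => ?_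
  rw [map_zero]
  exact h (WithLp.toLp 2 x) fun i => hx i (Set.mem_univ i)

lemma measurableSet_openRefCube : MeasurableSet (openRefCube d) := isOpen_openRefCube.measurableSet

lemma integrableOn_polyFun (P : MvPolynomial (Fin d) ℝ) :
    MeasureTheory.IntegrableOn (polyFun P) (openRefCube d) :=
  ((continuous_polyFun P).continuousOn.integrableOn_compact isCompact_refCube).mono_set
    openRefCube_subset

/-- Equivalence of norms on polynomials of bounded degree: the maximum over the reference cell is
controlled by the `L²` norm. -/
lemma exists_sq_polyFun_le (d m : ℕ) : ∃ c : ℝ, 0 ≤ c ∧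
    ∀ P ∈ MvPolynomial.restrictTotalDegree (Fin d) ℝ m, ∀ x ∈ refCube d,
      polyFun P x ^ 2 ≤ c * ∫ y in openRefCube d, polyFun P y ^ 2 := by
  set W := MvPolynomial.restrictTotalDegree (Fin d) ℝ m
  have hint : ∀ P R : MvPolynomial (Fin d) ℝ, MeasureTheory.IntegrableOn
      (fun x => polyFun P x * polyFun R x) (openRefCube d) := fun P R => by
    have : (fun x => polyFun P x * polyFun R x) = polyFun (P * R) := by
      funext x; simp [polyFun]
    rw [this]
    exact integrableOn_polyFun _
  let B : LinearMap.BilinForm ℝ W := LinearMap.mk₂ ℝ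
    (fun P R => ∫ x in openRefCube d, polyFun P.1 x * polyFun R.1 x)
    (fun P P' R => by
      rw [← MeasureTheory.integral_add (hint _ _) (hint _ _)]
      simp only [Submodule.coe_add, polyFun_add, add_mul])
    (fun c P R => by
      rw [smul_eq_mul, ← MeasureTheory.integral_const_mul]
      simp only [Submodule.coe_smul, polyFun_smul, mul_assoc])
    (fun P R R' => by
      rw [← MeasureTheory.integral_add (hint _ _) (hint _ _)]
      simp only [Submodule.coe_add, polyFun_add, mul_add])
    (fun c P R => by
      rw [smul_eq_mul, ← MeasureTheory.integral_const_mul]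
      simp only [Submodule.coe_smul, polyFun_smul, mul_left_comm])
  have hB : ∀ P R : W, B P R = ∫ x in openRefCube d, polyFun P.1 x * polyFun R.1 x :=
    fun _ _ => rfl
  have hsymm : ∀ P R : W, B P R = B R P := fun P R => by simp only [hB, mul_comm]
  have hpos : ∀ P : W, P ≠ 0 → 0 < B P P := by
    intro P hP
    rw [hB, MeasureTheory.setIntegral_pos_iff_support_of_nonneg_ae
      (Filter.Eventually.of_forall fun x => mul_self_nonneg _) (hint _ _)]
    have hopen : IsOpen (Function.support (fun x => polyFun P.1 x * polyFun P.1 x) ∩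
        openRefCube d) :=
      (((continuous_polyFun P.1).mul (continuous_polyFun P.1)).isOpen_support).inter
        isOpen_openRefCube
    refine hopen.measure_pos _ ?_
    by_contra hne
    refine hP (Subtype.ext (eq_zero_of_polyFun_eq_zero fun x hx => ?_))
    by_contra h0
    exact hne ⟨x, mul_self_ne_zero.2 h0, hx⟩
  obtain ⟨v, hv⟩ := LinearMap.BilinForm.exists_orthogonal_basis (B := B)
    ⟨fun P R => hsymm P R⟩
  have hvv : ∀ i, 0 < B (v i) (v i) := fun i => hpos _ (v.ne_zero i)
  have hbd : ∀ i, ∃ M : ℝ, 0 ≤ M ∧ ∀ x ∈ refCube d, polyFun (v i).1 x ^ 2 ≤ M := fun i => by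
    obtain ⟨M, hM⟩ := (isCompact_refCube (d := d)).bddAbove_image
      ((continuous_polyFun (v i).1).pow 2).continuousOn
    exact ⟨max M 0, le_max_right _ _, fun x hx =>
      (hM (Set.mem_image_of_mem _ hx)).trans (le_max_left _ _)⟩
  choose Mx hM0 hMx using hbd
  -- In an orthogonal basis `v i` the L² norm squared is a weighted sum of squared coefficients.
  -- Cauchy-Schwarz with these weights bounds the point value, and the constant collects the maxima
  -- `Mx i` of the squared basis functions over their squared norms.
  refine ⟨∑ i, Mx i / B (v i) (v i), Finset.sum_nonneg fun i _ => div_nonneg (hM0 i) (hvv i).le,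
    fun P hP x hx => ?_⟩
  set P' : W := ⟨P, hP⟩
  have hsum : P = ∑ i, (v.repr P' i) • (v i).1 := by
    have := congrArg Subtype.val (v.sum_repr P')
    rw [Submodule.coe_sum] at this
    simpa using this.symm
  have hBP : ∫ y in openRefCube d, polyFun P y ^ 2 = ∑ i, v.repr P' i ^ 2 * B (v i) (v i) := by
    have h1 : ∫ y in openRefCube d, polyFun P y ^ 2 = B P' P' := by
      rw [hB]; simp only [sq]; rfl
    rw [h1]
    conv_lhs => rw [← v.sum_repr P']
    simp only [map_sum, LinearMap.sum_apply, map_smul, LinearMap.smul_apply, smul_eq_mul]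
    refine Finset.sum_congr rfl fun i _ => ?_
    rw [Finset.sum_eq_single i]
    · ring
    · intro j _ hj
      have : B (v j) (v i) = 0 := hv hj
      rw [this, mul_zero]
    · simp
  have hPx : polyFun P x = ∑ i, v.repr P' i * polyFun (v i).1 x := by
    conv_lhs => rw [hsum]
    simp only [polyFun_sum, polyFun_smul]
  rw [hBP, hPx]
  calc (∑ i, v.repr P' i * polyFun (v i).1 x) ^ 2
      ≤ (∑ i, polyFun (v i).1 x ^ 2 / B (v i) (v i)) * ∑ i, v.repr P' i ^ 2 * B (v i) (v i) := by
        refine Finset.sum_sq_le_sum_mul_sum_of_sq_le_mul _ (fun i _ => ?_) (fun i _ => ?_)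
          fun i _ => ?_
        · exact div_nonneg (sq_nonneg _) (hvv i).le
        · exact mul_nonneg (sq_nonneg _) (hvv i).le
        · have := (hvv i).ne'
          exact le_of_eq (by field_simp)
    _ ≤ _ := by
        refine mul_le_mul_of_nonneg_right (Finset.sum_le_sum fun i _ => ?_)
          (Finset.sum_nonneg fun i _ => mul_nonneg (sq_nonneg _) (hvv i).le)
        exact div_le_div_of_nonneg_right (hMx i x hx) (hvv i).le

end Reference

end Biot

end

noncomputable section

namespace Biot

/-! ### Degrees -/

section Degrees

variable {σ : Type*}

lemma totalDegree_pderiv_le (i : σ) (P : MvPolynomial σ ℝ) :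
    (MvPolynomial.pderiv i P).totalDegree ≤ P.totalDegree := by
  conv_lhs => rw [P.as_sum, map_sum]
  refine MvPolynomial.totalDegree_finsetSum_le fun s hs => ?_
  rw [MvPolynomial.pderiv_monomial]
  refine (MvPolynomial.totalDegree_monomial_le _ _).trans ?_
  refine le_trans ?_ (MvPolynomial.le_totalDegree hs)
  exact Finsupp.degree_mono tsub_le_self

lemma totalDegree_det_le {d D : ℕ} (A : Matrix (Fin d) (Fin d) (MvPolynomial σ ℝ))
    (hA : ∀ i j, (A i j).totalDegree ≤ D) : A.det.totalDegree ≤ d * D := by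
  rw [Matrix.det_apply]
  refine MvPolynomial.totalDegree_finsetSum_le fun p _ => ?_
  have h : (∏ i, A (p i) i).totalDegree ≤ d * D := by
    refine (MvPolynomial.totalDegree_finsetProd _ _).trans ?_
    refine (Finset.sum_le_sum fun i _ => hA (p i) i).trans ?_
    simp
  rcases Int.units_eq_one_or (Equiv.Perm.sign p) with hs | hs <;> rw [hs]
  · simpa using h
  · simpa using h

/-- The adjugate of the Jacobian matrix enters the numerators of physical gradients. A crude degree
bound is enough, because it only has to place the numerators of all elements and all meshes in one
finite-dimensional space. -/
lemma totalDegree_adjugate_le {d D : ℕ} (A : Matrix (Fin d) (Fin d) (MvPolynomial σ ℝ))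
    (hA : ∀ i j, (A i j).totalDegree ≤ D) (i j : Fin d) :
    (A.adjugate i j).totalDegree ≤ d * D := by
  rw [Matrix.adjugate_apply]
  refine totalDegree_det_le _ fun k l => ?_
  rw [Matrix.updateRow_apply]
  split_ifs
  · rw [Pi.single_apply]
    split_ifs <;> simp
  · exact hA k l

lemma totalDegree_le_of_mem_restrictDegree {d r : ℕ} {P : MvPolynomial (Fin d) ℝ}
    (hP : P ∈ MvPolynomial.restrictDegree (Fin d) ℝ r) : P.totalDegree ≤ d * r := by
  rw [MvPolynomial.mem_restrictDegree] at hP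
  refine Finset.sup_le fun s hs => ?_
  rw [Finsupp.sum_fintype _ _ fun _ => rfl]
  refine (Finset.sum_le_sum fun i _ => hP s hs i).trans ?_
  simp

end Degrees

lemma contDiff_polyFun {d : ℕ} (P : MvPolynomial (Fin d) ℝ) : ContDiff ℝ 1 (polyFun P) := by
  induction P using MvPolynomial.induction_on with
  | C a =>
    have : polyFun (MvPolynomial.C a : MvPolynomial (Fin d) ℝ) = fun _ => a := by
      funext y; simp [polyFun]
    rw [this]
    exact contDiff_const
  | add P R hP hR =>
    have : polyFun (P + R) = fun y => polyFun P y + polyFun R y := by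
      funext y; exact polyFun_add P R y
    rw [this]
    exact hP.add hR
  | mul_X P i hP =>
    have : polyFun (P * MvPolynomial.X i) = fun y => polyFun P y * y i := by
      funext y; simp [polyFun]
    rw [this]
    exact hP.mul (EuclideanSpace.proj i : E d →L[ℝ] ℝ).contDiff

namespace Mesh

variable {d : ℕ} {Ω : Set (E d)} (M : Mesh d Ω)

/-! ### The reference maps -/

/-- The polynomial that gives a component of a reference map. -/
def mapPoly (K : Fin M.n) (i : Fin d) : MvPolynomial (Fin d) ℝ := (M.multilinear K i).choose

lemma map_apply (K : Fin M.n) (x : E d) (i : Fin d) :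
    M.map K x i = polyFun (M.mapPoly K i) x := (M.multilinear K i).choose_spec.2 x

lemma totalDegree_mapPoly_le (K : Fin M.n) (i : Fin d) : (M.mapPoly K i).totalDegree ≤ d :=
  (totalDegree_le_of_mem_restrictDegree (M.multilinear K i).choose_spec.1).trans (mul_one d).le

lemma contDiff_map (K : Fin M.n) : ContDiff ℝ 1 (M.map K) := by
  rw [contDiff_euclidean]
  intro i
  simp only [M.map_apply]
  exact contDiff_polyFun _

lemma hasStrictFDerivAt_map (K : Fin M.n) (x : E d) :
    HasStrictFDerivAt (M.map K) (fderiv ℝ (M.map K) x) x :=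
  (M.contDiff_map K).contDiffAt.hasStrictFDerivAt one_ne_zero

lemma hasFDerivAt_map (K : Fin M.n) (x : E d) :
    HasFDerivAt (M.map K) (fderiv ℝ (M.map K) x) x :=
  (M.hasStrictFDerivAt_map K x).hasFDerivAt

lemma continuous_map (K : Fin M.n) : Continuous (M.map K) := (M.contDiff_map K).continuous

/-- The Jacobian matrix of a reference map. -/
def jac (K : Fin M.n) : Matrix (Fin d) (Fin d) (MvPolynomial (Fin d) ℝ) :=
  Matrix.of fun i j => MvPolynomial.pderiv j (M.mapPoly K i)

lemma totalDegree_jac_le (K : Fin M.n) (i j : Fin d) : (M.jac K i j).totalDegree ≤ d :=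
  (totalDegree_pderiv_le _ _).trans (M.totalDegree_mapPoly_le K i)

lemma fderiv_map_single (K : Fin M.n) (x : E d) (i j : Fin d) :
    fderiv ℝ (M.map K) x (EuclideanSpace.single j 1) i = polyFun (M.jac K i j) x := by
  have h := (hasStrictFDerivAt_euclidean.1 (M.hasStrictFDerivAt_map K x) i).hasFDerivAt
  simp only [M.map_apply] at h
  have h' := fderiv_polyFun_single (M.mapPoly K i) x j
  rw [HasFDerivAt.fderiv (f := polyFun (M.mapPoly K i)) h] at h'
  exact h'

lemma det_fderiv_map (K : Fin M.n) (x : E d) :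
    (fderiv ℝ (M.map K) x).det = polyFun (M.jac K).det x := by
  rw [ContinuousLinearMap.det, ← LinearMap.det_toMatrix (EuclideanSpace.basisFun (Fin d) ℝ).toBasis,
    polyFun, RingHom.map_det]
  congr 1
  ext i j
  rw [LinearMap.toMatrix_apply]
  have h := M.fderiv_map_single K x i j
  simp only [polyFun] at h
  simpa using h

lemma polyFun_det_ne_zero (K : Fin M.n) {x : E d} (hx : x ∈ refCube d) :
    polyFun (M.jac K).det x ≠ 0 := by
  rw [← M.det_fderiv_map]
  exact M.det_ne_zero K x hx

/-- The derivative of a reference map as an isomorphism. -/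
def fderivEquiv (K : Fin M.n) {x : E d} (hx : x ∈ refCube d) : E d ≃L[ℝ] E d :=
  (fderiv ℝ (M.map K) x).toContinuousLinearEquivOfDetNeZero (M.det_ne_zero K x hx)

lemma coe_fderivEquiv (K : Fin M.n) {x : E d} (hx : x ∈ refCube d) :
    (M.fderivEquiv K hx : E d →L[ℝ] E d) = fderiv ℝ (M.map K) x := by
  ext y; rfl

/-- The inverse of a reference map. -/
def invMap (K : Fin M.n) : E d → E d := Function.invFunOn (M.map K) (refCube d)

lemma invMap_map (K : Fin M.n) {x : E d} (hx : x ∈ refCube d) : M.invMap K (M.map K x) = x :=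
  (M.injOn K).leftInvOn_invFunOn hx

lemma invMap_mem (K : Fin M.n) {y : E d} (hy : y ∈ M.closedElem K) : M.invMap K y ∈ refCube d := by
  obtain ⟨x, hx, rfl⟩ := hy
  rwa [M.invMap_map K hx]

lemma map_invMap (K : Fin M.n) {y : E d} (hy : y ∈ M.closedElem K) :
    M.map K (M.invMap K y) = y := by
  obtain ⟨x, hx, rfl⟩ := hy
  rw [M.invMap_map K hx]

lemma isCompact_closedElem (K : Fin M.n) : IsCompact (M.closedElem K) :=
  isCompact_refCube.image (M.continuous_map K)

/-- The map sends closed, hence compact, parts of the reference cell to closed sets, so its inverse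
on the closed element is continuous up to the boundary. -/
lemma continuousOn_invMap (K : Fin M.n) : ContinuousOn (M.invMap K) (M.closedElem K) := by
  rw [continuousOn_iff_isClosed]
  intro t ht
  refine ⟨M.map K '' (refCube d ∩ t),
    ((isCompact_refCube.inter_right ht).image (M.continuous_map K)).isClosed, ?_⟩
  ext y
  constructor
  · rintro ⟨h1, h2⟩
    exact ⟨⟨_, ⟨M.invMap_mem K h2, h1⟩, M.map_invMap K h2⟩, h2⟩
  · rintro ⟨⟨x, ⟨hx, hxt⟩, rfl⟩, h2⟩
    refine ⟨?_, h2⟩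
    rw [Set.mem_preimage, M.invMap_map K hx]
    exact hxt

/-- The reference map is a local homeomorphism at interior points by the inverse function theorem.
-/
lemma isOpen_elem (K : Fin M.n) : IsOpen (M.elem K) := by
  rw [isOpen_iff_mem_nhds]
  rintro _ ⟨x, hx, rfl⟩
  have h := M.hasStrictFDerivAt_map K x
  rw [← M.coe_fderivEquiv K (openRefCube_subset hx)] at h
  rw [← h.map_nhds_eq_of_equiv]
  exact Filter.image_mem_map (isOpen_openRefCube.mem_nhds hx)

lemma elem_subset_closedElem (K : Fin M.n) : M.elem K ⊆ M.closedElem K :=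
  Set.image_mono openRefCube_subset

/-- An invertible derivative transports unique differentiability from the convex reference cell. It
makes the one-sided derivatives on a closed element well defined up to its faces, where the fluxes
are taken. -/
lemma uniqueDiffWithinAt_closedElem (K : Fin M.n) {y : E d} (hy : y ∈ M.closedElem K) :
    UniqueDiffWithinAt ℝ (M.closedElem K) y := by
  obtain ⟨x, hx, rfl⟩ := hy
  have h := (M.hasFDerivAt_map K x).hasFDerivWithinAt (s := refCube d)
  rw [← M.coe_fderivEquiv K hx] at h
  exact h.uniqueDiffWithinAt_of_continuousLinearEquiv _ (uniqueDiffOn_refCube x hx)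

lemma hasFDerivWithinAt_invMap (K : Fin M.n) {x : E d} (hx : x ∈ refCube d) :
    HasFDerivWithinAt (M.invMap K) ((M.fderivEquiv K hx).symm : E d →L[ℝ] E d) (M.closedElem K)
      (M.map K x) := by
  have hy : M.map K x ∈ M.closedElem K := Set.mem_image_of_mem _ hx
  refine HasFDerivWithinAt.of_local_left_inverse (f := M.map K) (t := refCube d) ?_ ?_ hy ?_
  · exact tendsto_nhdsWithin_of_tendsto_nhds_of_eventually_within _
      (M.continuousOn_invMap K _ hy) (eventually_nhdsWithin_of_forall fun y hy => M.invMap_mem K hy)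
  · rw [M.invMap_map K hx, M.coe_fderivEquiv]
    exact (M.hasFDerivAt_map K x).hasFDerivWithinAt
  · exact eventually_nhdsWithin_of_forall fun y hy => M.map_invMap K hy

/-! ### Mapped polynomials -/

/-- The function `q` on the closed element `K` is a mapped polynomial of total degree at most
`m`. -/
def IsMapped (K : Fin M.n) (m : ℕ) (q : E d → ℝ) : Prop :=
  ∃ P : MvPolynomial (Fin d) ℝ, P.totalDegree ≤ m ∧ ∀ x ∈ refCube d, q (M.map K x) = polyFun P x

/-- The function `f` on the closed element `K` is the quotient of a mapped polynomial of total
degree at most `m` and the Jacobian determinant. -/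
def IsQuotient (K : Fin M.n) (m : ℕ) (f : E d → ℝ) : Prop :=
  ∃ P : MvPolynomial (Fin d) ℝ, P.totalDegree ≤ m ∧
    ∀ x ∈ refCube d, f (M.map K x) * polyFun (M.jac K).det x = polyFun P x

variable {M} {K : Fin M.n} {m : ℕ}

lemma IsMapped.continuousOn {q : E d → ℝ} (hq : M.IsMapped K m q) :
    ContinuousOn q (M.closedElem K) := by
  obtain ⟨P, -, hP⟩ := hq
  refine ((continuous_polyFun P).comp_continuousOn (M.continuousOn_invMap K)).congr fun y hy => ?_
  conv_lhs => rw [← M.map_invMap K hy, hP _ (M.invMap_mem K hy)]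
  rfl

lemma IsQuotient.continuousOn {f : E d → ℝ} (hf : M.IsQuotient K m f) :
    ContinuousOn f (M.closedElem K) := by
  obtain ⟨P, -, hP⟩ := hf
  have h : ContinuousOn (fun y => polyFun P (M.invMap K y) / polyFun (M.jac K).det (M.invMap K y))
      (M.closedElem K) :=
    ((continuous_polyFun P).comp_continuousOn (M.continuousOn_invMap K)).div
      ((continuous_polyFun _).comp_continuousOn (M.continuousOn_invMap K))
      fun y hy => M.polyFun_det_ne_zero K (M.invMap_mem K hy)
  refine h.congr fun y hy => ?_
  have hx := M.invMap_mem K hy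
  have h1 := hP _ hx
  rw [M.map_invMap K hy] at h1
  simp only [← h1, mul_div_cancel_right₀ _ (M.polyFun_det_ne_zero K hx)]

lemma IsQuotient.add {f g : E d → ℝ} (hf : M.IsQuotient K m f) (hg : M.IsQuotient K m g) :
    M.IsQuotient K m fun x => f x + g x := by
  obtain ⟨P, hPd, hP⟩ := hf
  obtain ⟨R, hRd, hR⟩ := hg
  refine ⟨P + R, (MvPolynomial.totalDegree_add _ _).trans (max_le hPd hRd), fun x hx => ?_⟩
  rw [polyFun_add, ← hP x hx, ← hR x hx]
  ring

lemma IsQuotient.const_mul {f : E d → ℝ} (hf : M.IsQuotient K m f) (c : ℝ) :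
    M.IsQuotient K m fun x => c * f x := by
  obtain ⟨P, hPd, hP⟩ := hf
  refine ⟨c • P, (MvPolynomial.totalDegree_smul_le _ _).trans hPd, fun x hx => ?_⟩
  rw [polyFun_smul, ← hP x hx]
  ring

lemma IsQuotient.sum {ι : Type*} {s : Finset ι} {f : ι → E d → ℝ}
    (hf : ∀ i ∈ s, M.IsQuotient K m (f i)) : M.IsQuotient K m fun x => ∑ i ∈ s, f i x := by
  classical
  induction s using Finset.induction_on with
  | empty => exact ⟨0, by simp, fun x _ => by simp [polyFun]⟩
  | insert a s ha ih =>
    simp only [Finset.sum_insert ha]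
    exact (hf a (Finset.mem_insert_self _ _)).add
      (ih fun i hi => hf i (Finset.mem_insert_of_mem hi))

lemma IsMapped.hasFDerivWithinAt {q : E d → ℝ} (hq : M.IsMapped K m q) {y : E d}
    (hy : y ∈ M.closedElem K) :
    HasFDerivWithinAt q (fderivWithin ℝ q (M.closedElem K) y) (M.closedElem K) y := by
  obtain ⟨x, hx, rfl⟩ := hy
  obtain ⟨P, -, hP⟩ := hq
  have h1 := M.hasFDerivWithinAt_invMap K hx
  have h2 : HasFDerivAt (polyFun P) (fderiv ℝ (polyFun P) x) (M.invMap K (M.map K x)) := by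
    rw [M.invMap_map K hx]
    exact (hasFDerivAt_polyFun P x).differentiableAt.hasFDerivAt
  have h3 := h2.comp_hasFDerivWithinAt _ h1
  refine (h3.congr (fun y hy => ?_) ?_).differentiableWithinAt.hasFDerivWithinAt
  · conv_lhs => rw [← M.map_invMap K hy, hP _ (M.invMap_mem K hy)]
    rfl
  · rw [Function.comp_apply, M.invMap_map K hx, hP x hx]

/-- The chain rule. -/
lemma sum_gradScal_mul_jac {q : E d → ℝ} {P : MvPolynomial (Fin d) ℝ}
    (hP : ∀ x ∈ refCube d, q (M.map K x) = polyFun P x) {x : E d} (hx : x ∈ refCube d)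
    (k : Fin d) :
    ∑ i, M.gradScal K q i (M.map K x) * polyFun (M.jac K i k) x
      = polyFun (MvPolynomial.pderiv k P) x := by
  have hq : M.IsMapped K P.totalDegree q := ⟨P, le_rfl, hP⟩
  have h1 := (hq.hasFDerivWithinAt (Set.mem_image_of_mem (M.map K) hx)).comp x
    ((M.hasFDerivAt_map K x).hasFDerivWithinAt (s := refCube d))
    (fun z hz => Set.mem_image_of_mem (M.map K) hz)
  have h2 : HasFDerivWithinAt (polyFun P) (fderiv ℝ (polyFun P) x) (refCube d) x :=
    (hasFDerivAt_polyFun P x).differentiableAt.hasFDerivAt.hasFDerivWithinAt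
  have h3 := (uniqueDiffOn_refCube x hx).eq h1
    (h2.congr (fun z hz => hP z hz) (hP x hx))
  have h4 := congrArg (fun L => L (EuclideanSpace.single k 1)) h3
  simp only [fderiv_polyFun_single, ContinuousLinearMap.comp_apply] at h4
  rw [← h4]
  have h5 : fderiv ℝ (M.map K) x (EuclideanSpace.single k 1)
      = ∑ i, polyFun (M.jac K i k) x • EuclideanSpace.single i (1 : ℝ) := by
    ext i
    rw [M.fderiv_map_single]
    simp [Pi.single_apply]
  rw [h5, map_sum]
  refine Finset.sum_congr rfl fun i _ => ?_
  rw [map_smul, smul_eq_mul, mul_comm]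
  rfl

/-- Cramer's rule: the physical gradient is the inverse transposed Jacobian applied to the reference
gradient, and the inverse is the adjugate over the determinant. The Jacobian entries have degree at
most `d`, which gives the increment `d * d`. -/
lemma IsMapped.gradScal {q : E d → ℝ} (hq : M.IsMapped K m q) (j : Fin d) :
    M.IsQuotient K (m + d * d) (M.gradScal K q j) := by
  obtain ⟨P, hPd, hP⟩ := hq
  refine ⟨∑ k, MvPolynomial.pderiv k P * (M.jac K).adjugate k j, ?_, fun x hx => ?_⟩
  · refine MvPolynomial.totalDegree_finsetSum_le fun k _ => ?_
    refine (MvPolynomial.totalDegree_mul _ _).trans (add_le_add ?_ ?_)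
    · exact (totalDegree_pderiv_le _ _).trans hPd
    · exact totalDegree_adjugate_le _ (M.totalDegree_jac_le K) k j
  · have h0 : ∀ i, ∑ k, polyFun (M.jac K i k) x * polyFun ((M.jac K).adjugate k j) x
        = if i = j then polyFun (M.jac K).det x else 0 := fun i => by
      have h := congrFun (congrFun (Matrix.mul_adjugate (M.jac K)) i) j
      have h' := congrArg (fun R => polyFun R x) h
      simp only [Matrix.mul_apply, polyFun_sum] at h'
      simp only [polyFun, map_mul] at h' ⊢
      rw [h']
      simp only [Matrix.smul_apply, Matrix.one_apply, smul_eq_mul, mul_ite, mul_one, mul_zero]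
      split_ifs <;> simp
    have h1 : polyFun (∑ k, MvPolynomial.pderiv k P * (M.jac K).adjugate k j) x
        = ∑ k, (∑ i, M.gradScal K q i (M.map K x) * polyFun (M.jac K i k) x)
          * polyFun ((M.jac K).adjugate k j) x := by
      rw [polyFun_sum]
      refine Finset.sum_congr rfl fun k _ => ?_
      rw [sum_gradScal_mul_jac hP hx]
      simp [polyFun]
    rw [h1]
    simp only [Finset.sum_mul]
    rw [Finset.sum_comm]
    simp only [mul_assoc, ← Finset.mul_sum, h0]
    simp

end Mesh

end Biot

end

/-! ### Volumes, inverse estimates and surface measures under the reference maps. -/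

noncomputable section

namespace Biot

open MeasureTheory

/-- The image of the unit ball lies in the ball of radius `‖L‖`; the volumes are compared. -/
lemma abs_det_le_norm_pow {d : ℕ} (L : E d →L[ℝ] E d) : |L.det| ≤ ‖L‖ ^ d := by
  have h1 := Measure.addHaar_image_continuousLinearMap (volume : Measure (E d)) L
    (Metric.ball 0 1)
  have hsub : L '' Metric.ball 0 1 ⊆ Metric.closedBall 0 ‖L‖ := by
    rintro _ ⟨x, hx, rfl⟩
    rw [mem_closedBall_zero_iff]
    have hx' : ‖x‖ ≤ 1 := (mem_ball_zero_iff.1 hx).le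
    calc ‖L x‖ ≤ ‖L‖ * ‖x‖ := L.le_opNorm x
      _ ≤ ‖L‖ * 1 := by gcongr
      _ = ‖L‖ := mul_one _
  have h2 := measure_mono (μ := (volume : Measure (E d))) hsub
  rw [h1, Measure.addHaar_closedBall _ _ (norm_nonneg L)] at h2
  have h0 : (volume : Measure (E d)) (Metric.ball 0 1) ≠ 0 :=
    (Metric.measure_ball_pos _ _ one_pos).ne'
  rw [ENNReal.mul_le_mul_iff_left h0 measure_ball_lt_top.ne,
    ENNReal.ofReal_le_ofReal_iff (by positivity)] at h2
  simpa using h2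

/-- The volume of the reference cell. -/
def refVol (d : ℕ) : ℝ := (volume (openRefCube d)).toReal

lemma volume_openRefCube_lt_top (d : ℕ) : volume (openRefCube d) < ⊤ :=
  (measure_mono openRefCube_subset).trans_lt isCompact_refCube.measure_lt_top

lemma refVol_pos (d : ℕ) : 0 < refVol d :=
  ENNReal.toReal_pos (isOpen_openRefCube.measure_pos _ ⟨_, half_mem_openRefCube⟩).ne'
    (volume_openRefCube_lt_top d).ne

/-- Inserting the fixed coordinate is an isometry of `ℝ^(d-1)` into `ℝ^d`, and the face lies in the
image of the cube, where this Hausdorff measure is Lebesgue measure. For `d = 0` there are no faces.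
-/
lemma euclideanHausdorffMeasure_refFace_lt_top {d : ℕ} (f : Fin d × Bool) :
    Measure.euclideanHausdorffMeasure (d - 1) (refFace f) < ⊤ := by
  rcases d with _ | m
  · exact f.1.elim0
  let ι : E m → E (m + 1) := fun y =>
    WithLp.toLp 2 (Fin.insertNth f.1 (if f.2 then (1 : ℝ) else 0) (fun i => y i))
  have hι : Isometry ι := by
    refine Isometry.of_dist_eq fun x y => ?_
    rw [EuclideanSpace.dist_eq, EuclideanSpace.dist_eq, Fin.sum_univ_succAbove _ f.1]
    simp [ι]
  have himg : refFace f ⊆ ι '' refCube m := by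
    rintro x ⟨hx, hxf⟩
    refine ⟨WithLp.toLp 2 fun i => x (f.1.succAbove i), fun i => hx _, ?_⟩
    ext i
    rcases Fin.eq_self_or_eq_succAbove f.1 i with rfl | ⟨j, rfl⟩
    · simp [ι, hxf]
    · simp [ι]
  refine (measure_mono himg).trans_lt ?_
  rw [Nat.add_sub_cancel, hι.euclideanHausdorffMeasure_image,
    EuclideanSpace.euclideanHausdorffMeasure_eq_volume]
  exact isCompact_refCube.measure_lt_top

/-- The surface area of the reference cell. -/
def refArea (d : ℕ) : ℝ :=
  ∑ f : Fin d × Bool, (Measure.euclideanHausdorffMeasure (d - 1) (refFace f)).toReal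

lemma refArea_nonneg (d : ℕ) : 0 ≤ refArea d := Finset.sum_nonneg fun _ _ => ENNReal.toReal_nonneg

lemma refFace_subset {d : ℕ} (f : Fin d × Bool) : refFace f ⊆ refCube d := fun _ hx => hx.1

lemma isCompact_refFace {d : ℕ} (f : Fin d × Bool) : IsCompact (refFace f) :=
  isCompact_refCube.inter_right
    (isClosed_eq (EuclideanSpace.proj f.1 : E d →L[ℝ] ℝ).continuous continuous_const)

namespace Mesh

variable {d : ℕ} {Ω : Set (E d)} {M : Mesh d Ω} {κ h : ℝ} {K : Fin M.n} {m : ℕ}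

lemma face_subset (F : M.LocalFace) : M.face F ⊆ M.closedElem F.1 := Set.image_mono (refFace_subset _)

lemma isCompact_face (F : M.LocalFace) : IsCompact (M.face F) :=
  (isCompact_refFace _).image (M.continuous_map F.1)

/-! ### Consequences of quasi-uniformity -/

lemma QuasiUniform.mul_nonneg (H : M.QuasiUniform κ h) (K : Fin M.n) : 0 ≤ κ * h :=
  (norm_nonneg _).trans (H.2 K _ (openRefCube_subset half_mem_openRefCube)).1

lemma QuasiUniform.nonneg (H : M.QuasiUniform κ h) (K : Fin M.n) : 0 ≤ κ :=
  nonneg_of_mul_nonneg_left (H.mul_nonneg K) H.1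

lemma QuasiUniform.abs_det_le (H : M.QuasiUniform κ h) {x : E d} (hx : x ∈ refCube d) :
    |(fderiv ℝ (M.map K) x).det| ≤ (κ * h) ^ d :=
  (abs_det_le_norm_pow _).trans (pow_le_pow_left₀ (norm_nonneg _) (H.2 K x hx).1 d)

/-- The bound on the inverse derivative gives `|det DM⁻¹| ≤ (κ/h)^d`, and the two determinants are
reciprocal. -/
lemma QuasiUniform.le_abs_det (H : M.QuasiUniform κ h) {x : E d} (hx : x ∈ refCube d) :
    h ^ d ≤ κ ^ d * |(fderiv ℝ (M.map K) x).det| := by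
  set L := fderiv ℝ (M.map K) x with hL
  have hinv : L.IsInvertible := ⟨M.fderivEquiv K hx, M.coe_fderivEquiv K hx⟩
  have h1 : L.det * L.inverse.det = 1 := by
    have := congrArg ContinuousLinearMap.det hinv.self_comp_inverse
    simpa [ContinuousLinearMap.det, LinearMap.det_comp] using this
  have h2 : |L.inverse.det| ≤ (κ / h) ^ d :=
    (abs_det_le_norm_pow _).trans (pow_le_pow_left₀ (norm_nonneg _) (H.2 K x hx).2 d)
  have h3 : |L.det| * |L.inverse.det| = 1 := by rw [← abs_mul, h1, abs_one]
  have h4 : 1 ≤ |L.det| * (κ / h) ^ d := by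
    rw [← h3]
    exact mul_le_mul_of_nonneg_left h2 (abs_nonneg _)
  have hh : 0 < h ^ d := pow_pos H.1 d
  rw [div_pow, mul_div_assoc', le_div_iff₀ hh] at h4
  linarith

/-- Transformation of integrals to the reference cell. -/
lemma integral_elem (K : Fin M.n) (g : E d → ℝ) :
    ∫ y in M.elem K, g y
      = ∫ x in openRefCube d, |(fderiv ℝ (M.map K) x).det| * g (M.map K x) := by
  have := integral_image_eq_integral_abs_det_fderiv_smul (volume : Measure (E d))
    measurableSet_openRefCube (fun x _ => (M.hasFDerivAt_map K x).hasFDerivWithinAt)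
    ((M.injOn K).mono openRefCube_subset) g
  simp only [smul_eq_mul] at this
  exact this

lemma integrableOn_elem {g : E d → ℝ} (hg : ContinuousOn g (M.closedElem K)) :
    IntegrableOn g (M.elem K) :=
  (hg.integrableOn_compact (M.isCompact_closedElem K)).mono_set (M.elem_subset_closedElem K)

lemma integrableOn_det_mul {g : E d → ℝ} (hg : ContinuousOn g (M.closedElem K)) :
    IntegrableOn (fun x => |(fderiv ℝ (M.map K) x).det| * g (M.map K x)) (openRefCube d) := by
  have := (integrableOn_image_iff_integrableOn_abs_det_fderiv_smul (volume : Measure (E d))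
    measurableSet_openRefCube (fun x _ => (M.hasFDerivAt_map K x).hasFDerivWithinAt)
    ((M.injOn K).mono openRefCube_subset) g).1 (integrableOn_elem hg)
  simpa only [smul_eq_mul] using this

lemma volume_elem (K : Fin M.n) : (volume (M.elem K)).toReal
    = ∫ x in openRefCube d, |(fderiv ℝ (M.map K) x).det| := by
  have := integral_elem K fun _ => (1 : ℝ)
  simpa [Measure.real] using this

lemma integrableOn_det (K : Fin M.n) :
    IntegrableOn (fun x => |(fderiv ℝ (M.map K) x).det|) (openRefCube d) := by
  simpa using integrableOn_det_mul (K := K) (continuousOn_const (c := (1 : ℝ)))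

lemma QuasiUniform.volume_elem_le (H : M.QuasiUniform κ h) (K : Fin M.n) :
    (volume (M.elem K)).toReal ≤ (κ * h) ^ d * refVol d := by
  rw [volume_elem]
  have h1 := setIntegral_mono_on (integrableOn_det K)
    (integrableOn_const (C := (κ * h) ^ d) (volume_openRefCube_lt_top d).ne)
    measurableSet_openRefCube fun x hx => H.abs_det_le (K := K) (openRefCube_subset hx)
  rw [setIntegral_const, smul_eq_mul, mul_comm] at h1
  exact h1

lemma QuasiUniform.le_volume_elem (H : M.QuasiUniform κ h) (K : Fin M.n) :
    h ^ d * refVol d ≤ κ ^ d * (volume (M.elem K)).toReal := by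
  rw [volume_elem, ← integral_const_mul]
  have h1 := setIntegral_mono_on
    (integrableOn_const (C := h ^ d) (volume_openRefCube_lt_top d).ne)
    ((integrableOn_det K).const_mul (κ ^ d))
    measurableSet_openRefCube fun x hx => H.le_abs_det (K := K) (openRefCube_subset hx)
  rw [setIntegral_const, smul_eq_mul, mul_comm] at h1
  exact h1

lemma QuasiUniform.volume_elem_pos (H : M.QuasiUniform κ h) (K : Fin M.n) :
    0 < (volume (M.elem K)).toReal := by
  have h1 := H.le_volume_elem K
  have h2 : 0 < h ^ d * refVol d := mul_pos (pow_pos H.1 d) (refVol_pos d)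
  by_contra hc
  have h3 : (volume (M.elem K)).toReal = 0 := le_antisymm (not_lt.1 hc) ENNReal.toReal_nonneg
  rw [h3, mul_zero] at h1
  linarith

/-- An element has volume of order at least `h^d` and is contained in `Ω`. This bounds the mesh size
in terms of `Ω` and `κ`, which later absorbs the surplus power of `h` in the penalty scaling. -/
lemma QuasiUniform.pow_le (H : M.QuasiUniform κ h) (hΩ : Bornology.IsBounded Ω) (K : Fin M.n) :
    h ^ d * refVol d ≤ κ ^ d * (volume Ω).toReal :=
  (H.le_volume_elem K).trans <| mul_le_mul_of_nonneg_left
    (ENNReal.toReal_mono hΩ.measure_lt_top.ne (measure_mono (M.subset K)))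
    (pow_nonneg (H.nonneg K) d)

/-- Inverse estimate: the maximum of a quotient is controlled by its `L²` norm. -/
lemma exists_sq_le (d m : ℕ) : ∃ c : ℝ, 0 ≤ c ∧ ∀ (Ω : Set (E d)) (M : Mesh d Ω) (κ h : ℝ),
    M.QuasiUniform κ h → ∀ (K : Fin M.n) (f : E d → ℝ), M.IsQuotient K m f →
      ∀ y ∈ M.closedElem K, h ^ d * f y ^ 2 ≤ c * κ ^ (3 * d) * ∫ z in M.elem K, f z ^ 2 := by
  obtain ⟨c, hc, hcP⟩ := exists_sq_polyFun_le d m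
  refine ⟨c, hc, fun Ω M κ h H K f hf y hy => ?_⟩
  have hfc : ContinuousOn (fun y => f y ^ 2) (M.closedElem K) := hf.continuousOn.pow 2
  obtain ⟨P, hPd, hP⟩ := hf
  obtain ⟨x, hx, rfl⟩ := hy
  have hκ := H.nonneg K
  have hh := H.1
  set I := ∫ z in M.elem K, f z ^ 2 with hI
  have h1 := hcP P ((MvPolynomial.mem_restrictTotalDegree _ _ _).2 hPd) x hx
  -- The numerator is `f` times the determinant. Of the two determinants in its square, one is the
  -- density of the change of variables and the other is at most `(κ h)^d`.
  have h2 : ∫ z in openRefCube d, polyFun P z ^ 2 ≤ (κ * h) ^ d * I := by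
    rw [hI, integral_elem, ← integral_const_mul]
    refine setIntegral_mono_on ?_ ((integrableOn_det_mul hfc).const_mul _)
      measurableSet_openRefCube fun z hz => ?_
    · exact ((continuous_polyFun P).pow 2).continuousOn.integrableOn_compact isCompact_refCube
        |>.mono_set openRefCube_subset
    · rw [← hP z (openRefCube_subset hz), ← M.det_fderiv_map, mul_pow,
        ← sq_abs (ContinuousLinearMap.det _)]
      have := H.abs_det_le (K := K) (openRefCube_subset hz)
      calc f (M.map K z) ^ 2 * |(fderiv ℝ (M.map K) z).det| ^ 2
          = |(fderiv ℝ (M.map K) z).det| *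
            (|(fderiv ℝ (M.map K) z).det| * f (M.map K z) ^ 2) := by ring
        _ ≤ _ := by gcongr
  have h3 := H.le_abs_det (K := K) hx
  have hI0 : 0 ≤ I := integral_nonneg fun z => sq_nonneg _
  have h4 : (h ^ d) ^ 2 ≤ (κ ^ d * |(fderiv ℝ (M.map K) x).det|) ^ 2 :=
    pow_le_pow_left₀ (by positivity) h3 2
  rw [mul_pow, sq_abs, M.det_fderiv_map] at h4
  have h5 : f (M.map K x) ^ 2 * polyFun (M.jac K).det x ^ 2 ≤ c * ((κ * h) ^ d * I) := by
    rw [← mul_pow, hP x hx]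
    exact h1.trans (mul_le_mul_of_nonneg_left h2 hc)
  -- Dividing by the squared determinant costs `κ^(2d)/h^(2d)`. With the factor `(κ h)^d` from `h2`
  -- this makes `κ^(3d)/h^d`.
  have h6 : h ^ d * (h ^ d * f (M.map K x) ^ 2) ≤ h ^ d * (c * κ ^ (3 * d) * I) := by
    calc h ^ d * (h ^ d * f (M.map K x) ^ 2) = (h ^ d) ^ 2 * f (M.map K x) ^ 2 := by ring
      _ ≤ ((κ ^ d) ^ 2 * polyFun (M.jac K).det x ^ 2) * f (M.map K x) ^ 2 := by gcongr
      _ = (κ ^ d) ^ 2 * (f (M.map K x) ^ 2 * polyFun (M.jac K).det x ^ 2) := by ring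
      _ ≤ (κ ^ d) ^ 2 * (c * ((κ * h) ^ d * I)) := by gcongr
      _ = h ^ d * (c * κ ^ (3 * d) * I) := by rw [mul_pow]; ring
  exact le_of_mul_le_mul_left h6 (pow_pos hh d)

/-! ### Surface measure of the faces -/

lemma QuasiUniform.lipschitzOnWith (H : M.QuasiUniform κ h) (K : Fin M.n) :
    LipschitzOnWith (κ * h).toNNReal (M.map K) (refCube d) := by
  refine convex_refCube.lipschitzOnWith_of_nnnorm_fderiv_le (𝕜 := ℝ)
    (fun x _ => (M.hasFDerivAt_map K x).differentiableAt) fun x hx => ?_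
  rw [← NNReal.coe_le_coe, coe_nnnorm, Real.coe_toNNReal _ (H.mul_nonneg K)]
  exact (H.2 K x hx).1

/-- The faces of hexahedra may be curved, but only an upper bound of their area is needed, and the
Lipschitz constant `κ h` of the reference map gives it. -/
lemma QuasiUniform.measure_face_le (H : M.QuasiUniform κ h) (F : M.LocalFace) :
    Measure.euclideanHausdorffMeasure (d - 1) (M.face F) ≤
      ENNReal.ofReal (κ * h) ^ (d - 1) *
        Measure.euclideanHausdorffMeasure (d - 1) (refFace F.2) := by
  have h1 := ((H.lipschitzOnWith F.1).mono (refFace_subset F.2)).hausdorffMeasure_image_le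
    (d := ((d - 1 : ℕ) : ℝ)) (Nat.cast_nonneg _)
  rw [Measure.euclideanHausdorffMeasure_def]
  simp only [Measure.smul_apply, ENNReal.smul_def, smul_eq_mul]
  rw [mul_left_comm]
  rw [ENNReal.rpow_natCast] at h1
  exact mul_le_mul_right h1 _

lemma QuasiUniform.measure_face_lt_top (H : M.QuasiUniform κ h) (F : M.LocalFace) :
    Measure.euclideanHausdorffMeasure (d - 1) (M.face F) < ⊤ :=
  (H.measure_face_le F).trans_lt (ENNReal.mul_lt_top (ENNReal.pow_lt_top ENNReal.ofReal_lt_top)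
    (euclideanHausdorffMeasure_refFace_lt_top F.2))

lemma QuasiUniform.measureReal_face_le (H : M.QuasiUniform κ h) (F : M.LocalFace) :
    (Measure.euclideanHausdorffMeasure (d - 1)).real (M.face F) ≤
      (κ * h) ^ (d - 1) * refArea d := by
  have h1 := ENNReal.toReal_mono (ENNReal.mul_lt_top (ENNReal.pow_lt_top ENNReal.ofReal_lt_top)
    (euclideanHausdorffMeasure_refFace_lt_top F.2)).ne (H.measure_face_le F)
  rw [ENNReal.toReal_mul, ENNReal.toReal_pow, ENNReal.toReal_ofReal (H.mul_nonneg F.1)] at h1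
  refine h1.trans (mul_le_mul_of_nonneg_left ?_ (pow_nonneg (H.mul_nonneg F.1) _))
  exact Finset.single_le_sum (f := fun f : Fin d × Bool =>
    (Measure.euclideanHausdorffMeasure (d - 1) (refFace f)).toReal)
    (fun _ _ => ENNReal.toReal_nonneg) (Finset.mem_univ F.2)

/-- Discrete trace inequality. -/
lemma exists_trace_le (Ω : Set (E d)) (hΩ : Bornology.IsBounded Ω) (κ : ℝ) (m : ℕ) :
    ∃ c : ℝ, 0 ≤ c ∧ ∀ (M : Mesh d Ω) (h : ℝ), M.QuasiUniform κ h →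
      ∀ (F : M.LocalFace) (f : E d → ℝ), M.IsQuotient F.1 m f → ∀ S ⊆ M.face F,
      ∀ η : ℝ, 0 ≤ η → η ≤ (κ * h) ^ d * refVol d →
        η * surfInt S (fun x => f x ^ 2) ≤ c * ∫ z in M.elem F.1, f z ^ 2 := by
  obtain ⟨c, hc, hcP⟩ := exists_sq_le d m
  -- This is the bound for `h^(d-1)`, the power left when `η` of order `h^d` and an area of order
  -- `h^(d-1)` meet the factor `h^(-d)` of the inverse estimate. The absolute value appears because
  -- `κ ≥ 0` is known only once the mesh has an element.
  set C := (1 + |κ| ^ d * (volume Ω).toReal / refVol d) with hC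
  refine ⟨|κ| ^ d * refVol d * (c * |κ| ^ (3 * d)) * (|κ| ^ (d - 1) * refArea d) * C, ?_,
    fun M h H F f hf S hS η hη hη' => ?_⟩
  · have h1 := refVol_pos d
    have h2 := refArea_nonneg d
    positivity
  have hκ := H.nonneg F.1
  have hh := H.1
  have hv := refVol_pos d
  have ha := refArea_nonneg d
  have hhd : 0 < h ^ d := pow_pos hh d
  rw [abs_of_nonneg hκ] at hC ⊢
  set I := ∫ z in M.elem F.1, f z ^ 2
  have hI0 : 0 ≤ I := integral_nonneg fun z => sq_nonneg _
  have hsup : ∀ x ∈ S, ‖f x ^ 2‖ ≤ c * κ ^ (3 * d) * I / h ^ d := fun x hx => by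
    rw [Real.norm_of_nonneg (sq_nonneg _), le_div_iff₀ hhd, mul_comm]
    exact hcP Ω M κ h H F.1 f hf x (face_subset F (hS hx))
  have hSt : Measure.euclideanHausdorffMeasure (d - 1) S < ⊤ :=
    (measure_mono hS).trans_lt (H.measure_face_lt_top F)
  have h1 := (le_abs_self _).trans (norm_setIntegral_le_of_norm_le_const hSt hsup)
  have h2 : (Measure.euclideanHausdorffMeasure (d - 1)).real S ≤ (κ * h) ^ (d - 1) * refArea d :=
    (measureReal_mono hS (H.measure_face_lt_top F).ne).trans (H.measureReal_face_le F)
  -- For `h ≤ 1` the summand `1` suffices; otherwise `h^(d-1) ≤ h^d`, which the volume of `Ω`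
  -- controls.
  have h3 : h ^ (d - 1) ≤ C := by
    have h4 : h ^ d ≤ κ ^ d * (volume Ω).toReal / refVol d := by
      rw [le_div_iff₀ hv]
      exact H.pow_le hΩ F.1
    rcases le_total h 1 with h5 | h5
    · have := pow_le_one₀ (n := d - 1) hh.le h5
      linarith
    · have := pow_le_pow_right₀ h5 (Nat.sub_le d 1)
      linarith
  have h0 : 0 ≤ c * κ ^ (3 * d) * I / h ^ d := by positivity
  calc η * surfInt S (fun x => f x ^ 2)
      ≤ η * (c * κ ^ (3 * d) * I / h ^ d * ((κ * h) ^ (d - 1) * refArea d)) :=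
        mul_le_mul_of_nonneg_left (h1.trans (mul_le_mul_of_nonneg_left h2 h0)) hη
    _ ≤ (κ * h) ^ d * refVol d *
        (c * κ ^ (3 * d) * I / h ^ d * ((κ * h) ^ (d - 1) * refArea d)) :=
        mul_le_mul_of_nonneg_right hη' (by have := H.mul_nonneg F.1; positivity)
    _ = κ ^ d * refVol d * (c * κ ^ (3 * d)) * (κ ^ (d - 1) * refArea d) * h ^ (d - 1) * I := by
        rw [mul_pow, mul_pow]
        field_simp
    _ ≤ κ ^ d * refVol d * (c * κ ^ (3 * d)) * (κ ^ (d - 1) * refArea d) * C * I := by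
        gcongr

end Mesh

end Biot

end

noncomputable section

namespace Biot

open MeasureTheory

/-! ### Functions that are linear on a subspace -/

section LinOn

variable {X Y : Type*} [AddCommGroup X] [Module ℝ X] [AddCommGroup Y] [Module ℝ Y]

/-- `f` is linear on the subspace `V`. -/
structure LinOn (V : Submodule ℝ X) (f : X → ℝ) : Prop where
  map_add : ∀ x ∈ V, ∀ y ∈ V, f (x + y) = f x + f y
  map_smul : ∀ (c : ℝ), ∀ x ∈ V, f (c • x) = c * f x

/-- `b` is bilinear on the product of the subspaces `V` and `W`. -/
structure BilinOn (V : Submodule ℝ X) (W : Submodule ℝ Y) (b : X → Y → ℝ) : Prop where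
  left : ∀ y ∈ W, LinOn V fun x => b x y
  right : ∀ x ∈ V, LinOn W fun y => b x y

variable {V : Submodule ℝ X} {W : Submodule ℝ Y} {f g : X → ℝ}

namespace LinOn

lemma of_linearMap (f : X →ₗ[ℝ] ℝ) : LinOn V fun x => f x :=
  ⟨fun x _ y _ => _root_.map_add f x y, fun c x _ => _root_.map_smul f c x⟩

lemma congr (hf : LinOn V f) (h : ∀ x ∈ V, g x = f x) : LinOn V g :=
  ⟨fun x hx y hy => by rw [h _ (V.add_mem hx hy), h x hx, h y hy, hf.map_add x hx y hy],
    fun c x hx => by rw [h _ (V.smul_mem c hx), h x hx, hf.map_smul c x hx]⟩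

lemma add (hf : LinOn V f) (hg : LinOn V g) : LinOn V fun x => f x + g x :=
  ⟨fun x hx y hy => by rw [hf.map_add x hx y hy, hg.map_add x hx y hy]; ring,
    fun c x hx => by rw [hf.map_smul c x hx, hg.map_smul c x hx]; ring⟩

lemma neg (hf : LinOn V f) : LinOn V fun x => -f x :=
  ⟨fun x hx y hy => by rw [hf.map_add x hx y hy]; ring,
    fun c x hx => by rw [hf.map_smul c x hx]; ring⟩

lemma sub (hf : LinOn V f) (hg : LinOn V g) : LinOn V fun x => f x - g x :=
  (hf.add hg.neg).congr fun _ _ => sub_eq_add_neg _ _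

lemma const_mul (hf : LinOn V f) (a : ℝ) : LinOn V fun x => a * f x :=
  ⟨fun x hx y hy => by rw [hf.map_add x hx y hy]; ring,
    fun c x hx => by rw [hf.map_smul c x hx]; ring⟩

lemma mul_const (hf : LinOn V f) (a : ℝ) : LinOn V fun x => f x * a :=
  (hf.const_mul a).congr fun _ _ => mul_comm _ _

lemma div_const (hf : LinOn V f) (a : ℝ) : LinOn V fun x => f x / a :=
  (hf.mul_const a⁻¹).congr fun _ _ => div_eq_mul_inv _ _

lemma sum {ι : Type*} {s : Finset ι} {f : ι → X → ℝ} (hf : ∀ i ∈ s, LinOn V (f i)) :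
    LinOn V fun x => ∑ i ∈ s, f i x :=
  ⟨fun x hx y hy => by
    rw [← Finset.sum_add_distrib]
    exact Finset.sum_congr rfl fun i hi => (hf i hi).map_add x hx y hy,
  fun c x hx => by
    rw [Finset.mul_sum]
    exact Finset.sum_congr rfl fun i hi => (hf i hi).map_smul c x hx⟩

/-- Integrals are additive only for integrable functions, and one-sided derivatives only for
differentiable ones. The forms are therefore linear on the discrete spaces and not on all functions,
which is why linearity is taken relative to a subspace. -/
lemma setIntegral {α : Type*} [MeasurableSpace α] {μ : Measure α} {S : Set α}
    (hS : MeasurableSet S) {b : X → α → ℝ} (hb : ∀ a ∈ S, LinOn V fun x => b x a)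
    (hint : ∀ x ∈ V, IntegrableOn (b x) S μ) : LinOn V fun x => ∫ a in S, b x a ∂μ :=
  ⟨fun x hx y hy => by
    rw [← integral_add (hint x hx) (hint y hy)]
    exact setIntegral_congr_fun hS fun a ha => (hb a ha).map_add x hx y hy,
  fun c x hx => by
    rw [← integral_const_mul]
    exact setIntegral_congr_fun hS fun a ha => (hb a ha).map_smul c x hx⟩

/-- The linear map on the subspace. -/
def toLinearMap (hf : LinOn V f) : V →ₗ[ℝ] ℝ where
  toFun x := f x
  map_add' x y := hf.map_add x x.2 y y.2
  map_smul' c x := hf.map_smul c x x.2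

end LinOn

namespace BilinOn

variable {b b' : X → Y → ℝ}

lemma add (hb : BilinOn V W b) (hb' : BilinOn V W b') : BilinOn V W fun x y => b x y + b' x y :=
  ⟨fun y hy => (hb.left y hy).add (hb'.left y hy),
    fun x hx => (hb.right x hx).add (hb'.right x hx)⟩

lemma sub (hb : BilinOn V W b) (hb' : BilinOn V W b') : BilinOn V W fun x y => b x y - b' x y :=
  ⟨fun y hy => (hb.left y hy).sub (hb'.left y hy),
    fun x hx => (hb.right x hx).sub (hb'.right x hx)⟩

lemma neg (hb : BilinOn V W b) : BilinOn V W fun x y => -b x y :=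
  ⟨fun y hy => (hb.left y hy).neg, fun x hx => (hb.right x hx).neg⟩

lemma const_mul (hb : BilinOn V W b) (a : ℝ) : BilinOn V W fun x y => a * b x y :=
  ⟨fun y hy => (hb.left y hy).const_mul a, fun x hx => (hb.right x hx).const_mul a⟩

lemma swap (hb : BilinOn V W b) : BilinOn W V fun y x => b x y := ⟨hb.right, hb.left⟩

lemma mul {f : X → ℝ} {g : Y → ℝ} (hf : LinOn V f) (hg : LinOn W g) :
    BilinOn V W fun x y => f x * g y :=
  ⟨fun y _ => hf.mul_const (g y), fun x _ => hg.const_mul (f x)⟩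

lemma sum {ι : Type*} {s : Finset ι} {b : ι → X → Y → ℝ} (hb : ∀ i ∈ s, BilinOn V W (b i)) :
    BilinOn V W fun x y => ∑ i ∈ s, b i x y :=
  ⟨fun y hy => LinOn.sum fun i hi => (hb i hi).left y hy,
    fun x hx => LinOn.sum fun i hi => (hb i hi).right x hx⟩

lemma setIntegral {α : Type*} [MeasurableSpace α] {μ : Measure α} {S : Set α}
    (hS : MeasurableSet S) {b : X → Y → α → ℝ} (hb : ∀ a ∈ S, BilinOn V W fun x y => b x y a)
    (hint : ∀ x ∈ V, ∀ y ∈ W, IntegrableOn (b x y) S μ) :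
    BilinOn V W fun x y => ∫ a in S, b x y a ∂μ :=
  ⟨fun y hy => LinOn.setIntegral hS (fun a ha => (hb a ha).left y hy) fun x hx => hint x hx y hy,
    fun x hx => LinOn.setIntegral hS (fun a ha => (hb a ha).right x hx) fun y hy => hint x hx y hy⟩

/-- The bilinear map on the subspaces. -/
def toLinearMap (hb : BilinOn V W b) : V →ₗ[ℝ] W →ₗ[ℝ] ℝ :=
  LinearMap.mk₂ ℝ (fun x y => b x y) (fun x x' y => (hb.left y y.2).map_add x x.2 x' x'.2)
    (fun c x y => (hb.left y y.2).map_smul c x x.2)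
    (fun x y y' => (hb.right x x.2).map_add y y.2 y' y'.2)
    (fun c x y => (hb.right x x.2).map_smul c y y.2)

end BilinOn

end LinOn

namespace Mesh

variable {d : ℕ} {Ω : Set (E d)} {M : Mesh d Ω} {κ h : ℝ} {K : Fin M.n} {m r : ℕ}

/-! ### Elements of the finite element spaces -/

lemma isMapped_of_mem_Vh {v : E d → E d} (hv : v ∈ M.Vh r) (K : Fin M.n) (i : Fin d) :
    M.IsMapped K (d * r) fun x => v x i := by
  obtain ⟨P, hP, h⟩ := hv.2.2 K i
  exact ⟨P, totalDegree_le_of_mem_restrictDegree hP, h⟩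

lemma isMapped_of_mem_QhCont {q : E d → ℝ} (hq : q ∈ M.QhCont r) (K : Fin M.n) :
    M.IsMapped K (d * r) q := by
  obtain ⟨P, hP, h⟩ := hq.2.2 K
  exact ⟨P, totalDegree_le_of_mem_restrictDegree hP, h⟩

lemma isMapped_of_mem_QhDisc {q : M.Broken} (hq : q ∈ M.QhDisc r) (K : Fin M.n) :
    M.IsMapped K r (q K) := by
  obtain ⟨P, hP, h⟩ := (hq K).2
  exact ⟨P, (MvPolynomial.mem_restrictTotalDegree _ _ _).1 hP, h⟩

section FiniteDimensional

variable {X : Type*} [AddCommGroup X] [Module ℝ X] {V : Submodule ℝ X}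

-- A function in `V` is determined by its pull-backs, and these lie in the range of a product of
-- finitely many polynomial spaces. Working in the range makes a linear choice of the polynomials
-- superfluous.
open Classical in
lemma finiteDimensional_of_isMapped {ι : Type*} [Finite ι] (el : ι → Fin M.n)
    (res : ι → X →ₗ[ℝ] (E d → ℝ)) (hres : ∀ v ∈ V, ∀ a, M.IsMapped (el a) m (res a v))
    (hinj : ∀ v ∈ V, (∀ a, ∀ x ∈ refCube d, res a v (M.map (el a) x) = 0) → v = 0) :
    FiniteDimensional ℝ V := by
  let Ψ : (ι → MvPolynomial.restrictTotalDegree (Fin d) ℝ m) →ₗ[ℝ] (ι → refCube d → ℝ) :=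
    { toFun := fun P a x => polyFun (P a).1 x
      map_add' := fun P R => by funext a x; exact polyFun_add _ _ _
      map_smul' := fun c P => by funext a x; exact polyFun_smul _ _ _ }
  let Φ : V →ₗ[ℝ] (ι → refCube d → ℝ) :=
    { toFun := fun v a x => res a v.1 (M.map (el a) x)
      map_add' := fun v w => by funext a x; simp
      map_smul' := fun c v => by funext a x; simp }
  have hmem : ∀ v : V, Φ v ∈ LinearMap.range Ψ := fun v => by
    choose P hPd hP using hres v.1 v.2
    refine ⟨fun a => ⟨P a, (MvPolynomial.mem_restrictTotalDegree _ _ _).2 (hPd a)⟩, ?_⟩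
    funext a x
    exact (hP a x x.2).symm
  refine Module.Finite.of_injective (Φ.codRestrict _ hmem)
    ((injective_iff_map_eq_zero _).2 fun v hv => Subtype.ext (hinj v.1 v.2 fun a x hx => ?_))
  have h1 := congrArg Subtype.val hv
  exact congrFun (congrFun h1 a) ⟨x, hx⟩

end FiniteDimensional

/-- A component of a vector field. -/
def compLin (i : Fin d) : (E d → E d) →ₗ[ℝ] (E d → ℝ) where
  toFun v x := v x i
  map_add' _ _ := rfl
  map_smul' _ _ := rfl

/-- The restrictions of a function to the elements. -/
def toBrokenLin (M : Mesh d Ω) : (E d → ℝ) →ₗ[ℝ] M.Broken where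
  toFun q := M.toBroken q
  map_add' _ _ := rfl
  map_smul' _ _ := rfl

lemma exists_mem_closedElem {x : E d} (hx : x ∈ closure Ω) : ∃ K, x ∈ M.closedElem K := by
  rw [← M.cover] at hx
  exact Set.mem_iUnion.1 hx

instance finiteDimensional_Vh : FiniteDimensional ℝ (M.Vh r) := by
  refine finiteDimensional_of_isMapped (M := M) (m := d * r) (ι := Fin M.n × Fin d)
    (fun a => a.1) (fun a => compLin a.2) (fun v hv a => isMapped_of_mem_Vh hv a.1 a.2)
    fun v hv h0 => ?_
  funext x
  by_cases hx : x ∈ closure Ω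
  · obtain ⟨K, y, hy, rfl⟩ := exists_mem_closedElem (M := M) hx
    ext i
    exact h0 (K, i) y hy
  · exact hv.2.1 x hx

instance finiteDimensional_QhCont : FiniteDimensional ℝ (M.QhCont r) := by
  refine finiteDimensional_of_isMapped (M := M) (m := d * r) (ι := Fin M.n) (fun K => K)
    (fun _ => LinearMap.id) (fun v hv K => isMapped_of_mem_QhCont hv K) fun v hv h0 => ?_
  funext x
  by_cases hx : x ∈ closure Ω
  · obtain ⟨K, y, hy, rfl⟩ := exists_mem_closedElem (M := M) hx
    exact h0 K y hy
  · exact hv.2.1 x hx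

instance finiteDimensional_QhDisc : FiniteDimensional ℝ (M.QhDisc r) := by
  refine finiteDimensional_of_isMapped (M := M) (m := r) (ι := Fin M.n) (fun K => K)
    (fun K => LinearMap.proj K) (fun v hv K => isMapped_of_mem_QhDisc hv K) fun v hv h0 => ?_
  funext K x
  by_cases hx : x ∈ M.closedElem K
  · obtain ⟨y, hy, rfl⟩ := hx
    exact h0 K y hy
  · exact (hv K).1 x hx

/-! ### The `L²` inner products -/

lemma eq_zero_of_setIntegral_eq_zero {U : Set (E d)} (hU : IsOpen U) {f : E d → ℝ}
    (hf : ContinuousOn f U) (hf0 : ∀ x, 0 ≤ f x) (hint : IntegrableOn f U)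
    (h : ∫ x in U, f x = 0) : ∀ x ∈ U, f x = 0 := by
  have h1 := (setIntegral_eq_zero_iff_of_nonneg_ae (Filter.Eventually.of_forall hf0) hint).1 h
  exact Measure.eqOn_of_ae_eq h1 hf continuousOn_const (by rw [hU.interior_eq]; exact subset_closure)

lemma bilinOn_l2Vec (hΩo : IsOpen Ω) (hΩb : Bornology.IsBounded Ω) :
    BilinOn (M.Vh r) (M.Vh r) (l2Vec Ω) := by
  refine BilinOn.setIntegral hΩo.measurableSet (fun x _ => BilinOn.sum fun i _ =>
    BilinOn.mul (f := fun v : E d → E d => v x i) (g := fun v : E d → E d => v x i)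
      ⟨fun _ _ _ _ => rfl, fun _ _ _ => rfl⟩ ⟨fun _ _ _ _ => rfl, fun _ _ _ => rfl⟩)
    fun v hv w hw => ?_
  have hc : ∀ v ∈ M.Vh r, ∀ i, ContinuousOn (fun x => v x i) (closure Ω) := fun v hv i =>
    (EuclideanSpace.proj i : E d →L[ℝ] ℝ).continuous.comp_continuousOn hv.1
  have : ContinuousOn (fun x => ∑ i, v x i * w x i) (closure Ω) :=
    continuousOn_finsetSum _ fun i _ => (hc v hv i).mul (hc w hw i)
  exact (this.integrableOn_compact hΩb.isCompact_closure).mono_set subset_closure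

lemma l2Vec_comm (w χ : E d → E d) : l2Vec Ω w χ = l2Vec Ω χ w := by
  simp only [l2Vec, mul_comm]

/-- A zero norm makes `v` vanish on `Ω`, then on the closure by continuity, and outside by the
convention of extension by zero. -/
lemma l2Vec_pos (hΩo : IsOpen Ω) (hΩb : Bornology.IsBounded Ω) {v : E d → E d} (hv : v ∈ M.Vh r)
    (h0 : v ≠ 0) : 0 < l2Vec Ω v v := by
  have hc : ∀ i, ContinuousOn (fun x => v x i) (closure Ω) := fun i =>
    (EuclideanSpace.proj i : E d →L[ℝ] ℝ).continuous.comp_continuousOn hv.1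
  have hcs : ContinuousOn (fun x => ∑ i, v x i * v x i) (closure Ω) :=
    continuousOn_finsetSum _ fun i _ => (hc i).mul (hc i)
  have hnn : ∀ x, 0 ≤ ∑ i, v x i * v x i := fun x => Finset.sum_nonneg fun i _ => mul_self_nonneg _
  have hint := (hcs.integrableOn_compact hΩb.isCompact_closure).mono_set subset_closure
    (μ := volume)
  refine (integral_nonneg hnn).lt_of_ne' fun h => h0 ?_
  have hz := eq_zero_of_setIntegral_eq_zero hΩo (hcs.mono subset_closure) hnn hint h
  have hz' : ∀ x ∈ Ω, v x = 0 := fun x hx => by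
    ext i
    exact mul_self_eq_zero.1 ((Finset.sum_eq_zero_iff_of_nonneg fun i _ => mul_self_nonneg _).1
      (hz x hx) i (Finset.mem_univ i))
  funext x
  by_cases hx : x ∈ closure Ω
  · exact Set.EqOn.of_subset_closure (s := Ω) (t := closure Ω) (f := v) (g := fun _ => 0)
      (fun x hx => hz' x hx) hv.1 continuousOn_const subset_closure le_rfl hx
  · exact hv.2.1 x hx

lemma l2Broken_comm (q ψ : M.Broken) : M.l2Broken q ψ = M.l2Broken ψ q := by
  simp only [l2Broken, mul_comm]

section Broken

variable {X : Type*} [AddCommGroup X] [Module ℝ X] {Q : Submodule ℝ X} {br : X →ₗ[ℝ] M.Broken}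

lemma bilinOn_l2Broken (hbr : ∀ q ∈ Q, ∀ K, M.IsMapped K m (br q K)) :
    BilinOn Q Q fun q ψ => M.l2Broken (br q) (br ψ) := by
  refine BilinOn.sum fun K _ => BilinOn.setIntegral (M.isOpen_elem K).measurableSet (fun x _ =>
    BilinOn.mul (f := fun q : X => br q K x) (g := fun q : X => br q K x)
      ⟨fun _ _ _ _ => by simp, fun _ _ _ => by simp⟩ ⟨fun _ _ _ _ => by simp, fun _ _ _ => by simp⟩)
    fun v hv w hw => ?_
  exact integrableOn_elem ((hbr v hv K).continuousOn.mul (hbr w hw K).continuousOn)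

/-- The pull-back to each open reference cell is a polynomial that vanishes there, so it is the zero
polynomial and the faces are covered as well. The map `br` lets one argument serve both pressure
spaces. -/
lemma l2Broken_pos (hbr : ∀ q ∈ Q, ∀ K, M.IsMapped K m (br q K))
    (hinj : ∀ q ∈ Q, (∀ K, ∀ x ∈ M.closedElem K, br q K x = 0) → q = 0) {q : X} (hq : q ∈ Q)
    (h0 : q ≠ 0) : 0 < M.l2Broken (br q) (br q) := by
  have hnn : ∀ K, 0 ≤ ∫ x in M.elem K, br q K x * br q K x :=
    fun K => integral_nonneg fun x => mul_self_nonneg _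
  refine (Finset.sum_nonneg fun K _ => hnn K).lt_of_ne' fun h => h0 (hinj q hq fun K x hx => ?_)
  have hK := (Finset.sum_eq_zero_iff_of_nonneg fun K _ => hnn K).1 h K (Finset.mem_univ K)
  have hc := (hbr q hq K).continuousOn
  have hz := eq_zero_of_setIntegral_eq_zero (M.isOpen_elem K)
    ((hc.mul hc).mono (M.elem_subset_closedElem K)) (fun x => mul_self_nonneg _)
    (integrableOn_elem (hc.mul hc)) hK
  obtain ⟨P, -, hP⟩ := hbr q hq K
  have hP0 : P = 0 := eq_zero_of_polyFun_eq_zero fun y hy => by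
    rw [← hP y (openRefCube_subset hy)]
    exact mul_self_eq_zero.1 (hz _ (Set.mem_image_of_mem _ hy))
  obtain ⟨y, hy, rfl⟩ := hx
  rw [hP y hy, hP0]
  exact map_zero _

end Broken

lemma isMapped_toBrokenLin {q : E d → ℝ} (hq : q ∈ M.QhCont r) (K : Fin M.n) :
    M.IsMapped K (d * r) (M.toBrokenLin q K) := isMapped_of_mem_QhCont hq K

lemma eq_zero_of_mem_QhCont {q : E d → ℝ} (hq : q ∈ M.QhCont r)
    (h : ∀ K, ∀ x ∈ M.closedElem K, M.toBrokenLin q K x = 0) : q = 0 := by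
  funext x
  by_cases hx : x ∈ closure Ω
  · obtain ⟨K, hK⟩ := exists_mem_closedElem (M := M) hx
    exact h K x hK
  · exact hq.2.1 x hx

lemma eq_zero_of_mem_QhDisc {q : M.Broken} (hq : q ∈ M.QhDisc r)
    (h : ∀ K, ∀ x ∈ M.closedElem K, q K x = 0) : q = 0 := by
  funext K x
  by_cases hx : x ∈ M.closedElem K
  · exact h K x hx
  · exact (hq K).1 x hx

end Mesh

end Biot

end

noncomputable section

namespace Biot

open MeasureTheory

lemma refNormal_ne_zero {d : ℕ} (f : Fin d × Bool) : refNormal f ≠ 0 := by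
  intro h
  have := congrArg (fun v : E d => v f.1) h
  simp only [refNormal, PiLp.single_apply] at this
  split_ifs at this <;> norm_num at this

lemma BilinOn.mono_left {X Y : Type*} [AddCommGroup X] [Module ℝ X] [AddCommGroup Y] [Module ℝ Y]
    {V V' : Submodule ℝ X} {W : Submodule ℝ Y} {b : X → Y → ℝ} (hb : BilinOn V W b) (h : V' ≤ V) :
    BilinOn V' W b :=
  ⟨fun y hy => ⟨fun x hx x' hx' => (hb.left y hy).map_add x (h hx) x' (h hx'),
    fun c x hx => (hb.left y hy).map_smul c x (h hx)⟩, fun x hx => hb.right x (h hx)⟩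

namespace Mesh

variable {d : ℕ} {Ω : Set (E d)} {M : Mesh d Ω} {κ h : ℝ} {K : Fin M.n} {m r : ℕ}

/-! ### Linearity and continuity of the derivatives -/

/-- The restriction of broken functions to an element. -/
def restrLin (M : Mesh d Ω) (K : Fin M.n) : M.Broken →ₗ[ℝ] (E d → ℝ) where
  toFun q := q K
  map_add' _ _ := rfl
  map_smul' _ _ := rfl

lemma IsQuotient.congr {f g : E d → ℝ} (hf : M.IsQuotient K m f)
    (h : ∀ y ∈ M.closedElem K, g y = f y) : M.IsQuotient K m g := by
  obtain ⟨P, hPd, hP⟩ := hf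
  exact ⟨P, hPd, fun x hx => by rw [h _ (Set.mem_image_of_mem _ hx), hP x hx]⟩

section Lin

variable {X : Type*} [AddCommGroup X] [Module ℝ X] {V : Submodule ℝ X}

lemma linOn_res (res : X →ₗ[ℝ] (E d → ℝ)) (y : E d) : LinOn V fun v => res v y :=
  ⟨fun _ _ _ _ => by simp, fun _ _ _ => by simp⟩

/-- Mapped polynomials are differentiable up to the boundary of the element, and unique
differentiability identifies the derivative of a sum with the sum of the derivatives. -/
lemma linOn_gradScal {res : X →ₗ[ℝ] (E d → ℝ)} (hres : ∀ v ∈ V, M.IsMapped K m (res v))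
    {y : E d} (hy : y ∈ M.closedElem K) (j : Fin d) :
    LinOn V fun v => M.gradScal K (res v) j y := by
  have hu := M.uniqueDiffWithinAt_closedElem K hy
  constructor
  · intro v hv w hw
    have h := ((hres v hv).hasFDerivWithinAt hy).add ((hres w hw).hasFDerivWithinAt hy)
    simp only [gradScal, map_add, h.fderivWithin hu]
    rfl
  · intro c v hv
    have h := ((hres v hv).hasFDerivWithinAt hy).const_smul c
    simp only [gradScal, map_smul, h.fderivWithin hu]
    rfl

lemma linOn_flux (Kp : Matrix (Fin d) (Fin d) ℝ) {res : X →ₗ[ℝ] (E d → ℝ)}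
    (hres : ∀ v ∈ V, M.IsMapped K m (res v)) {y : E d} (hy : y ∈ M.closedElem K) (i : Fin d) :
    LinOn V fun v => M.flux Kp K (res v) y i :=
  LinOn.sum fun j _ => (linOn_gradScal hres hy j).const_mul _

lemma linOn_fluxNormal (Kp : Matrix (Fin d) (Fin d) ℝ) {res : X →ₗ[ℝ] (E d → ℝ)}
    (hres : ∀ v ∈ V, M.IsMapped K m (res v)) (F : M.LocalFace) {y : E d}
    (hy : y ∈ M.closedElem K) : LinOn V fun v => M.fluxNormal Kp K F (res v) y :=
  LinOn.sum fun i _ => (linOn_flux Kp hres hy i).mul_const _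

end Lin

lemma partialVec_eq {w : E d → E d} (hw : ∀ i, M.IsMapped K m fun x => w x i) {y : E d}
    (hy : y ∈ M.closedElem K) (i j : Fin d) :
    M.partialVec K w i j y = M.gradScal K (fun x => w x i) j y := by
  have hu := M.uniqueDiffWithinAt_closedElem K hy
  have h1 : DifferentiableWithinAt ℝ w (M.closedElem K) y :=
    differentiableWithinAt_euclidean.2 fun i => ((hw i).hasFDerivWithinAt hy).differentiableWithinAt
  have h2 := hasFDerivWithinAt_euclidean.1 h1.hasFDerivWithinAt i
  rw [gradScal, h2.fderivWithin hu]
  rfl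

lemma linOn_partialVec {y : E d} (hy : y ∈ M.closedElem K) (i j : Fin d) :
    LinOn (M.Vh r) fun w => M.partialVec K w i j y :=
  (linOn_gradScal (res := compLin i) (fun _ hv => isMapped_of_mem_Vh hv K i) hy j).congr
    fun _ hw => partialVec_eq (isMapped_of_mem_Vh hw K) hy i j

lemma linOn_strain {y : E d} (hy : y ∈ M.closedElem K) (i j : Fin d) :
    LinOn (M.Vh r) fun w => M.strain K w y i j :=
  ((linOn_partialVec hy i j).add (linOn_partialVec hy j i)).div_const 2

lemma linOn_divg {y : E d} (hy : y ∈ M.closedElem K) : LinOn (M.Vh r) fun w => M.divg K w y :=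
  LinOn.sum fun i _ => linOn_partialVec hy i i

lemma linOn_stress (Ct : Fin d → Fin d → Fin d → Fin d → ℝ) {y : E d} (hy : y ∈ M.closedElem K)
    (i j : Fin d) : LinOn (M.Vh r) fun w => M.stress Ct K w y i j :=
  LinOn.sum fun k _ => LinOn.sum fun l _ => (linOn_strain hy k l).const_mul _

lemma bilinOn_tractionDot (Ct : Fin d → Fin d → Fin d → Fin d → ℝ) (W : Submodule ℝ (E d → E d))
    (F : M.LocalFace) {y : E d} (hy : y ∈ M.closedElem F.1) :
    BilinOn (M.Vh r) W fun w z => M.tractionDot Ct F w z y :=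
  BilinOn.sum fun i _ => BilinOn.mul
    (LinOn.sum fun j _ => (linOn_stress Ct hy i j).mul_const _) (linOn_res (compLin i) y)

lemma isQuotient_partialVec {w : E d → E d} (hw : w ∈ M.Vh r) (K : Fin M.n) (i j : Fin d) :
    M.IsQuotient K (d * r + d * d) (M.partialVec K w i j) :=
  ((isMapped_of_mem_Vh hw K i).gradScal j).congr fun _ hy =>
    partialVec_eq (isMapped_of_mem_Vh hw K) hy i j

lemma isQuotient_strain {w : E d → E d} (hw : w ∈ M.Vh r) (K : Fin M.n) (i j : Fin d) :
    M.IsQuotient K (d * r + d * d) fun x => M.strain K w x i j :=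
  (((isQuotient_partialVec hw K i j).add (isQuotient_partialVec hw K j i)).const_mul 2⁻¹).congr
    fun _ _ => div_eq_inv_mul _ _

lemma isQuotient_divg {w : E d → E d} (hw : w ∈ M.Vh r) (K : Fin M.n) :
    M.IsQuotient K (d * r + d * d) (M.divg K w) :=
  IsQuotient.sum fun i _ => isQuotient_partialVec hw K i i

lemma isQuotient_stress (Ct : Fin d → Fin d → Fin d → Fin d → ℝ) {w : E d → E d}
    (hw : w ∈ M.Vh r) (K : Fin M.n) (i j : Fin d) :
    M.IsQuotient K (d * r + d * d) fun x => M.stress Ct K w x i j :=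
  IsQuotient.sum fun k _ => IsQuotient.sum fun l _ => (isQuotient_strain hw K k l).const_mul _

lemma IsMapped.flux {q : E d → ℝ} (hq : M.IsMapped K m q) (Kp : Matrix (Fin d) (Fin d) ℝ)
    (i : Fin d) : M.IsQuotient K (m + d * d) fun x => M.flux Kp K q x i :=
  IsQuotient.sum fun j _ => (hq.gradScal j).const_mul _

/-- Inversion is continuous at invertible maps, so it remains to see that the vector to be
normalized is nonzero. Continuity and length at most one are the only properties of the normal that
the estimates use. -/
lemma continuousOn_normal (F : M.LocalFace) (i : Fin d) :
    ContinuousOn (fun x => M.normal F x i) (M.closedElem F.1) := by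
  refine (EuclideanSpace.proj i : E d →L[ℝ] ℝ).continuous.comp_continuousOn
    (f := fun x => M.normal F x) ?_
  have h1 : ContinuousOn (fun x => (fderiv ℝ (M.map F.1) (M.invMap F.1 x)).inverse)
      (M.closedElem F.1) := by
    intro x hx
    have hinv : (fderiv ℝ (M.map F.1) (M.invMap F.1 x)).IsInvertible :=
      ⟨M.fderivEquiv F.1 (M.invMap_mem F.1 hx), M.coe_fderivEquiv F.1 (M.invMap_mem F.1 hx)⟩
    have h2 : ContinuousAt ContinuousLinearMap.inverse
        (fderiv ℝ (M.map F.1) (M.invMap F.1 x)) :=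
      (hinv.contDiffAt_map_inverse (n := 0)).continuousAt
    have h3 : ContinuousWithinAt (fun x => fderiv ℝ (M.map F.1) (M.invMap F.1 x))
        (M.closedElem F.1) x :=
      ((M.contDiff_map F.1).continuous_fderiv one_ne_zero).continuousAt.comp_continuousWithinAt
        (M.continuousOn_invMap F.1 x hx)
    exact ContinuousAt.comp_continuousWithinAt
      (f := fun x => fderiv ℝ (M.map F.1) (M.invMap F.1 x))
      (g := ContinuousLinearMap.inverse) h2 h3
  have h4 : ContinuousOn (fun x => ContinuousLinearMap.adjoint
      (fderiv ℝ (M.map F.1) (M.invMap F.1 x)).inverse (refNormal F.2)) (M.closedElem F.1) :=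
    ((ContinuousLinearMap.adjoint (𝕜 := ℝ) (E := E d) (F := E d)).continuous.comp_continuousOn
      h1).clm_apply continuousOn_const
  refine (h4.norm.inv₀ fun x hx => ?_).smul h4
  rw [norm_ne_zero_iff]
  intro h0
  have hinv : (fderiv ℝ (M.map F.1) (M.invMap F.1 x)).IsInvertible :=
    ⟨M.fderivEquiv F.1 (M.invMap_mem F.1 hx), M.coe_fderivEquiv F.1 (M.invMap_mem F.1 hx)⟩
  -- The adjoint of the derivative takes the vector to be normalized back to `refNormal`, which is
  -- not zero.
  have h5 := congrArg ContinuousLinearMap.adjoint hinv.inverse_comp_self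
  rw [ContinuousLinearMap.adjoint_comp] at h5
  have h6 := congrArg (fun L : E d →L[ℝ] E d => L (refNormal F.2)) h5
  rw [ContinuousLinearMap.comp_apply, h0, map_zero, ContinuousLinearMap.adjoint_id] at h6
  exact refNormal_ne_zero F.2 h6.symm

lemma sum_normal_sq_le (F : M.LocalFace) (x : E d) : ∑ i, M.normal F x i ^ 2 ≤ 1 := by
  rw [← EuclideanSpace.real_norm_sq_eq]
  have h : ‖M.normal F x‖ ≤ 1 := by
    unfold normal
    rw [norm_smul, norm_inv, norm_norm]
    exact inv_mul_le_one
  exact pow_le_one₀ (norm_nonneg _) h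

lemma continuousOn_traction (Ct : Fin d → Fin d → Fin d → Fin d → ℝ) {w : E d → E d}
    (hw : w ∈ M.Vh r) (F : M.LocalFace) (i : Fin d) :
    ContinuousOn (fun x => ∑ j, M.stress Ct F.1 w x i j * M.normal F x j) (M.closedElem F.1) :=
  continuousOn_finsetSum _ fun j _ => (isQuotient_stress Ct hw F.1 i j).continuousOn.mul
    (continuousOn_normal F j)

lemma IsMapped.continuousOn_fluxNormal {q : E d → ℝ} (hq : M.IsMapped K m q)
    (Kp : Matrix (Fin d) (Fin d) ℝ) (F : M.LocalFace) {S : Set (E d)} (hS : S ⊆ M.closedElem K)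
    (hS' : S ⊆ M.closedElem F.1) : ContinuousOn (M.fluxNormal Kp K F q) S :=
  continuousOn_finsetSum _ fun i _ => ((hq.flux Kp i).continuousOn.mono hS).mul
    ((continuousOn_normal F i).mono hS')

/-! ### Integrability on the faces -/

lemma QuasiUniform.integrableOn_face (H : M.QuasiUniform κ h) (F : M.LocalFace) {S : Set (E d)}
    (hS : IsCompact S) (hSF : S ⊆ M.face F) {g : E d → ℝ} (hg : ContinuousOn g S) :
    IntegrableOn g S (Measure.euclideanHausdorffMeasure (d - 1)) := by
  have h1 : IntegrableOn (fun _ => (1 : ℝ)) S (Measure.euclideanHausdorffMeasure (d - 1)) :=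
    integrableOn_const ((measure_mono hSF).trans_lt (H.measure_face_lt_top F)).ne
  simpa using h1.continuousOn_mul hg hS

lemma QuasiUniform.integrableOn_of_memLp (H : M.QuasiUniform κ h) (F : M.LocalFace)
    {S Γ : Set (E d)} (hSF : S ⊆ M.face F) (hSΓ : S ⊆ Γ) {g : E d → ℝ}
    (hg : MemLp g 2 ((Measure.euclideanHausdorffMeasure (d - 1)).restrict Γ)) :
    IntegrableOn g S (Measure.euclideanHausdorffMeasure (d - 1)) := by
  have : IsFiniteMeasure ((Measure.euclideanHausdorffMeasure (d - 1)).restrict S) :=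
    ⟨by
      rw [Measure.restrict_apply_univ]
      exact (measure_mono hSF).trans_lt (H.measure_face_lt_top F)⟩
  exact (hg.mono_measure (Measure.restrict_mono hSΓ le_rfl)).integrable (by norm_num)

/-- Scalar functions that are integrable on the boundary faces within `Γ`. -/
def intScal (M : Mesh d Ω) (Γ : Set (E d)) : Submodule ℝ (E d → ℝ) where
  carrier := {q | ∀ F : M.LocalFace, IntegrableOn q (M.face F ∩ Γ)
    (Measure.euclideanHausdorffMeasure (d - 1))}
  zero_mem' := fun _ => integrableOn_zero
  add_mem' := fun hv hw F => (hv F).add (hw F)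
  smul_mem' := fun c _ hv F => (hv F).smul c

/-- Vector fields that are integrable on the boundary faces within `Γ`. -/
def intVec (M : Mesh d Ω) (Γ : Set (E d)) : Submodule ℝ (E d → E d) :=
  ⨅ i : Fin d, (M.intScal Γ).comap (compLin i)

lemma mem_intVec {Γ : Set (E d)} {w : E d → E d} :
    w ∈ M.intVec Γ ↔ ∀ i, (fun x => w x i) ∈ M.intScal Γ := by
  simp only [intVec, Submodule.mem_iInf, Submodule.mem_comap]
  rfl

lemma QuasiUniform.mem_intScal (H : M.QuasiUniform κ h) {Γ : Set (E d)} (hΓ : IsClosed Γ)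
    {q : E d → ℝ} (hq : ∀ K, M.IsMapped K m q) : q ∈ M.intScal Γ := fun F =>
  H.integrableOn_face F ((isCompact_face F).inter_right hΓ) Set.inter_subset_left
    ((hq F.1).continuousOn.mono (Set.inter_subset_left.trans (face_subset F)))

lemma QuasiUniform.Vh_le_intVec (H : M.QuasiUniform κ h) {Γ : Set (E d)} (hΓ : IsClosed Γ) :
    M.Vh r ≤ M.intVec Γ := fun _ hw => mem_intVec.2 fun i =>
  H.mem_intScal hΓ fun K => isMapped_of_mem_Vh hw K i

lemma QuasiUniform.QhCont_le_intScal (H : M.QuasiUniform κ h) {Γ : Set (E d)} (hΓ : IsClosed Γ) :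
    M.QhCont r ≤ M.intScal Γ := fun _ hq => H.mem_intScal hΓ (isMapped_of_mem_QhCont hq)

/-- The first argument of the Nitsche forms is a discrete function on the left-hand side and L² data
on the right-hand side. Traces integrable on the faces form a common domain, since the second factor
is continuous on compact faces. -/
lemma QuasiUniform.mem_intScal_of_memLp (H : M.QuasiUniform κ h) {Γ : Set (E d)} {q : E d → ℝ}
    (hq : MemLp q 2 ((Measure.euclideanHausdorffMeasure (d - 1)).restrict Γ)) :
    q ∈ M.intScal Γ := fun F =>
  H.integrableOn_of_memLp F Set.inter_subset_left Set.inter_subset_right hq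

lemma QuasiUniform.mem_intVec_of_memLp (H : M.QuasiUniform κ h) {Γ : Set (E d)} {w : E d → E d}
    (hw : MemLp w 2 ((Measure.euclideanHausdorffMeasure (d - 1)).restrict Γ)) :
    w ∈ M.intVec Γ := mem_intVec.2 fun i =>
  H.mem_intScal_of_memLp (hw.continuousLinearMap_comp (EuclideanSpace.proj i : E d →L[ℝ] ℝ))

/-! ### Bilinearity of the forms of the local problem. -/

section Forms

variable {Γ : Set (E d)}

lemma isCompact_face_inter (hΓ : IsClosed Γ) (F : M.LocalFace) : IsCompact (M.face F ∩ Γ) :=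
  (isCompact_face F).inter_right hΓ

lemma face_inter_subset (F : M.LocalFace) : M.face F ∩ Γ ⊆ M.closedElem F.1 :=
  Set.inter_subset_left.trans (face_subset F)

lemma bilinOn_surfInt_traction (hΓ : IsClosed Γ) (Ct : Fin d → Fin d → Fin d → Fin d → ℝ)
    (F : M.LocalFace) : BilinOn (M.Vh r) (M.intVec Γ) fun w z =>
      surfInt (M.face F ∩ Γ) fun x => M.tractionDot Ct F w z x := by
  refine BilinOn.setIntegral (isCompact_face_inter hΓ F).measurableSet
    (fun x hx => bilinOn_tractionDot Ct _ F (face_inter_subset F hx)) fun w hw z hz => ?_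
  refine integrable_finsetSum _ fun i _ => ?_
  exact IntegrableOn.continuousOn_mul
    ((continuousOn_traction Ct hw F i).mono (face_inter_subset F)) (mem_intVec.1 hz i F)
    (isCompact_face_inter hΓ F)

lemma bilinOn_surfInt_mul (hΓ : IsClosed Γ) (F : M.LocalFace) :
    BilinOn (M.intVec Γ) (M.Vh r) fun w z =>
      surfInt (M.face F ∩ Γ) fun x => ∑ i, w x i * z x i := by
  refine BilinOn.setIntegral (isCompact_face_inter hΓ F).measurableSet
    (fun x hx => BilinOn.sum fun i _ => BilinOn.mul (linOn_res (compLin i) x)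
      (linOn_res (compLin i) x)) fun w hw z hz => ?_
  refine integrable_finsetSum _ fun i _ => ?_
  exact IntegrableOn.mul_continuousOn (mem_intVec.1 hw i F)
    ((isMapped_of_mem_Vh hz F.1 i).continuousOn.mono (face_inter_subset F))
    (isCompact_face_inter hΓ F)

lemma bilinOn_aNitsche (hΓ : IsClosed Γ) (Ct : Fin d → Fin d → Fin d → Fin d → ℝ) (γ : ℝ) :
    BilinOn (M.intVec Γ) (M.Vh r) (M.aNitsche Ct Γ γ) :=
  BilinOn.sum fun F _ => (bilinOn_surfInt_traction hΓ Ct F).swap.neg.add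
    ((bilinOn_surfInt_mul hΓ F).const_mul _)

lemma integrableOn_stress_mul_strain (Ct : Fin d → Fin d → Fin d → Fin d → ℝ) {w z : E d → E d}
    (hw : w ∈ M.Vh r) (hz : z ∈ M.Vh r) (K : Fin M.n) :
    IntegrableOn (fun x => ∑ i, ∑ j, M.stress Ct K w x i j * M.strain K z x i j) (M.elem K) :=
  integrableOn_elem (continuousOn_finsetSum _ fun i _ => continuousOn_finsetSum _ fun j _ =>
    (isQuotient_stress Ct hw K i j).continuousOn.mul (isQuotient_strain hz K i j).continuousOn)

lemma QuasiUniform.bilinOn_formA (H : M.QuasiUniform κ h) (hΓ : IsClosed Γ)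
    (Ct : Fin d → Fin d → Fin d → Fin d → ℝ) (γ : ℝ) :
    BilinOn (M.Vh r) (M.Vh r) (M.formA Ct Γ γ) := by
  have h1 := (bilinOn_aNitsche (r := r) (M := M) hΓ Ct γ).mono_left (H.Vh_le_intVec (r := r) hΓ)
  have h2 : ∀ F : M.LocalFace, BilinOn (M.Vh r) (M.Vh r) fun w z =>
      surfInt (M.face F ∩ Γ) fun x => M.tractionDot Ct F w z x := fun F =>
    ((bilinOn_surfInt_traction (r := r) hΓ Ct F).swap.mono_left (H.Vh_le_intVec hΓ)).swap
  refine BilinOn.add (BilinOn.sub (BilinOn.sum fun K _ => ?_) (BilinOn.sum fun F _ => h2 F)) h1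
  exact BilinOn.setIntegral (M.isOpen_elem K).measurableSet (fun x hx => BilinOn.sum fun i _ =>
    BilinOn.sum fun j _ => BilinOn.mul (linOn_stress Ct (M.elem_subset_closedElem K hx) i j)
      (linOn_strain (M.elem_subset_closedElem K hx) i j))
    fun w hw z hz => integrableOn_stress_mul_strain Ct hw hz K

section Broken

variable {X : Type*} [AddCommGroup X] [Module ℝ X] {Q : Submodule ℝ X} {br : X →ₗ[ℝ] M.Broken}

/-- The restriction to an element. -/
def brLin (br : X →ₗ[ℝ] M.Broken) (K : Fin M.n) : X →ₗ[ℝ] (E d → ℝ) := LinearMap.proj K ∘ₗ br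

lemma bilinOn_surfInt_normal (hΓ : IsClosed Γ) (hbr : ∀ q ∈ Q, ∀ K, M.IsMapped K m (br q K))
    (F : M.LocalFace) : BilinOn (M.intVec Γ) Q fun χ q =>
      surfInt (M.face F ∩ Γ) fun x => (∑ i, χ x i * M.normal F x i) * br q F.1 x := by
  refine BilinOn.setIntegral (isCompact_face_inter hΓ F).measurableSet
    (fun x hx => BilinOn.mul (LinOn.sum fun i _ => (linOn_res (compLin i) x).mul_const _)
      (linOn_res (brLin br F.1) x)) fun w hw q hq => ?_
  refine IntegrableOn.mul_continuousOn (integrable_finsetSum _ fun i _ => ?_)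
    ((hbr q hq F.1).continuousOn.mono (face_inter_subset F)) (isCompact_face_inter hΓ F)
  exact IntegrableOn.mul_continuousOn (mem_intVec.1 hw i F)
    ((continuousOn_normal F i).mono (face_inter_subset F)) (isCompact_face_inter hΓ F)

lemma QuasiUniform.bilinOn_formC (H : M.QuasiUniform κ h) (hΓ : IsClosed Γ)
    (hbr : ∀ q ∈ Q, ∀ K, M.IsMapped K m (br q K)) (α : ℝ) :
    BilinOn (M.Vh r) Q fun χ q => M.formC α Γ χ (br q) := by
  refine BilinOn.add (BilinOn.const_mul (BilinOn.sum fun K _ => ?_) _)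
    (BilinOn.const_mul (BilinOn.sum fun F _ =>
      (bilinOn_surfInt_normal hΓ hbr F).mono_left (H.Vh_le_intVec hΓ)) _)
  exact BilinOn.setIntegral (M.isOpen_elem K).measurableSet (fun x hx =>
    BilinOn.mul (linOn_divg (M.elem_subset_closedElem K hx)) (linOn_res (brLin br K) x))
    fun w hw q hq => integrableOn_elem ((isQuotient_divg hw K).continuousOn.mul
      (hbr q hq K).continuousOn)

lemma IsMapped.integrableOn_flux_mul_grad {q ψ : E d → ℝ} (hq : M.IsMapped K m q)
    (hψ : M.IsMapped K m ψ) (Kp : Matrix (Fin d) (Fin d) ℝ) :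
    IntegrableOn (fun x => ∑ i, M.flux Kp K q x i * M.gradScal K ψ i x) (M.elem K) :=
  integrableOn_elem (continuousOn_finsetSum _ fun i _ =>
    (hq.flux Kp i).continuousOn.mul (hψ.gradScal i).continuousOn)

lemma bilinOn_flux_grad (hbr : ∀ q ∈ Q, ∀ K, M.IsMapped K m (br q K))
    (Kp : Matrix (Fin d) (Fin d) ℝ) (K : Fin M.n) : BilinOn Q Q fun q ψ =>
      ∫ x in M.elem K, ∑ i, M.flux Kp K (br q K) x i * M.gradScal K (br ψ K) i x := by
  refine BilinOn.setIntegral (M.isOpen_elem K).measurableSet (fun x hx => BilinOn.sum fun i _ =>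
    BilinOn.mul (linOn_flux (res := brLin br K) Kp (fun q hq => hbr q hq K)
      (M.elem_subset_closedElem K hx) i)
      (linOn_gradScal (res := brLin br K) (fun q hq => hbr q hq K)
        (M.elem_subset_closedElem K hx) i)) fun q hq ψ hψ => ?_
  exact (hbr q hq K).integrableOn_flux_mul_grad (hbr ψ hψ K) Kp

/-- Products of integrable functions and functions that depend linearly on `ψ` and are continuous
on a part `S` of a face. -/
lemma bilinOn_surfInt_of_continuousOn {Y : Type*} [AddCommGroup Y] [Module ℝ Y]
    {L : Submodule ℝ Y} {S : Set (E d)} (hS : IsCompact S) {u : Y → E d → ℝ}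
    {g : X → E d → ℝ} (hu : ∀ x ∈ S, LinOn L fun y => u y x) (hg : ∀ x ∈ S, LinOn Q fun q => g q x)
    (hui : ∀ y ∈ L, IntegrableOn (u y) S (Measure.euclideanHausdorffMeasure (d - 1)))
    (hgc : ∀ q ∈ Q, ContinuousOn (g q) S) :
    BilinOn L Q fun y q => surfInt S fun x => u y x * g q x :=
  BilinOn.setIntegral hS.measurableSet (fun x hx => BilinOn.mul (hu x hx) (hg x hx))
    fun y hy q hq => IntegrableOn.mul_continuousOn (hui y hy) (hgc q hq) hS

end Broken

lemma bilinOn_bNitsche (hΓ : IsClosed Γ) (Kp : Matrix (Fin d) (Fin d) ℝ) (γ : ℝ) :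
    BilinOn (M.intScal Γ) (M.QhCont r) (M.bNitsche Kp Γ γ) := by
  have hm : ∀ K, ∀ q ∈ M.QhCont r, M.IsMapped K (d * r) q :=
    fun K q hq => isMapped_of_mem_QhCont hq K
  refine BilinOn.sum fun F _ => BilinOn.add (BilinOn.neg ?_) (BilinOn.const_mul ?_ _)
  · refine bilinOn_surfInt_of_continuousOn (isCompact_face_inter hΓ F)
      (fun x _ => linOn_res LinearMap.id x) (fun x hx => linOn_fluxNormal (res := LinearMap.id) Kp
        (hm F.1) F (face_inter_subset F hx)) (fun y hy => hy F) fun q hq => ?_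
    exact (hm F.1 q hq).continuousOn_fluxNormal Kp F (face_inter_subset F) (face_inter_subset F)
  · exact bilinOn_surfInt_of_continuousOn (isCompact_face_inter hΓ F)
      (fun x _ => linOn_res LinearMap.id x) (fun x _ => linOn_res LinearMap.id x)
      (fun y hy => hy F) fun q hq => (hm F.1 q hq).continuousOn.mono (face_inter_subset F)

lemma QuasiUniform.bilinOn_formBCont (H : M.QuasiUniform κ h) (hΓ : IsClosed Γ)
    (Kp : Matrix (Fin d) (Fin d) ℝ) (γ : ℝ) :
    BilinOn (M.QhCont r) (M.QhCont r) (M.formBCont Kp Γ γ) := by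
  have hm : ∀ K, ∀ q ∈ M.QhCont r, M.IsMapped K (d * r) q :=
    fun K q hq => isMapped_of_mem_QhCont hq K
  refine BilinOn.add (BilinOn.sub (BilinOn.sum fun K _ => bilinOn_flux_grad (br := M.toBrokenLin)
    (fun q hq K => isMapped_toBrokenLin hq K) Kp K) (BilinOn.sum fun F _ => ?_))
    ((bilinOn_bNitsche hΓ Kp γ).mono_left (H.QhCont_le_intScal hΓ))
  refine bilinOn_surfInt_of_continuousOn (isCompact_face_inter hΓ F)
    (fun x hx => linOn_fluxNormal (res := LinearMap.id) Kp (hm F.1) F (face_inter_subset F hx))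
    (fun x _ => linOn_res LinearMap.id x) (fun q hq => ?_)
    fun q hq => (hm F.1 q hq).continuousOn.mono (face_inter_subset F)
  exact H.integrableOn_face F (isCompact_face_inter hΓ F) Set.inter_subset_left
    ((hm F.1 q hq).continuousOn_fluxNormal Kp F (face_inter_subset F) (face_inter_subset F))

lemma face_subset_of_mem_intFaces {F : M.LocalFace × M.LocalFace} (hF : F ∈ M.intFaces) :
    M.face F.1 ⊆ M.closedElem F.2.1 := by
  have : M.face F.1 = M.face F.2 := by
    simp only [intFaces, Finset.mem_filter] at hF
    exact hF.2.2.1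
  rw [this]
  exact face_subset F.2

lemma linOn_jump (F : M.LocalFace × M.LocalFace) (Q : Submodule ℝ M.Broken) (x : E d) :
    LinOn Q fun q => M.jump F q x :=
  (linOn_res (M.restrLin F.1.1) x).sub (linOn_res (M.restrLin F.2.1) x)

lemma linOn_avgFluxNormal (Kp : Matrix (Fin d) (Fin d) ℝ) {F : M.LocalFace × M.LocalFace}
    (hF : F ∈ M.intFaces) {x : E d} (hx : x ∈ M.face F.1) :
    LinOn (M.QhDisc r) fun q => M.avgFluxNormal Kp F q x :=
  ((linOn_fluxNormal (res := M.restrLin F.1.1) Kp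
      (fun _ hq => isMapped_of_mem_QhDisc hq F.1.1) F.1 (face_subset F.1 hx)).add
    (linOn_fluxNormal (res := M.restrLin F.2.1) Kp
      (fun _ hq => isMapped_of_mem_QhDisc hq F.2.1) F.1
      (face_subset_of_mem_intFaces hF hx))).div_const 2

lemma continuousOn_jump {F : M.LocalFace × M.LocalFace} (hF : F ∈ M.intFaces) {q : M.Broken}
    (hq : q ∈ M.QhDisc r) : ContinuousOn (M.jump F q) (M.face F.1) :=
  ((isMapped_of_mem_QhDisc hq F.1.1).continuousOn.mono (face_subset F.1)).sub
    ((isMapped_of_mem_QhDisc hq F.2.1).continuousOn.mono (face_subset_of_mem_intFaces hF))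

lemma continuousOn_avgFluxNormal (Kp : Matrix (Fin d) (Fin d) ℝ) {F : M.LocalFace × M.LocalFace}
    (hF : F ∈ M.intFaces) {q : M.Broken} (hq : q ∈ M.QhDisc r) :
    ContinuousOn (M.avgFluxNormal Kp F q) (M.face F.1) :=
  (((isMapped_of_mem_QhDisc hq F.1.1).continuousOn_fluxNormal Kp F.1 (face_subset F.1)
      (face_subset F.1)).add
    ((isMapped_of_mem_QhDisc hq F.2.1).continuousOn_fluxNormal Kp F.1
      (face_subset_of_mem_intFaces hF) (face_subset F.1))).div_const 2

lemma QuasiUniform.bilinOn_formBDisc (H : M.QuasiUniform κ h)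
    (Kp : Matrix (Fin d) (Fin d) ℝ) (γ : ℝ) :
    BilinOn (M.QhDisc r) (M.QhDisc r) (M.formBDisc Kp γ) := by
  have hm : ∀ K, ∀ q ∈ M.QhDisc r, M.IsMapped K r (q K) :=
    fun K q hq => isMapped_of_mem_QhDisc hq K
  have hmi : ∀ (F : M.LocalFace) {g : E d → ℝ}, ContinuousOn g (M.face F) →
      IntegrableOn g (M.face F) (Measure.euclideanHausdorffMeasure (d - 1)) := fun F g hg =>
    H.integrableOn_face F (isCompact_face F) le_rfl hg
  refine BilinOn.add (BilinOn.add (BilinOn.sum fun K _ => bilinOn_flux_grad (br := LinearMap.id)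
    (fun q hq K => hm K q hq) Kp K) (BilinOn.sum fun F hF => ?_)) (BilinOn.sum fun F _ => ?_)
  · refine BilinOn.add (BilinOn.neg (BilinOn.add ?_ ?_)) (BilinOn.const_mul ?_ _)
    · exact bilinOn_surfInt_of_continuousOn (isCompact_face F.1)
        (fun x hx => linOn_avgFluxNormal Kp hF hx) (fun x _ => linOn_jump F _ x)
        (fun q hq => hmi F.1 (continuousOn_avgFluxNormal Kp hF hq))
        fun q hq => continuousOn_jump hF hq
    · exact bilinOn_surfInt_of_continuousOn (isCompact_face F.1)
        (fun x _ => linOn_jump F _ x) (fun x hx => linOn_avgFluxNormal Kp hF hx)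
        (fun q hq => hmi F.1 (continuousOn_jump hF hq))
        fun q hq => continuousOn_avgFluxNormal Kp hF hq
    · exact bilinOn_surfInt_of_continuousOn (isCompact_face F.1)
        (fun x _ => linOn_jump F _ x) (fun x _ => linOn_jump F _ x)
        (fun q hq => hmi F.1 (continuousOn_jump hF hq)) fun q hq => continuousOn_jump hF hq
  · have hl : ∀ x ∈ M.face F, LinOn (M.QhDisc r) fun q => M.fluxNormal Kp F.1 F (q F.1) x :=
      fun x hx => linOn_fluxNormal (res := M.restrLin F.1) Kp (hm F.1) F (face_subset F hx)
    have hv : ∀ x ∈ M.face F, LinOn (M.QhDisc r) fun q => q F.1 x :=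
      fun x _ => linOn_res (M.restrLin F.1) x
    have hlc : ∀ q ∈ M.QhDisc r, ContinuousOn (fun x => M.fluxNormal Kp F.1 F (q F.1) x)
        (M.face F) := fun q hq =>
      (hm F.1 q hq).continuousOn_fluxNormal Kp F (face_subset F) (face_subset F)
    have hvc : ∀ q ∈ M.QhDisc r, ContinuousOn (fun x => q F.1 x) (M.face F) :=
      fun q hq => (hm F.1 q hq).continuousOn.mono (face_subset F)
    refine BilinOn.add (BilinOn.neg (BilinOn.add ?_ ?_)) (BilinOn.const_mul ?_ _)
    · exact bilinOn_surfInt_of_continuousOn (isCompact_face F) hl hv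
        (fun q hq => hmi F (hlc q hq)) hvc
    · exact bilinOn_surfInt_of_continuousOn (isCompact_face F) hv hl
        (fun q hq => hmi F (hvc q hq)) hlc
    · exact bilinOn_surfInt_of_continuousOn (isCompact_face F) hv hv
        (fun q hq => hmi F (hvc q hq)) hvc

/-! ### Linearity of the right-hand sides -/

lemma QuasiUniform.linOn_rhsF (H : M.QuasiUniform κ h) (hΓ : IsClosed Γ)
    (Ct : Fin d → Fin d → Fin d → Fin d → ℝ) (ΓN : Set (E d)) (γ : ℝ)
    (f : (E d → E d) →ₗ[ℝ] ℝ) (tN : (ΓN → E d) →ₗ[ℝ] ℝ) {uD : E d → E d}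
    (huD : MemLp uD 2 ((Measure.euclideanHausdorffMeasure (d - 1)).restrict Γ)) :
    LinOn (M.Vh r) (M.rhsF Ct Γ ΓN γ f tN uD) :=
  ((LinOn.of_linearMap f).sub (LinOn.of_linearMap
    (tN ∘ₗ LinearMap.funLeft ℝ (E d) (Subtype.val : ΓN → E d)))).add
    ((bilinOn_aNitsche hΓ Ct γ).right uD (H.mem_intVec_of_memLp huD))

lemma QuasiUniform.linOn_rhsGCont (H : M.QuasiUniform κ h) {ΓuD ΓpD : Set (E d)}
    (hΓu : IsClosed ΓuD) (hΓp : IsClosed ΓpD) (α : ℝ) (Kp : Matrix (Fin d) (Fin d) ℝ)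
    (ΓpN : Set (E d)) (γ : ℝ) (g : (E d → ℝ) →ₗ[ℝ] ℝ) (pN : (ΓpN → ℝ) →ₗ[ℝ] ℝ)
    {vD : E d → E d} (hvD : MemLp vD 2 ((Measure.euclideanHausdorffMeasure (d - 1)).restrict ΓuD))
    {pD : E d → ℝ} (hpD : MemLp pD 2 ((Measure.euclideanHausdorffMeasure (d - 1)).restrict ΓpD)) :
    LinOn (M.QhCont r) (M.rhsGCont α Kp ΓuD ΓpD ΓpN γ g pN vD pD) := by
  refine (((LinOn.of_linearMap g).sub (LinOn.const_mul (LinOn.sum fun F _ => ?_) α)).sub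
    (LinOn.of_linearMap (pN ∘ₗ LinearMap.funLeft ℝ ℝ (Subtype.val : ΓpN → E d)))).add
    ((bilinOn_bNitsche hΓp Kp γ).right pD (H.mem_intScal_of_memLp hpD))
  exact (bilinOn_surfInt_normal hΓu (br := M.toBrokenLin)
    (fun q hq K => isMapped_toBrokenLin hq K) F).right vD (H.mem_intVec_of_memLp hvD)

lemma subset_of_mem_bdFacesOn {F : M.LocalFace} (hF : F ∈ M.bdFacesOn Γ) : M.face F ⊆ Γ := by
  simp only [bdFacesOn, Finset.mem_filter] at hF
  exact hF.2

lemma QuasiUniform.linOn_rhsGDisc (H : M.QuasiUniform κ h) {ΓuD ΓpD ΓpN : Set (E d)}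
    (α : ℝ) (Kp : Matrix (Fin d) (Fin d) ℝ)
    (γ : ℝ) (g : M.Broken →ₗ[ℝ] ℝ) {pN : E d → ℝ}
    (hpN : MemLp pN 2 ((Measure.euclideanHausdorffMeasure (d - 1)).restrict ΓpN))
    {vD : E d → E d} (hvD : MemLp vD 2 ((Measure.euclideanHausdorffMeasure (d - 1)).restrict ΓuD))
    {pD : E d → ℝ} (hpD : MemLp pD 2 ((Measure.euclideanHausdorffMeasure (d - 1)).restrict ΓpD)) :
    LinOn (M.QhDisc r) (M.rhsGDisc α Kp ΓuD ΓpD ΓpN γ g pN vD pD) := by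
  have hm : ∀ K, ∀ q ∈ M.QhDisc r, M.IsMapped K r (q K) :=
    fun K q hq => isMapped_of_mem_QhDisc hq K
  have key : ∀ (F : M.LocalFace) (u : E d → ℝ),
      IntegrableOn u (M.face F) (Measure.euclideanHausdorffMeasure (d - 1)) →
      LinOn (M.QhDisc r) fun ψ => surfInt (M.face F) fun x => u x * ψ F.1 x := fun F u hu =>
    LinOn.setIntegral (isCompact_face F).measurableSet
      (fun x _ => (linOn_res (M.restrLin F.1) x).const_mul _) fun q hq =>
      hu.mul_continuousOn ((hm F.1 q hq).continuousOn.mono (face_subset F)) (isCompact_face F)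
  refine ((((LinOn.of_linearMap g).sub (LinOn.sum fun F hF => LinOn.const_mul ?_ α)).sub
    (LinOn.sum fun F hF => ?_)).add (LinOn.sum fun F hF => LinOn.const_mul ?_ _)).sub
    (LinOn.sum fun F hF => ?_)
  · refine key F _ (integrable_finsetSum _ fun i _ => ?_)
    refine IntegrableOn.mul_continuousOn ?_ ((continuousOn_normal F i).mono (face_subset F))
      (isCompact_face F)
    exact H.integrableOn_of_memLp F le_rfl (subset_of_mem_bdFacesOn hF)
      (hvD.continuousLinearMap_comp (EuclideanSpace.proj i : E d →L[ℝ] ℝ))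
  · refine LinOn.setIntegral (isCompact_face F).measurableSet (fun x hx =>
      (linOn_fluxNormal (res := M.restrLin F.1) Kp (hm F.1) F (face_subset F hx)).const_mul _)
      fun q hq => ?_
    exact (H.integrableOn_of_memLp F le_rfl (subset_of_mem_bdFacesOn hF) hpD).mul_continuousOn
      ((hm F.1 q hq).continuousOn_fluxNormal Kp F (face_subset F) (face_subset F))
      (isCompact_face F)
  · exact key F _ (H.integrableOn_of_memLp F le_rfl (subset_of_mem_bdFacesOn hF) hpD)
  · exact key F _ (H.integrableOn_of_memLp F le_rfl (subset_of_mem_bdFacesOn hF) hpN)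

end Forms

end Mesh

end Biot

end

noncomputable section

namespace Biot

open MeasureTheory

/-! ### Algebraic inequalities -/

lemma sq_sum_mul_le_of_sum_sq_le_one {ι : Type*} [Fintype ι] {σ n : ι → ℝ}
    (hn : ∑ j, n j ^ 2 ≤ 1) : (∑ j, σ j * n j) ^ 2 ≤ ∑ j, σ j ^ 2 :=
  (Finset.sum_mul_sq_le_sq_mul_sq _ σ n).trans
    (mul_le_of_le_one_right (Finset.sum_nonneg fun _ _ => sq_nonneg _) hn)

/-- The squared length of `K ξ` is at most `tr K` times `ξᵀ K ξ`. -/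
lemma sum_sq_mulVec_le {ι : Type*} [Fintype ι] [DecidableEq ι] {A : Matrix ι ι ℝ}
    (hA : A.PosDef) (ξ : ι → ℝ) :
    ∑ i, (∑ j, A i j * ξ j) ^ 2 ≤ A.trace * ∑ i, (∑ j, A i j * ξ j) * ξ i := by
  have hs : ∀ i j, A i j = A j i := fun i j => by simpa using hA.isHermitian.apply j i
  have hquad : ∀ η : ι → ℝ, 0 ≤ ∑ i, (∑ j, A i j * η j) * η i := fun η => by
    have := hA.posSemidef.dotProduct_mulVec_nonneg η
    simpa [dotProduct, Matrix.mulVec, mul_comm] using this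
  rw [Matrix.trace, Finset.sum_mul]
  refine Finset.sum_le_sum fun i _ => ?_
  have ha : 0 < A i i := hA.diag_pos
  set b := ∑ j, A i j * ξ j with hb
  -- The quadratic form at `A i i • ξ - b • e_i` gives `b² ≤ A i i * ξᵀAξ`, the Cauchy-Schwarz
  -- inequality in the product of `A` for `ξ` and `e_i`. Summation over `i` produces the trace.
  have h := hquad fun j => A i i * ξ j - if j = i then b else 0
  have h1 : ∀ l, ∑ j, A l j * (A i i * ξ j - if j = i then b else 0)
      = A i i * (∑ j, A l j * ξ j) - A l i * b := fun l => by
    simp only [mul_sub, Finset.sum_sub_distrib, Finset.mul_sum, mul_ite, mul_zero,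
      Finset.sum_ite_eq', Finset.mem_univ, if_true]
    congr 1
    exact Finset.sum_congr rfl fun j _ => by ring
  have h2 : ∑ l, A l i * ξ l = b := by
    rw [hb]
    exact Finset.sum_congr rfl fun j _ => by rw [hs]
  have h3 : ∑ l, (A i i * (∑ j, A l j * ξ j) - A l i * b) * (A i i * ξ l - if l = i then b else 0)
      = A i i * (A i i * (∑ l, (∑ j, A l j * ξ j) * ξ l) - b ^ 2) := by
    have h4 : ∀ l, (A i i * (∑ j, A l j * ξ j) - A l i * b) * (A i i * ξ l - if l = i then b else 0)
        = A i i * A i i * ((∑ j, A l j * ξ j) * ξ l) - A i i * b * (A l i * ξ l)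
          - if l = i then (A i i * (∑ j, A l j * ξ j) - A l i * b) * b else 0 := fun l => by
      split_ifs <;> ring
    simp only [h4, Finset.sum_sub_distrib, ← Finset.mul_sum, h2, Finset.sum_ite_eq',
      Finset.mem_univ, if_true, ← hb]
    ring
  simp only [h1, h3] at h
  have := nonneg_of_mul_nonneg_right h ha
  rw [Matrix.diag]
  linarith

/-- The absorption step: `s` is a sum over faces of energies that occur at most `N` times in the
total `S`, and a penalty `γ ≥ N a` keeps the weighted face sum below the total. -/
lemma div_mul_le_of_mul_le {a γ N s S : ℝ} (ha : 0 ≤ a) (hγ : 0 < γ) (h : N * a ≤ γ) (hS : 0 ≤ S)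
    (hs : s ≤ N * S) : a / γ * s ≤ S :=
  calc a / γ * s ≤ a / γ * (N * S) := mul_le_mul_of_nonneg_left hs (div_nonneg ha hγ.le)
    _ = N * a / γ * S := by ring
    _ ≤ S := mul_le_of_le_one_left hS ((div_le_one hγ).2 h)

namespace Mesh

variable {d : ℕ} {Ω : Set (E d)} {M : Mesh d Ω} {κ h c : ℝ} {K : Fin M.n} {m r : ℕ} {Γ : Set (E d)}

lemma sum_stress_sq_le (Ct : Fin d → Fin d → Fin d → Fin d → ℝ) (K : Fin M.n) (w : E d → E d)
    (x : E d) : ∑ i, ∑ j, M.stress Ct K w x i j ^ 2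
      ≤ (∑ i, ∑ j, ∑ k, ∑ l, Ct i j k l ^ 2) * ∑ k, ∑ l, M.strain K w x k l ^ 2 := by
  simp only [Finset.sum_mul (s := Finset.univ)]
  refine Finset.sum_le_sum fun i _ => Finset.sum_le_sum fun j _ => ?_
  have := Finset.sum_mul_sq_le_sq_mul_sq Finset.univ (fun p : Fin d × Fin d => Ct i j p.1 p.2)
    fun p => M.strain K w x p.1 p.2
  simpa only [stress, Fintype.sum_prod_type, Finset.sum_mul] using this

/-! ### Summation over the faces -/

/-- Each element has `2d` local faces, so an injective family of local faces meets it at most `2d`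
times. -/
lemma sum_comp_fst_le {ι : Type*} {s : Finset ι} {f : ι → M.LocalFace} (hf : Set.InjOn f s)
    {X : Fin M.n → ℝ} (hX : ∀ K, 0 ≤ X K) : ∑ i ∈ s, X (f i).1 ≤ 2 * d * ∑ K, X K := by
  classical
  calc ∑ i ∈ s, X (f i).1 = ∑ F ∈ s.image f, X F.1 :=
        (Finset.sum_image (f := fun F : M.LocalFace => X F.1) hf).symm
    _ ≤ ∑ F : M.LocalFace, X F.1 :=
        Finset.sum_le_sum_of_subset_of_nonneg (Finset.subset_univ _) fun _ _ _ => hX _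
    _ = 2 * d * ∑ K, X K := by
        rw [Fintype.sum_prod_type, Finset.mul_sum]
        refine Finset.sum_congr rfl fun K _ => ?_
        simp [mul_comm]

lemma mem_intFaces {F : M.LocalFace × M.LocalFace} : F ∈ M.intFaces ↔
    F.1.1 < F.2.1 ∧ M.face F.1 = M.face F.2 ∧ ¬ M.face F.1 ⊆ frontier Ω := by
  simp [intFaces]

lemma eq_of_face_eq {F G G' : M.LocalFace} (hF : ¬ M.face F ⊆ frontier Ω) (hG : G ≠ F)
    (hG' : G' ≠ F) (h : M.face G = M.face F) (h' : M.face G' = M.face F) : G = G' :=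
  ((M.conform F).resolve_left hF).unique ⟨hG, h⟩ ⟨hG', h'⟩

/-- Conformity leaves one partner for a face not in the boundary, and the strict order of the
indices excludes the face itself. An interior face is thus determined by either of its sides, which
bounds the multiplicity in the face sums. -/
lemma injOn_fst_intFaces : Set.InjOn (Prod.fst : M.LocalFace × M.LocalFace → _) M.intFaces := by
  rintro ⟨F, F'⟩ hF ⟨G, G'⟩ hG (rfl : F = G)
  obtain ⟨h1, h2, h3⟩ := mem_intFaces.1 hF
  obtain ⟨h1', h2', -⟩ := mem_intFaces.1 hG
  exact Prod.ext rfl (eq_of_face_eq h3 (fun h => h1.ne (congrArg Prod.fst h.symm)) (fun h => h1'.ne (congrArg Prod.fst h.symm))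
    h2.symm h2'.symm)

lemma injOn_snd_intFaces : Set.InjOn (Prod.snd : M.LocalFace × M.LocalFace → _) M.intFaces := by
  rintro ⟨F, F'⟩ hF ⟨G, G'⟩ hG (rfl : F' = G')
  obtain ⟨h1, h2, h3⟩ := mem_intFaces.1 hF
  obtain ⟨h1', h2', -⟩ := mem_intFaces.1 hG
  exact Prod.ext (eq_of_face_eq (h2 ▸ h3) (fun h => h1.ne (congrArg Prod.fst h))
    (fun h => h1'.ne (congrArg Prod.fst h)) h2 h2') rfl

/-! ### Estimates on the faces -/

/-- A scaled trace inequality with constant `c` for quotients of degree `m`. -/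
def TraceBound (M : Mesh d Ω) (κ h : ℝ) (m : ℕ) (c : ℝ) : Prop :=
  ∀ F f, M.IsQuotient F.1 m f → ∀ S ⊆ M.face F, ∀ η, 0 ≤ η → η ≤ (κ * h) ^ d * refVol d →
    η * surfInt S (fun x => f x ^ 2) ≤ c * ∫ z in M.elem F.1, f z ^ 2

/-- Young's inequality with weight `η/γ` for `s` and `γ/η` for `w`. The factor `η` is the one that
the scaled trace inequality needs to turn the squared fluxes on the face into an integral over the
element. -/
lemma QuasiUniform.two_mul_surfInt_le (H : M.QuasiUniform κ h) (hc : M.TraceBound κ h m c)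
    (F : M.LocalFace) {S : Set (E d)} (hS : IsCompact S) (hSF : S ⊆ M.face F) {s w : E d → ℝ}
    (hs : ContinuousOn s S) (hw : ContinuousOn w S) {ι : Type*} [Fintype ι] {σ : ι → E d → ℝ}
    (hσ : ∀ j, M.IsQuotient F.1 m (σ j)) (hsσ : ∀ x ∈ S, s x ^ 2 ≤ ∑ j, σ j x ^ 2) {η γ : ℝ}
    (hη : 0 < η) (hη' : η ≤ (κ * h) ^ d * refVol d) (hγ : 0 < γ) :
    2 * surfInt S (fun x => s x * w x)
      ≤ c / γ * (∫ x in M.elem F.1, ∑ j, σ j x ^ 2) + γ / η * surfInt S fun x => w x * w x := by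
  have hint : ∀ {g : E d → ℝ}, ContinuousOn g S →
      IntegrableOn g S (Measure.euclideanHausdorffMeasure (d - 1)) :=
    fun hg => H.integrableOn_face F hS hSF hg
  have hσS : ∀ j, ContinuousOn (fun x => σ j x ^ 2) S := fun j =>
    ((hσ j).continuousOn.mono (hSF.trans (face_subset F))).pow 2
  have hi1 : IntegrableOn (fun x => η / γ * ∑ j, σ j x ^ 2) S
      (Measure.euclideanHausdorffMeasure (d - 1)) :=
    hint (continuousOn_const.mul (continuousOn_finsetSum _ fun j _ => hσS j))
  have hi2 : IntegrableOn (fun x => γ / η * (w x * w x)) S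
      (Measure.euclideanHausdorffMeasure (d - 1)) := hint (continuousOn_const.mul (hw.mul hw))
  have hi3 : ∀ j ∈ Finset.univ, IntegrableOn (fun x => σ j x ^ 2) (M.elem F.1) :=
    fun j _ => integrableOn_elem ((hσ j).continuousOn.pow 2)
  have h1 : 2 * surfInt S (fun x => s x * w x)
      ≤ surfInt S fun x => η / γ * (∑ j, σ j x ^ 2) + γ / η * (w x * w x) := by
    rw [surfInt, ← integral_const_mul]
    refine setIntegral_mono_on (hint (continuousOn_const.mul (hs.mul hw))) (hi1.add hi2)
      hS.measurableSet fun x hx => ?_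
    have h2 : 2 * (s x * w x) ≤ η / γ * s x ^ 2 + γ / η * (w x * w x) := by
      have h3 : η / γ * s x ^ 2 + γ / η * (w x * w x) - 2 * (s x * w x)
          = (η * s x - γ * w x) ^ 2 / (η * γ) := by
        field_simp
        ring
      have : 0 ≤ (η * s x - γ * w x) ^ 2 / (η * γ) := by positivity
      linarith
    exact h2.trans (by gcongr; exact hsσ x hx)
  refine h1.trans ?_
  rw [surfInt, integral_add hi1 hi2, integral_const_mul,
    integral_const_mul, integral_finsetSum _ fun j _ => hint (hσS j),
    integral_finsetSum _ hi3]
  refine add_le_add ?_ le_rfl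
  rw [div_mul_eq_mul_div, div_mul_eq_mul_div, Finset.mul_sum, Finset.mul_sum]
  exact div_le_div_of_nonneg_right (Finset.sum_le_sum fun j _ =>
    hc F (σ j) (hσ j) S hSF η hη.le hη') hγ.le

lemma QuasiUniform.hBd_pos (H : M.QuasiUniform κ h) (F : M.LocalFace) : 0 < M.hBd F :=
  H.volume_elem_pos F.1

lemma QuasiUniform.hBd_le (H : M.QuasiUniform κ h) (F : M.LocalFace) :
    M.hBd F ≤ (κ * h) ^ d * refVol d := H.volume_elem_le F.1

lemma QuasiUniform.hInt_pos (H : M.QuasiUniform κ h) (F : M.LocalFace × M.LocalFace) :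
    0 < M.hInt F := half_pos (add_pos (H.hBd_pos F.1) (H.hBd_pos F.2))

lemma QuasiUniform.hInt_le (H : M.QuasiUniform κ h) (F : M.LocalFace × M.LocalFace) :
    M.hInt F ≤ (κ * h) ^ d * refVol d := by
  have h1 := H.hBd_le F.1
  have h2 := H.hBd_le F.2
  unfold hInt
  linarith

/-! ### The elasticity form -/

lemma formA_comm {Ct : Fin d → Fin d → Fin d → Fin d → ℝ}
    (hCsymm : ∀ i j k l, Ct i j k l = Ct k l i j) (γ : ℝ) (w χ : E d → E d) :
    M.formA Ct Γ γ w χ = M.formA Ct Γ γ χ w := by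
  have h1 : ∀ K x, ∑ i, ∑ j, M.stress Ct K w x i j * M.strain K χ x i j
      = ∑ i, ∑ j, M.stress Ct K χ x i j * M.strain K w x i j := fun K x => by
    have key : ∀ w χ : E d → E d, ∑ i, ∑ j, M.stress Ct K w x i j * M.strain K χ x i j
        = ∑ p : Fin d × Fin d, ∑ q : Fin d × Fin d,
          Ct p.1 p.2 q.1 q.2 * M.strain K w x q.1 q.2 * M.strain K χ x p.1 p.2 := fun w χ => by
      simp only [stress, Finset.sum_mul, Fintype.sum_prod_type]
    rw [key w χ, key χ w, Finset.sum_comm]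
    refine Finset.sum_congr rfl fun p _ => Finset.sum_congr rfl fun q _ => ?_
    rw [hCsymm]
    ring
  have h2 : ∀ x, ∑ i, w x i * χ x i = ∑ i, χ x i * w x i := fun x =>
    Finset.sum_congr rfl fun i _ => mul_comm _ _
  simp only [formA, aNitsche, Finset.sum_add_distrib, Finset.sum_neg_distrib, h2]
  rw [Finset.sum_congr rfl fun K _ => integral_congr_ae (Filter.Eventually.of_forall (h1 K))]
  ring

/-- On the diagonal both consistency terms agree and form `2⟨Cε(w)n, w⟩`. As only nonnegativity is
wanted, Young's inequality may use up the whole penalty, and for large `γ` the remainder is at most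
the whole elastic energy. -/
lemma QuasiUniform.formA_nonneg (H : M.QuasiUniform κ h) (hΓ : IsClosed Γ)
    (hc : M.TraceBound κ h (d * r + d * d) c) (hc0 : 0 ≤ c)
    {Ct : Fin d → Fin d → Fin d → Fin d → ℝ} {k₀ : ℝ} (hk₀ : 0 < k₀)
    (hCpos : ∀ ξ : Fin d → Fin d → ℝ, (∀ i j, ξ i j = ξ j i) →
      k₀ * ∑ i, ∑ j, (ξ i j) ^ 2 ≤ ∑ i, ∑ j, ∑ k, ∑ l, ξ i j * Ct i j k l * ξ k l) {γ : ℝ}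
    (hγ : 0 < γ) (hγ' : 2 * d * c * (∑ i, ∑ j, ∑ k, ∑ l, Ct i j k l ^ 2) / k₀ ≤ γ)
    {w : E d → E d} (hw : w ∈ M.Vh r) : 0 ≤ M.formA Ct Γ γ w w := by
  set cσ := ∑ i, ∑ j, ∑ k, ∑ l, Ct i j k l ^ 2 with hcσ
  have hcσ0 : 0 ≤ cσ := Finset.sum_nonneg fun _ _ => Finset.sum_nonneg fun _ _ =>
    Finset.sum_nonneg fun _ _ => Finset.sum_nonneg fun _ _ => sq_nonneg _
  set e : Fin M.n → ℝ := fun K =>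
    ∫ x in M.elem K, ∑ i, ∑ j, M.stress Ct K w x i j * M.strain K w x i j with he
  have hpt : ∀ K x, k₀ * ∑ i, ∑ j, M.strain K w x i j ^ 2
      ≤ ∑ i, ∑ j, M.stress Ct K w x i j * M.strain K w x i j := fun K x => by
    refine (hCpos _ fun i j => ?_).trans_eq ?_
    · rw [strain, strain, add_comm]
    · refine Finset.sum_congr rfl fun i _ => Finset.sum_congr rfl fun j _ => ?_
      simp only [stress, Finset.sum_mul]
      exact Finset.sum_congr rfl fun k _ => Finset.sum_congr rfl fun l _ => by ring
  have he0 : ∀ K, 0 ≤ e K := fun K => integral_nonneg fun x =>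
    le_trans (_root_.mul_nonneg hk₀.le (Finset.sum_nonneg fun _ _ => Finset.sum_nonneg fun _ _ =>
      sq_nonneg _)) (hpt K x)
  have hσint : ∀ K i, IntegrableOn (fun x => ∑ j, M.stress Ct K w x i j ^ 2) (M.elem K) :=
    fun K i => integrableOn_elem (continuousOn_finsetSum _ fun j _ =>
      (isQuotient_stress Ct hw K i j).continuousOn.pow 2)
  -- Pointwise `|Cε|² ≤ cσ |ε|²` by Cauchy-Schwarz, and `k₀ |ε|² ≤ Cε : ε` by definiteness on
  -- symmetric matrices.
  have hσ : ∀ K, ∑ i, ∫ x in M.elem K, ∑ j, M.stress Ct K w x i j ^ 2 ≤ cσ / k₀ * e K :=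
    fun K => by
    rw [he, ← integral_const_mul, ← integral_finsetSum _ fun i _ => hσint K i]
    refine integral_mono (integrable_finsetSum _ fun i _ => hσint K i)
      ((integrableOn_stress_mul_strain Ct hw hw K).const_mul _) fun x => ?_
    refine (sum_stress_sq_le Ct K w x).trans ?_
    rw [div_mul_eq_mul_div, le_div_iff₀ hk₀, mul_assoc]
    refine mul_le_mul_of_nonneg_left ?_ hcσ0
    rw [mul_comm]
    exact hpt K x
  have hwc : ∀ F : M.LocalFace, ∀ i, ContinuousOn (fun x => w x i) (M.face F ∩ Γ) := fun F i =>
    (isMapped_of_mem_Vh hw F.1 i).continuousOn.mono (face_inter_subset F)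
  have htc : ∀ F : M.LocalFace, ∀ i, ContinuousOn
      (fun x => ∑ j, M.stress Ct F.1 w x i j * M.normal F x j) (M.face F ∩ Γ) := fun F i =>
    (continuousOn_traction Ct hw F i).mono (face_inter_subset F)
  have hF : ∀ F : M.LocalFace, 2 * surfInt (M.face F ∩ Γ) (fun x => M.tractionDot Ct F w w x)
      ≤ c / γ * (cσ / k₀ * e F.1)
        + γ / M.hBd F * surfInt (M.face F ∩ Γ) fun x => ∑ i, w x i * w x i := fun F => by
    have hcomp := isCompact_face_inter hΓ F
    have h1 := fun i => H.two_mul_surfInt_le hc F hcomp Set.inter_subset_left (htc F i) (hwc F i)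
      (fun j => isQuotient_stress Ct hw F.1 i j)
      (fun x _ => sq_sum_mul_le_of_sum_sq_le_one (sum_normal_sq_le F x)) (H.hBd_pos F) (H.hBd_le F)
      hγ
    have h2 := Finset.sum_le_sum fun i (_ : i ∈ Finset.univ) => h1 i
    rw [← Finset.mul_sum, Finset.sum_add_distrib, ← Finset.mul_sum, ← Finset.mul_sum] at h2
    have hint : ∀ {g : E d → ℝ}, ContinuousOn g (M.face F ∩ Γ) →
        Integrable g ((Measure.euclideanHausdorffMeasure (d - 1)).restrict (M.face F ∩ Γ)) :=
      fun hg => H.integrableOn_face F hcomp Set.inter_subset_left hg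
    have hi1 : ∀ i ∈ Finset.univ, IntegrableOn (fun x =>
        (∑ j, M.stress Ct F.1 w x i j * M.normal F x j) * w x i) (M.face F ∩ Γ)
        (Measure.euclideanHausdorffMeasure (d - 1)) := fun i _ => hint ((htc F i).mul (hwc F i))
    have hi2 : ∀ i ∈ Finset.univ, IntegrableOn (fun x => w x i * w x i) (M.face F ∩ Γ)
        (Measure.euclideanHausdorffMeasure (d - 1)) := fun i _ => hint ((hwc F i).mul (hwc F i))
    simp only [surfInt, tractionDot] at h2 ⊢
    rw [integral_finsetSum _ hi1, integral_finsetSum _ hi2]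
    refine h2.trans (add_le_add ?_ le_rfl)
    exact mul_le_mul_of_nonneg_left (hσ F.1) (by positivity)
  have hsum := Finset.sum_le_sum fun F (_ : F ∈ M.bdFaces) => hF F
  rw [Finset.sum_add_distrib, ← Finset.mul_sum, ← Finset.mul_sum, ← Finset.mul_sum] at hsum
  have hbd : ∑ F ∈ M.bdFaces, e F.1 ≤ 2 * d * ∑ K, e K :=
    sum_comp_fst_le (f := id) (Set.injOn_id _) he0
  have h3 := div_mul_le_of_mul_le (_root_.mul_nonneg hc0 (div_nonneg hcσ0 hk₀.le)) hγ
    (le_trans (le_of_eq (by ring)) hγ') (Finset.sum_nonneg fun K _ => he0 K) hbd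
  have h4 : c / γ * (cσ / k₀ * ∑ F ∈ M.bdFaces, e F.1)
      = c * (cσ / k₀) / γ * ∑ F ∈ M.bdFaces, e F.1 := by ring
  simp only [formA, aNitsche, Finset.sum_add_distrib, Finset.sum_neg_distrib]
  linarith

/-! ### The flow forms -/

/-- The energy of a pressure on an element bounds the squared norm of the flux. -/
lemma IsMapped.integral_flux_sq_le {q : E d → ℝ} (hq : M.IsMapped K m q)
    {Kp : Matrix (Fin d) (Fin d) ℝ} (hK : Kp.PosDef) :
    ∫ x in M.elem K, ∑ i, M.flux Kp K q x i ^ 2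
      ≤ Kp.trace * ∫ x in M.elem K, ∑ i, M.flux Kp K q x i * M.gradScal K q i x := by
  rw [← integral_const_mul]
  exact integral_mono (integrableOn_elem (continuousOn_finsetSum _ fun i _ =>
      (hq.flux Kp i).continuousOn.pow 2)) ((hq.integrableOn_flux_mul_grad hq Kp).const_mul _)
    fun x => sum_sq_mulVec_le hK fun j => M.gradScal K q j x

lemma integral_flux_mul_grad_nonneg {Kp : Matrix (Fin d) (Fin d) ℝ} (hK : Kp.PosDef)
    (K : Fin M.n) (q : E d → ℝ) :
    0 ≤ ∫ x in M.elem K, ∑ i, M.flux Kp K q x i * M.gradScal K q i x :=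
  integral_nonneg fun x => by
    have := hK.posSemidef.dotProduct_mulVec_nonneg fun j => M.gradScal K q j x
    simpa [dotProduct, Matrix.mulVec, flux, mul_comm] using this

lemma QuasiUniform.two_mul_surfInt_fluxNormal_le (H : M.QuasiUniform κ h)
    (hc : M.TraceBound κ h (m + d * d) c) (hc0 : 0 ≤ c) {Kp : Matrix (Fin d) (Fin d) ℝ}
    (hK : Kp.PosDef) (F G : M.LocalFace) {S : Set (E d)} (hS : IsCompact S)
    (hSF : S ⊆ M.face F) (hSG : S ⊆ M.face G) {q : E d → ℝ} (hq : M.IsMapped F.1 m q)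
    {w : E d → ℝ} (hw : ContinuousOn w S) {η γ : ℝ} (hη : 0 < η)
    (hη' : η ≤ (κ * h) ^ d * refVol d) (hγ : 0 < γ) :
    2 * surfInt S (fun x => M.fluxNormal Kp F.1 G q x * w x)
      ≤ c * Kp.trace / γ * (∫ x in M.elem F.1, ∑ i, M.flux Kp F.1 q x i * M.gradScal F.1 q i x)
        + γ / η * surfInt S fun x => w x * w x := by
  refine (H.two_mul_surfInt_le hc F hS hSF (hq.continuousOn_fluxNormal Kp G
    (hSF.trans (face_subset F)) (hSG.trans (face_subset G))) hw (fun i => hq.flux Kp i)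
    (fun x _ => sq_sum_mul_le_of_sum_sq_le_one (sum_normal_sq_le G x)) hη hη' hγ).trans
    (add_le_add ?_ le_rfl)
  calc c / γ * (∫ x in M.elem F.1, ∑ i, M.flux Kp F.1 q x i ^ 2)
      ≤ c / γ * (Kp.trace * ∫ x in M.elem F.1, ∑ i, M.flux Kp F.1 q x i * M.gradScal F.1 q i x) :=
        mul_le_mul_of_nonneg_left (hq.integral_flux_sq_le hK) (by positivity)
    _ = _ := by ring

lemma QuasiUniform.formBCont_nonneg (H : M.QuasiUniform κ h) (hΓ : IsClosed Γ)
    (hc : M.TraceBound κ h (d * r + d * d) c) (hc0 : 0 ≤ c) {Kp : Matrix (Fin d) (Fin d) ℝ}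
    (hK : Kp.PosDef) {γ : ℝ} (hγ : 0 < γ) (hγ' : 2 * d * c * Kp.trace ≤ γ)
    {q : E d → ℝ} (hq : q ∈ M.QhCont r) : 0 ≤ M.formBCont Kp Γ γ q q := by
  set e : Fin M.n → ℝ := fun K =>
    ∫ x in M.elem K, ∑ i, M.flux Kp K q x i * M.gradScal K q i x with he
  have he0 : ∀ K, 0 ≤ e K := fun K => integral_flux_mul_grad_nonneg hK K q
  have hF : ∀ F : M.LocalFace, 2 * surfInt (M.face F ∩ Γ) (fun x => M.fluxNormal Kp F.1 F q x * q x)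
      ≤ c * Kp.trace / γ * e F.1 + γ / M.hBd F * surfInt (M.face F ∩ Γ) fun x => q x * q x :=
    fun F => H.two_mul_surfInt_fluxNormal_le hc hc0 hK F F (isCompact_face_inter hΓ F)
      Set.inter_subset_left Set.inter_subset_left (isMapped_of_mem_QhCont hq F.1)
      ((isMapped_of_mem_QhCont hq F.1).continuousOn.mono (face_inter_subset F)) (H.hBd_pos F)
      (H.hBd_le F) hγ
  have hsum := Finset.sum_le_sum fun F (_ : F ∈ M.bdFaces) => hF F
  rw [Finset.sum_add_distrib, ← Finset.mul_sum, ← Finset.mul_sum] at hsum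
  have hbd : ∑ F ∈ M.bdFaces, e F.1 ≤ 2 * d * ∑ K, e K :=
    sum_comp_fst_le (f := id) (Set.injOn_id _) he0
  have htr : 0 ≤ Kp.trace := hK.posSemidef.trace_nonneg
  have h3 := div_mul_le_of_mul_le (_root_.mul_nonneg hc0 htr) hγ
    (le_trans (le_of_eq (by ring)) hγ') (Finset.sum_nonneg fun K _ => he0 K) hbd
  simp only [formBCont, bNitsche, Finset.sum_add_distrib, Finset.sum_neg_distrib,
    fun F x => mul_comm (q x) (M.fluxNormal Kp F.1 F q x)]
  linarith

/-- The same absorption face by face. On an interior face the average splits into one flux from each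
side; both are tested with the common weight `hInt`, which is admissible in both trace inequalities
because quasi-uniformity bounds all volumes alike. -/
lemma QuasiUniform.formBDisc_nonneg (H : M.QuasiUniform κ h)
    (hc : M.TraceBound κ h (r + d * d) c) (hc0 : 0 ≤ c) {Kp : Matrix (Fin d) (Fin d) ℝ}
    (hK : Kp.PosDef) {γ : ℝ} (hγ : 0 < γ) (hγ' : 4 * d * c * Kp.trace ≤ γ)
    {q : M.Broken} (hq : q ∈ M.QhDisc r) : 0 ≤ M.formBDisc Kp γ q q := by
  set e : Fin M.n → ℝ := fun K =>
    ∫ x in M.elem K, ∑ i, M.flux Kp K (q K) x i * M.gradScal K (q K) i x with he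
  have he0 : ∀ K, 0 ≤ e K := fun K => integral_flux_mul_grad_nonneg hK K (q K)
  have hm : ∀ K, M.IsMapped K r (q K) := isMapped_of_mem_QhDisc hq
  have hb : ∀ F : M.LocalFace,
      2 * surfInt (M.face F) (fun x => M.fluxNormal Kp F.1 F (q F.1) x * q F.1 x)
      ≤ c * Kp.trace / γ * e F.1 + γ / M.hBd F * surfInt (M.face F) fun x => q F.1 x * q F.1 x :=
    fun F => H.two_mul_surfInt_fluxNormal_le hc hc0 hK F F (isCompact_face F) le_rfl le_rfl (hm F.1)
      ((hm F.1).continuousOn.mono (face_subset F)) (H.hBd_pos F) (H.hBd_le F) hγ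
  have hi : ∀ F ∈ M.intFaces,
      2 * surfInt (M.face F.1) (fun x => M.avgFluxNormal Kp F q x * M.jump F q x)
      ≤ c * Kp.trace / γ * ((e F.1.1 + e F.2.1) / 2)
        + γ / M.hInt F * surfInt (M.face F.1) fun x => M.jump F q x * M.jump F q x := by
    intro F hF
    have hj := continuousOn_jump hF hq
    have hle : M.face F.1 ⊆ M.face F.2 := (mem_intFaces.1 hF).2.1.le
    have h1 := H.two_mul_surfInt_fluxNormal_le hc hc0 hK F.1 F.1 (isCompact_face F.1) le_rfl le_rfl
      (hm F.1.1) hj (H.hInt_pos F) (H.hInt_le F) hγ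
    have h2 := H.two_mul_surfInt_fluxNormal_le hc hc0 hK F.2 F.1 (isCompact_face F.1) hle le_rfl
      (hm F.2.1) hj (H.hInt_pos F) (H.hInt_le F) hγ
    have h3 : 2 * surfInt (M.face F.1) (fun x => M.avgFluxNormal Kp F q x * M.jump F q x)
        = surfInt (M.face F.1) (fun x => M.fluxNormal Kp F.1.1 F.1 (q F.1.1) x * M.jump F q x)
          + surfInt (M.face F.1)
            (fun x => M.fluxNormal Kp F.2.1 F.1 (q F.2.1) x * M.jump F q x) := by
      simp only [surfInt]
      rw [← integral_add, ← integral_const_mul]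
      · refine integral_congr_ae (Filter.Eventually.of_forall fun x => ?_)
        simp only [avgFluxNormal]
        ring
      · exact H.integrableOn_face F.1 (isCompact_face F.1) le_rfl
          (((hm F.1.1).continuousOn_fluxNormal Kp F.1 (face_subset F.1) (face_subset F.1)).mul hj)
      · exact H.integrableOn_face F.1 (isCompact_face F.1) le_rfl
          (((hm F.2.1).continuousOn_fluxNormal Kp F.1 (face_subset_of_mem_intFaces hF)
            (face_subset F.1)).mul hj)
    rw [h3]
    linarith
  have hbs := Finset.sum_le_sum fun F (_ : F ∈ M.bdFaces) => hb F
  have his := Finset.sum_le_sum hi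
  rw [Finset.sum_add_distrib, ← Finset.mul_sum, ← Finset.mul_sum] at hbs his
  rw [← Finset.sum_div, Finset.sum_add_distrib] at his
  have h1 : ∑ F ∈ M.bdFaces, e F.1 ≤ 2 * d * ∑ K, e K :=
    sum_comp_fst_le (f := id) (Set.injOn_id _) he0
  have h2 : ∑ F ∈ M.intFaces, e F.1.1 ≤ 2 * d * ∑ K, e K := sum_comp_fst_le injOn_fst_intFaces he0
  have h3 : ∑ F ∈ M.intFaces, e F.2.1 ≤ 2 * d * ∑ K, e K := sum_comp_fst_le injOn_snd_intFaces he0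
  have htr : 0 ≤ Kp.trace := hK.posSemidef.trace_nonneg
  -- The boundary faces count an element at most `2d` times. The two sides of the interior faces do
  -- so with weight one half each, which adds another `2d`.
  have h4 := div_mul_le_of_mul_le (N := 4 * d) (S := ∑ K, e K) (_root_.mul_nonneg hc0 htr) hγ
    (le_trans (le_of_eq (by ring)) hγ') (Finset.sum_nonneg fun K _ => he0 K)
    (s := (∑ F ∈ M.bdFaces, e F.1)
      + (∑ F ∈ M.intFaces, e F.1.1 + ∑ F ∈ M.intFaces, e F.2.1) / 2) (by linarith)
  rw [mul_add] at h4
  simp only [formBDisc, Finset.sum_add_distrib, Finset.sum_neg_distrib,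
    fun F x => mul_comm (M.jump F q x) (M.avgFluxNormal Kp F q x),
    fun (F : M.LocalFace) x => mul_comm (q F.1 x) (M.fluxNormal Kp F.1 F (q F.1) x)]
  linarith

end Mesh

end Biot

end

noncomputable section

namespace Biot

/-! ### Functions with values in polynomials in time -/

section TimePoly

variable {X Y : Type*} [AddCommGroup X] [Module ℝ X] [AddCommGroup Y] [Module ℝ Y]
  {V : Submodule ℝ X} {k : ℕ}

/-- The polynomial in time with the coefficients `W` in the subspace `V`. -/
def timePoly (W : Fin (k + 1) → V) (t : ℝ) : X := (timeEval V k t W : V)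

lemma timePoly_apply (W : Fin (k + 1) → V) (t : ℝ) :
    timePoly W t = ∑ j : Fin (k + 1), t ^ (j : ℕ) • (W j : X) := by
  simp [timePoly, timeEval_apply]

lemma mem_polyTime_iff {w : ℝ → X} :
    w ∈ polyTime k V ↔ ∃ W : Fin (k + 1) → V, w = timePoly W := by
  constructor
  · rintro ⟨W, hW, hw⟩
    exact ⟨fun j => ⟨W j, hW j⟩, funext fun t => by rw [hw, timePoly_apply]⟩
  · rintro ⟨W, rfl⟩
    exact ⟨fun j => W j, fun j => (W j).2, timePoly_apply W⟩

lemma forall_mem_polyTime_iff {P : (ℝ → X) → Prop} :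
    (∀ w ∈ polyTime k V, P w) ↔ ∀ W : Fin (k + 1) → V, P (timePoly W) := by
  simp only [mem_polyTime_iff, forall_exists_index, forall_eq_apply_imp_iff]

lemma LinOn.comp {f : X → ℝ} (hf : LinOn V f) (L : Y →ₗ[ℝ] V) :
    LinOn (⊤ : Submodule ℝ Y) fun y => f (L y) :=
  ⟨fun x _ y _ => by simp [hf.map_add], fun c x _ => by simp [hf.map_smul]⟩

lemma LinOn.radauQuad {f : ℝ → X → ℝ} {a b : ℝ} (hab : a < b)
    (hf : ∀ t ∈ Set.Ioc a b, LinOn V (f t)) :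
    LinOn V fun x => radauQuad k a b fun t => f t x := by
  simp only [radauQuad_eq]
  exact LinOn.sum fun t ht => (hf _ (quadNode_mem hab ht)).const_mul _

lemma LinOn.exists_linearMap {f : X → ℝ} (hf : LinOn ⊤ f) : ∃ F : X →ₗ[ℝ] ℝ, ∀ x, F x = f x :=
  ⟨hf.toLinearMap ∘ₗ Submodule.topEquiv.symm.toLinearMap, fun _ => rfl⟩

lemma hasDerivAt_timePoly_comp {Z : Type*} [NormedAddCommGroup Z] [NormedSpace ℝ Z]
    (f : V →ₗ[ℝ] Z) (W : Fin (k + 1) → V) (t : ℝ) :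
    HasDerivAt (fun s => f (timeEval V k s W)) (f (timeDeriv V k t W)) t := by
  simp only [timeEval_apply, timeDeriv_apply, map_sum, map_smul]
  exact HasDerivAt.fun_sum fun j _ => (hasDerivAt_pow (j : ℕ) t).smul_const _

end TimePoly

lemma dtVec_timePoly {d k : ℕ} {V : Submodule ℝ (E d → E d)} (W : Fin (k + 1) → V) (t : ℝ) :
    dtVec (timePoly W) t = (timeDeriv V k t W : V) := by
  funext x
  exact (hasDerivAt_timePoly_comp (LinearMap.proj x ∘ₗ V.subtype) W t).deriv

section AbstractRows

variable {V Q : Type*} [AddCommGroup V] [Module ℝ V] [AddCommGroup Q] [Module ℝ Q]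
  {k : ℕ} {a b ρ c₀ : ℝ} {m A : V →ₗ[ℝ] V →ₗ[ℝ] ℝ} {mQ B : Q →ₗ[ℝ] Q →ₗ[ℝ] ℝ}
  {C : V →ₗ[ℝ] Q →ₗ[ℝ] ℝ}

/-- The single equations of the abstract local problem. -/
lemma localForm_eq_iff {u v : Fin (k + 1) → V} {p : Fin (k + 1) → Q}
    {F₁ F₂ : (Fin (k + 1) → V) →ₗ[ℝ] ℝ} {F₃ : (Fin (k + 1) → Q) →ₗ[ℝ] ℝ} :
    (∀ Φ, localForm k a b ρ c₀ m A mQ B C (u, v, p) Φ = (F₁.coprod (F₂.coprod F₃)) Φ) ↔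
      (∀ φ, radauQuad k a b (fun t => m (timeDeriv V k t u) (timeEval V k t φ)
          - m (timeEval V k t v) (timeEval V k t φ))
        + m (timeEval V k a u) (timeEval V k a φ) = F₁ φ) ∧
      (∀ χ, radauQuad k a b (fun t => ρ * m (timeDeriv V k t v) (timeEval V k t χ)
          + A (timeEval V k t u) (timeEval V k t χ) + C (timeEval V k t χ) (timeEval Q k t p))
        + ρ * m (timeEval V k a v) (timeEval V k a χ) = F₂ χ) ∧
      (∀ ψ, radauQuad k a b (fun t => c₀ * mQ (timeDeriv Q k t p) (timeEval Q k t ψ)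
          - C (timeEval V k t v) (timeEval Q k t ψ) + B (timeEval Q k t p) (timeEval Q k t ψ))
        + c₀ * mQ (timeEval Q k a p) (timeEval Q k a ψ) = F₃ ψ) := by
  constructor
  · refine fun h => ⟨fun φ => ?_, fun χ => ?_, fun ψ => ?_⟩
    · have := h (φ, 0, 0)
      rw [localForm_apply] at this
      simpa [radauQuad] using this
    · have := h (0, χ, 0)
      rw [localForm_apply] at this
      simpa [radauQuad] using this
    · have := h (0, 0, ψ)
      rw [localForm_apply] at this
      simpa [radauQuad] using this
  · rintro ⟨h1, h2, h3⟩ ⟨φ, χ, ψ⟩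
    rw [localForm_apply, h1, h2, h3, LinearMap.coprod_apply, LinearMap.coprod_apply, add_assoc]

end AbstractRows

namespace Mesh

variable {d : ℕ} {Ω : Set (E d)} {M : Mesh d Ω} {m r k : ℕ}

/-! ### From coefficients in time to solutions of the local problem. -/

section Solution

variable {X : Type*} [AddCommGroup X] [Module ℝ X] {Q : Submodule ℝ X} {br : X →ₗ[ℝ] M.Broken}

lemma dtBroken_timePoly (br : X →ₗ[ℝ] M.Broken) (W : Fin (k + 1) → Q) (t : ℝ) :
    M.dtBroken (fun s => br (timePoly W s)) t = br (timeDeriv Q k t W : Q) := by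
  funext K x
  exact (hasDerivAt_timePoly_comp
    ((LinearMap.proj x ∘ₗ M.restrLin K ∘ₗ br) ∘ₗ Q.subtype) W t).deriv

/-- Unique solvability of the local problem for bilinear forms `A` and `B` that are positive
semidefinite, with `A` symmetric. -/
theorem existsUnique_isSolution [FiniteDimensional ℝ Q] (hΩo : IsOpen Ω)
    (hΩb : Bornology.IsBounded Ω) {ρ c₀ a b : ℝ} (hρ : 0 < ρ) (hc₀ : 0 < c₀) (hab : a < b)
    (hbr : ∀ q ∈ Q, ∀ K, M.IsMapped K m (br q K))
    (hinj : ∀ q ∈ Q, (∀ K, ∀ x ∈ M.closedElem K, br q K x = 0) → q = 0)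
    {A : (E d → E d) → (E d → E d) → ℝ} {C : (E d → E d) → M.Broken → ℝ} {B : X → X → ℝ}
    (hA : BilinOn (M.Vh r) (M.Vh r) A) (hAs : ∀ w χ, A w χ = A χ w)
    (hA0 : ∀ w ∈ M.Vh r, 0 ≤ A w w) (hC : BilinOn (M.Vh r) Q fun χ q => C χ (br q))
    (hB : BilinOn Q Q B) (hB0 : ∀ q ∈ Q, 0 ≤ B q q)
    {Fr : ℝ → (E d → E d) → ℝ} {G : ℝ → X → ℝ}
    (hF : ∀ t ∈ Set.Ioc a b, LinOn (M.Vh r) (Fr t)) (hG : ∀ t ∈ Set.Ioc a b, LinOn Q (G t))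
    {u₀ v₀ : E d → E d} (hu₀ : u₀ ∈ M.Vh r) (hv₀ : v₀ ∈ M.Vh r) {p₀ : X} (hp₀ : p₀ ∈ Q) :
    ∃! U, M.IsSolution br ρ c₀ k a b (M.Vh r) Q A C B Fr G u₀ v₀ p₀ U := by
  have hm := bilinOn_l2Vec (M := M) (r := r) hΩo hΩb
  have hmQ := bilinOn_l2Broken hbr
  have H : Admissible ρ c₀ hm.toLinearMap hA.toLinearMap hmQ.toLinearMap hB.toLinearMap :=
    { rho_pos := hρ
      c_pos := hc₀
      m_symm := fun x y => l2Vec_comm _ _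
      m_pos := fun x hx => l2Vec_pos hΩo hΩb x.2 fun h => hx (Subtype.ext h)
      A_symm := fun x y => hAs _ _
      A_nonneg := fun x => hA0 _ x.2
      mQ_symm := fun x y => l2Broken_comm _ _
      mQ_pos := fun x hx => l2Broken_pos hbr hinj x.2 fun h => hx (Subtype.ext h)
      B_nonneg := fun x => hB0 _ x.2 }
  obtain ⟨F₁, hF₁⟩ := ((hm.right u₀ hu₀).comp (timeEval (M.Vh r) k a)).exists_linearMap
  obtain ⟨F₂, hF₂⟩ := ((LinOn.radauQuad (k := k) hab fun t ht =>
    (hF t ht).comp (timeEval (M.Vh r) k t)).add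
    (((hm.right v₀ hv₀).comp (timeEval (M.Vh r) k a)).const_mul ρ)).exists_linearMap
  obtain ⟨F₃, hF₃⟩ := ((LinOn.radauQuad (k := k) hab fun t ht =>
    (hG t ht).comp (timeEval Q k t)).add
    (((hmQ.right p₀ hp₀).comp (timeEval Q k a)).const_mul c₀)).exists_linearMap
  -- For polynomials in time the local problem is the abstract one for their coefficients. Every
  -- solution has such coefficients, so existence and uniqueness both transfer.
  have hiff : ∀ (u v : Fin (k + 1) → M.Vh r) (p : Fin (k + 1) → Q),
      M.IsSolution br ρ c₀ k a b (M.Vh r) Q A C B Fr G u₀ v₀ p₀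
        (timePoly u, timePoly v, timePoly p) ↔
      ∀ Φ, localForm k a b ρ c₀ hm.toLinearMap hA.toLinearMap hmQ.toLinearMap hB.toLinearMap
        hC.toLinearMap (u, v, p) Φ = (F₁.coprod (F₂.coprod F₃)) Φ := fun u v p => by
    rw [localForm_eq_iff]
    simp only [IsSolution, forall_mem_polyTime_iff, dtVec_timePoly, dtBroken_timePoly, hF₁, hF₂,
      hF₃]
    simp only [mem_polyTime_iff.2 ⟨u, rfl⟩, mem_polyTime_iff.2 ⟨v, rfl⟩,
      mem_polyTime_iff.2 ⟨p, rfl⟩, true_and]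
    rfl
  obtain ⟨⟨u, v, p⟩, hU, huniq⟩ := existsUnique_localForm (C := hC.toLinearMap) hab H
    (F₁.coprod (F₂.coprod F₃))
  refine ⟨(timePoly u, timePoly v, timePoly p), (hiff u v p).2 hU, ?_⟩
  rintro ⟨u', v', p'⟩ hU'
  obtain ⟨u', rfl⟩ := mem_polyTime_iff.1 hU'.1
  obtain ⟨v', rfl⟩ := mem_polyTime_iff.1 hU'.2.1
  obtain ⟨p', rfl⟩ := mem_polyTime_iff.1 hU'.2.2.1
  obtain ⟨rfl, rfl, rfl⟩ : u' = u ∧ v' = v ∧ p' = p := by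
    have := huniq (u', v', p') ((hiff u' v' p').1 hU')
    simpa only [Prod.mk.injEq] using this
  rfl

end Solution

end Mesh

end Biot

end

/-! ### The choice of the threshold and the two pressure spaces. -/

theorem mainTheorem1
    (d : ℕ) (hd : d = 2 ∨ d = 3)
    (Ω : Set (Biot.E d)) (hΩo : IsOpen Ω) (hΩb : Bornology.IsBounded Ω)
    (Ct : Fin d → Fin d → Fin d → Fin d → ℝ)
    (hCsymm : ∀ i j k l, Ct i j k l = Ct k l i j)
    (hCpos : ∃ k₀ > 0, ∀ ξ : Fin d → Fin d → ℝ, (∀ i j, ξ i j = ξ j i) →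
      k₀ * ∑ i, ∑ j, (ξ i j) ^ 2 ≤ ∑ i, ∑ j, ∑ k, ∑ l, ξ i j * Ct i j k l * ξ k l)
    (Kp : Matrix (Fin d) (Fin d) ℝ) (hK : Kp.PosDef)
    (r : ℕ) (hr : 2 ≤ r) (κ : ℝ) :
    ∃ γ₀ > 0, ∀ γa ≥ γ₀, ∀ γb ≥ γ₀, ∀ γ ≥ γ₀,
    ∀ (M : Biot.Mesh d Ω) (h : ℝ), M.QuasiUniform κ h →
    ∀ (ΓuD ΓuN ΓpD ΓpN : Set (Biot.E d)), IsClosed ΓuD → IsClosed ΓpD →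
      ΓuD ∪ ΓuN = frontier Ω → ΓpD ∪ ΓpN = frontier Ω →
    ∀ (ρ α c₀ : ℝ), 0 < ρ → 0 < α → 0 < c₀ →
    ∀ (k N : ℕ) (T : ℝ) (tm : Fin (N + 1) → ℝ), StrictMono tm → tm 0 = 0 → tm (Fin.last N) = T →
    ∀ (f : ℝ → (Biot.E d → Biot.E d) →ₗ[ℝ] ℝ) (tN : ℝ → (ΓuN → Biot.E d) →ₗ[ℝ] ℝ)
      (uD vD : ℝ → Biot.E d → Biot.E d) (pD : ℝ → Biot.E d → ℝ),
      (∀ t ∈ Set.Ioc 0 T, MeasureTheory.MemLp (uD t) 2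
        ((MeasureTheory.Measure.euclideanHausdorffMeasure (d - 1)).restrict ΓuD)) →
      (∀ t ∈ Set.Ioc 0 T, MeasureTheory.MemLp (vD t) 2
        ((MeasureTheory.Measure.euclideanHausdorffMeasure (d - 1)).restrict ΓuD)) →
      (∀ t ∈ Set.Ioc 0 T, MeasureTheory.MemLp (pD t) 2
        ((MeasureTheory.Measure.euclideanHausdorffMeasure (d - 1)).restrict ΓpD)) →
    ∀ n : Fin N,
      (∀ (g : ℝ → (Biot.E d → ℝ) →ₗ[ℝ] ℝ) (pN : ℝ → (ΓpN → ℝ) →ₗ[ℝ] ℝ),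
        ∀ u₀ ∈ M.Vh r, ∀ v₀ ∈ M.Vh r, ∀ p₀ ∈ M.QhCont (r - 1),
          ∃! U, M.IsSolution M.toBroken ρ c₀ k (tm n.castSucc) (tm n.succ)
            (M.Vh r) (M.QhCont (r - 1))
            (M.formA Ct ΓuD γa) (M.formC α ΓuD) (M.formBCont Kp ΓpD γb)
            (fun t => M.rhsF Ct ΓuD ΓuN γa (f t) (tN t) (uD t))
            (fun t => M.rhsGCont α Kp ΓuD ΓpD ΓpN γb (g t) (pN t) (vD t) (pD t))
            u₀ v₀ p₀ U) ∧
      (∀ (g : ℝ → M.Broken →ₗ[ℝ] ℝ) (pN : ℝ → Biot.E d → ℝ),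
        (∀ t ∈ Set.Ioc 0 T, MeasureTheory.MemLp (pN t) 2
          ((MeasureTheory.Measure.euclideanHausdorffMeasure (d - 1)).restrict ΓpN)) →
        ∀ u₀ ∈ M.Vh r, ∀ v₀ ∈ M.Vh r, ∀ p₀ ∈ M.QhDisc (r - 1),
          ∃! U, M.IsSolution id ρ c₀ k (tm n.castSucc) (tm n.succ)
            (M.Vh r) (M.QhDisc (r - 1))
            (M.formA Ct ΓuD γa) (M.formC α ΓuD) (M.formBDisc Kp γ)
            (fun t => M.rhsF Ct ΓuD ΓuN γa (f t) (tN t) (uD t))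
            (fun t => M.rhsGDisc α Kp ΓuD ΓpD ΓpN γ (g t) (pN t) (vD t) (pD t))
            u₀ v₀ p₀ U) := by
  obtain ⟨k₀, hk₀, hCp⟩ := hCpos
  -- Three trace constants, for the numerators of strains of `ℚ_r` fields and of gradients of
  -- `ℚ_(r-1)` and `ℙ_(r-1)` pressures. A polynomial of degree `s` in each variable has total degree
  -- at most `d * s`, and the Jacobian adds `d * d`.
  obtain ⟨c₁, hc₁, H₁⟩ := Biot.Mesh.exists_trace_le Ω hΩb κ (d * r + d * d)
  obtain ⟨c₂, hc₂, H₂⟩ := Biot.Mesh.exists_trace_le Ω hΩb κ (d * (r - 1) + d * d)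
  obtain ⟨c₃, hc₃, H₃⟩ := Biot.Mesh.exists_trace_le Ω hΩb κ (r - 1 + d * d)
  -- The three absorption conditions together; the entry `1` keeps the threshold positive.
  refine ⟨max 1 (max (2 * d * c₁ * (∑ i, ∑ j, ∑ k, ∑ l, Ct i j k l ^ 2) / k₀)
    (max (2 * d * c₂ * Kp.trace) (4 * d * c₃ * Kp.trace))), lt_max_of_lt_left one_pos, ?_⟩
  intro γa hγa γb hγb γ hγ M h H ΓuD ΓuN ΓpD ΓpN hΓu hΓp _ _ ρ α c₀ hρ _ hc₀ k N T tm htm htm0 htmN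
    f tN uD vD pD huD hvD hpD n
  simp only [ge_iff_le, max_le_iff] at hγa hγb hγ
  have hab : tm n.castSucc < tm n.succ := htm Fin.castSucc_lt_succ
  have hsub : ∀ t ∈ Set.Ioc (tm n.castSucc) (tm n.succ), t ∈ Set.Ioc 0 T := fun t ht =>
    ⟨(htm0.symm.le.trans (htm.monotone (Fin.zero_le _))).trans_lt ht.1,
      ht.2.trans ((htm.monotone (Fin.le_last _)).trans htmN.le)⟩
  have hA := H.bilinOn_formA (r := r) hΓu Ct γa
  have hA0 : ∀ w ∈ M.Vh r, 0 ≤ M.formA Ct ΓuD γa w w := fun w hw =>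
    H.formA_nonneg hΓu (H₁ M h H) hc₁ hk₀ hCp (one_pos.trans_le hγa.1) hγa.2.1 hw
  refine ⟨fun g pN u₀ hu₀ v₀ hv₀ p₀ hp₀ => ?_, fun g pN hpN u₀ hu₀ v₀ hv₀ p₀ hp₀ => ?_⟩
  · refine Biot.Mesh.existsUnique_isSolution (br := M.toBrokenLin) hΩo hΩb hρ hc₀ hab
      (fun q hq K => Biot.Mesh.isMapped_toBrokenLin hq K)
      (fun q hq => Biot.Mesh.eq_zero_of_mem_QhCont hq) hA (Biot.Mesh.formA_comm hCsymm γa) hA0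
      (H.bilinOn_formC hΓu (fun q hq K => Biot.Mesh.isMapped_toBrokenLin hq K) α)
      (H.bilinOn_formBCont hΓp Kp γb) (fun q hq => ?_) (fun t ht => ?_) (fun t ht => ?_)
      hu₀ hv₀ hp₀
    · exact H.formBCont_nonneg hΓp (H₂ M h H) hc₂ hK (one_pos.trans_le hγb.1) hγb.2.2.1 hq
    · exact H.linOn_rhsF hΓu Ct ΓuN γa (f t) (tN t) (huD t (hsub t ht))
    · exact H.linOn_rhsGCont hΓu hΓp α Kp ΓpN γb (g t) (pN t) (hvD t (hsub t ht))
        (hpD t (hsub t ht))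
  · refine Biot.Mesh.existsUnique_isSolution (br := LinearMap.id) hΩo hΩb hρ hc₀ hab
      (fun q hq K => Biot.Mesh.isMapped_of_mem_QhDisc hq K)
      (fun q hq => Biot.Mesh.eq_zero_of_mem_QhDisc hq) hA (Biot.Mesh.formA_comm hCsymm γa) hA0
      (H.bilinOn_formC hΓu (br := LinearMap.id)
        (fun q hq K => Biot.Mesh.isMapped_of_mem_QhDisc hq K) α)
      (H.bilinOn_formBDisc Kp γ) (fun q hq => ?_) (fun t ht => ?_) (fun t ht => ?_) hu₀ hv₀ hp₀
    · exact H.formBDisc_nonneg (H₃ M h H) hc₃ hK (one_pos.trans_le hγ.1) hγ.2.2.2 hq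
    · exact H.linOn_rhsF hΓu Ct ΓuN γa (f t) (tN t) (huD t (hsub t ht))
    · exact H.linOn_rhsGDisc α Kp γ (g t) (hpN t (hsub t ht)) (hvD t (hsub t ht))
        (hpD t (hsub t ht))
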